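/- **Graph Search Problem (costs independent of the target).** Let $G$ be a finite simple connected graph with $n$ vertices, $c\colon V(G)\to\mathbb N$ a query cost function and $w\colon V(G)\to\mathbb N$ a weight function; write $c(G)=\sum_v c(v)$, $w(G)=\sum_v w(v)$. A *decision tree* for a connected vertex set $S$ (at the start $S=V(G)$) consists of a root, which queries some $r\in S$, and, for each connected component of $G[S]-r$, exactly one edge from the root to a decision tree for that component. For a target $x$ let $Q_G(D,x)$ be the sequence of queries on the path of $D$ from the root to $x$. The cost of $D$ is $$c_G(D)=\sum_{x\in V(G)}w(x)\sum_{q\in Q_G(D,x)}c(q),$$ and $\mathrm{OPT}(G)$ is the minimum cost of a decision tree. A leaf is a vertex of degree one. **Theorem.** There is a single algorithm which, given a rational $0<\varepsilon\le 1$ and an instance $(G,c,w)$ in which $G$ has $k\ge 1$ non-leaf vertices and $c(G)\ge 2$, outputs a decision tree $D$ with $$c_G(D)\le(1+\varepsilon)\cdot \mathrm{OPT}(G).$$ With an absolute constant in the $O$ (independent of $\varepsilon,n,k,c,w$) its running time is $$O\!\left(\frac{k\cdot n^{4k+2}\cdot\log_2^{2k}c(G)}{\log_2^{2k}(1+\varepsilon)}\right),$$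 so that for every fixed $k$ it is an FPTAS; and for every fixed $\varepsilon$, with a constant in the $O_\varepsilon$ that depends only on $\varepsilon$ (not on $n,k,c,w$), its running time is $$O_\varepsilon\!\left(\frac{k\cdot n^{4k+2}\cdot\log_2^{2k}c(G)}{\log_2^{k}(1+\varepsilon)}\right).$$ Running time is the number of steps of a random access machine with the unit-cost operations $+$, truncated $-$, $\cdot$, integer division, remainder, comparison, and reads and writes of registers and of array cells, in which every number and every address that occurs is at most $(n+c(G)+w(G)+q)^{A k}$, where $q$ is the denominator of $\varepsilon$ in lowest terms and $A$ is an absolute constant (words of $O(k\log(n+c(G)+w(G)+q))$ bits). The input consists of $n$, of the numerator and denominator of $\varepsilon$, of the adjacency matrix of $G$, and of the tables of $c$ and $w$; the output is the table of the parents of the nodes of $D$. -/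

import Mathlib

namespace GraphSearch

/-! ### Decision trees and their cost -/

/-- `DecisionTree G S` is the type of decision trees for the candidate set `S`: the root queries a
vertex `r` of `S`, and for every response other than "`r` is the target", that is, for every
connected component `K` of `G[S] - r`, there is exactly one edge from the root to a decision tree
for the vertex set of `K`. -/
inductive DecisionTree {V : Type*} (G : SimpleGraph V) : Set V → Type _
  | query {S : Set V} (r : V) (hr : r ∈ S)
      (next : ∀ K : (G.induce (S \ {r})).ConnectedComponent,
        DecisionTree G (Subtype.val '' K.supp)) : DecisionTree G S

open Classical in
/-- The sequence of queries from the root of the decision tree to the target `x`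
(only meaningful for `x` in the candidate set). -/
noncomputable def DecisionTree.queries {V : Type*} {G : SimpleGraph V} :
    {S : Set V} → DecisionTree G S → V → List V
  | S, .query r _ next, x =>
      r :: (if h : x ∈ S \ {r} then
        (next ((G.induce (S \ {r})).connectedComponentMk ⟨x, h⟩)).queries x
      else [])

/-- The cost of searching for the target `x`, for query costs that do not depend on the target. -/
noncomputable def DecisionTree.costAt {V : Type*} {G : SimpleGraph V} {S : Set V}
    (D : DecisionTree G S) (c : V → ℕ) (x : V) : ℕ :=
  ((D.queries x).map c).sum

/-- The weighted average-case cost of a decision tree for the whole graph. -/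
noncomputable def DecisionTree.cost {V : Type*} [Fintype V] {G : SimpleGraph V}
    (D : DecisionTree G Set.univ) (c w : V → ℕ) : ℕ :=
  ∑ x, w x * D.costAt c x

/-- The parent of the node `x` in the decision tree, i.e. the query made directly before `x` is
queried; `none` for the root. -/
noncomputable def DecisionTree.parent {V : Type*} {G : SimpleGraph V} {S : Set V}
    (D : DecisionTree G S) (x : V) : Option V :=
  (D.queries x).dropLast.getLast?

/-- The number of vertices that are not leaves (a leaf is a vertex of degree one). -/
noncomputable def nonLeafCount {V : Type*} (G : SimpleGraph V) : ℕ :=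
  {v : V | (G.neighborSet v).ncard ≠ 1}.ncard

/-! ### The machine model: a random access machine with bounded word size

Programs are written in a structured language. A program uses finitely many registers and finitely
many random access arrays, all of them initially `0` outside the input; registers and array cells
hold natural numbers. -/

/-- The arithmetic operations and tests of the machine. Subtraction is truncated at `0`; tests have
the value `1` or `0`. -/
inductive Op
  | add | sub | mul | div | mod | lt | eq

/-- The value of an operation. -/
def Op.eval : Op → ℕ → ℕ → ℕ
  | .add, a, b => a + b
  | .sub, a, b => a - b
  | .mul, a, b => a * b
  | .div, a, b => a / b
  | .mod, a, b => a % b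
  | .lt, a, b => if a < b then 1 else 0
  | .eq, a, b => if a = b then 1 else 0

/-- Expressions: constants, registers, array cells `a[i]`, operations. -/
inductive Expr
  | lit (m : ℕ)
  | var (x : ℕ)
  | get (a : ℕ) (i : Expr)
  | op (o : Op) (e₁ e₂ : Expr)

/-- Programs. -/
inductive Program
  | skip
  | assign (x : ℕ) (e : Expr)
  | store (a : ℕ) (i e : Expr)
  | seq (p₁ p₂ : Program)
  | ite (e : Expr) (p₁ p₂ : Program)
  | loop (e : Expr) (p : Program)

/-- The content of the registers and of the arrays. -/
@[ext] structure State where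
  reg : ℕ → ℕ
  arr : ℕ → ℕ → ℕ

/-- The value of an expression. -/
def Expr.eval (σ : State) : Expr → ℕ
  | .lit m => m
  | .var x => σ.reg x
  | .get a i => σ.arr a (i.eval σ)
  | .op o e₁ e₂ => o.eval (e₁.eval σ) (e₂.eval σ)

/-- The number of elementary operations needed to evaluate an expression. -/
def Expr.size : Expr → ℕ
  | .lit _ => 1
  | .var _ => 1
  | .get _ i => i.size + 1
  | .op _ e₁ e₂ => e₁.size + e₂.size + 1

/-- All values (in particular all addresses) that occur in the evaluation of the expression are at
most `B`. -/
def Expr.Fits (B : ℕ) (σ : State) : Expr → Prop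
  | .lit m => m ≤ B
  | .var x => σ.reg x ≤ B
  | .get a i => i.Fits B σ ∧ σ.arr a (i.eval σ) ≤ B
  | .op o e₁ e₂ => e₁.Fits B σ ∧ e₂.Fits B σ ∧ o.eval (e₁.eval σ) (e₂.eval σ) ≤ B

/-- The state after register `x` has been set to `m`. -/
def State.setReg (σ : State) (x m : ℕ) : State :=
  { σ with reg := Function.update σ.reg x m }

/-- The state after cell `i` of array `a` has been set to `m`. -/
def State.setArr (σ : State) (a i m : ℕ) : State :=
  { σ with arr := Function.update σ.arr a (Function.update (σ.arr a) i m) }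

/-- `Exec B p σ t τ`: on a machine whose words hold the numbers `0, …, B`, the program `p` started
in the state `σ` halts in the state `τ` after exactly `t` steps, and no overflow occurs. -/
inductive Exec (B : ℕ) : Program → State → ℕ → State → Prop
  | skip (σ : State) : Exec B .skip σ 1 σ
  | assign (σ : State) (x : ℕ) (e : Expr) (he : e.Fits B σ) :
      Exec B (.assign x e) σ (e.size + 1) (σ.setReg x (e.eval σ))
  | store (σ : State) (a : ℕ) (i e : Expr) (hi : i.Fits B σ) (he : e.Fits B σ) :
      Exec B (.store a i e) σ (i.size + e.size + 1) (σ.setArr a (i.eval σ) (e.eval σ))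
  | seq {σ₁ σ₂ σ₃ : State} {p₁ p₂ : Program} {t₁ t₂ : ℕ}
      (h₁ : Exec B p₁ σ₁ t₁ σ₂) (h₂ : Exec B p₂ σ₂ t₂ σ₃) :
      Exec B (.seq p₁ p₂) σ₁ (t₁ + t₂) σ₃
  | iteTrue {σ₁ σ₂ : State} {e : Expr} {p₁ p₂ : Program} {t : ℕ}
      (he : e.Fits B σ₁) (hv : e.eval σ₁ ≠ 0) (h : Exec B p₁ σ₁ t σ₂) :
      Exec B (.ite e p₁ p₂) σ₁ (e.size + 1 + t) σ₂
  | iteFalse {σ₁ σ₂ : State} {e : Expr} {p₁ p₂ : Program} {t : ℕ}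
      (he : e.Fits B σ₁) (hv : e.eval σ₁ = 0) (h : Exec B p₂ σ₁ t σ₂) :
      Exec B (.ite e p₁ p₂) σ₁ (e.size + 1 + t) σ₂
  | loopDone {σ : State} {e : Expr} {p : Program}
      (he : e.Fits B σ) (hv : e.eval σ = 0) :
      Exec B (.loop e p) σ (e.size + 1) σ
  | loopStep {σ₁ σ₂ σ₃ : State} {e : Expr} {p : Program} {t₁ t₂ : ℕ}
      (he : e.Fits B σ₁) (hv : e.eval σ₁ ≠ 0)
      (h₁ : Exec B p σ₁ t₁ σ₂) (h₂ : Exec B (.loop e p) σ₂ t₂ σ₃) :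
      Exec B (.loop e p) σ₁ (e.size + 1 + t₁ + t₂) σ₃

/-! ### Input and output -/

open Classical in
/-- The input of the machine. Registers `0`, `1`, `2` hold the number `n` of vertices and the
numerator and the denominator of `ε`; array `0` holds the adjacency matrix of `G`, row by row,
array `1` the costs and array `2` the weights. Everything else is `0`. -/
noncomputable def inputState (ε : ℚ) {n : ℕ} (G : SimpleGraph (Fin n)) (c w : Fin n → ℕ) :
    State where
  reg x := if x = 0 then n else if x = 1 then ε.num.toNat else if x = 2 then ε.den else 0
  arr a i :=
    if a = 0 then (if ∃ u v : Fin n, G.Adj u v ∧ i = u * n + v then 1 else 0)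
    else if a = 1 then (if h : i < n then c ⟨i, h⟩ else 0)
    else if a = 2 then (if h : i < n then w ⟨i, h⟩ else 0)
    else 0

/-- The state holds the decision tree `D` as output: array `3` is its table of parents, with the
entry `0` at the root and the entry `u + 1` at the nodes with parent `u`. -/
def Outputs {n : ℕ} {G : SimpleGraph (Fin n)} (σ : State) (D : DecisionTree G Set.univ) : Prop :=
  ∀ v : Fin n, σ.arr 3 v = (D.parent v).elim 0 (fun u => (u : ℕ) + 1)

end GraphSearch

namespace GraphSearch

/-! ### Reasoning about programs -/

/-! A decision tree amounts to a ranking of the vertices: always query the candidate with the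
smallest key (`exists_decisionTree`). In that tree `y` is an ancestor of `x` exactly when a walk
joins them through vertices whose keys are at least the key of `y`. Since every leaf hangs on an
inner vertex, only two things matter: the order of the `k` inner vertices, and for each leaf whether
it is queried after its neighbour or immediately before some inner ancestor.

The algorithm guesses the depths of the inner vertices (`n ^ k` guesses `P`) and, for each inner
vertex, the cost of the leaves queried immediately before it, rounded to a grid of `m` loads (`m ^
k` guesses `S`). The guesses fix the cost of everything above a vertex, so the decisions about the
leaves interact only through the loads accumulated so far. Leaves in front of the same inner vertex
are best ordered by the ratio of cost to weight (Smith's rule), so a dynamic program that visits the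
vertices in this order, with the load vectors as states, finds the best decisions.

Correctness has two halves. By `Setup.cost_le_value` the optimal path of the dynamic program is
realised by a tree that costs at most its nominal value, because loads are only rounded up. By
`Setup.value_le` every tree `D` is matched up to `1 + ε`: let `P` be its depths. Then the ancestors
predicted by `P` are ancestors in `D` (`Setup.mem_queries_of_above`), each leaf is assigned to the
first suitable inner vertex queried after it (`Setup.exists_assignment`), and an exchange argument
over pairs of leaves shows that Smith's order costs no more (`Setup.sum_baseCost_le`). A load is
rounded at most `n` times, each time by a factor of at most `1 + ε / (2 n)`, which is harmless by
`one_add_div_pow_le`.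

For the running time, `gridSize_le` makes `m` at most a constant times `n log c(G) / log (1 + ε)`.
One pair of guesses takes `O(m ^ k n ^ 2 + n ^ 3)` steps, hence everything takes a constant times `n
^ (k + 2) m ^ (2 k)`. This has the exponent `3 k + 2` of `n`, and the spare factor `n ^ k` of the
claim absorbs either `529 ^ k` or `(529 / log (1 + ε)) ^ k`, because `k ≤ n` (`exists_pow_le`);
these two choices give the two bounds.

The program is verified in a small logic `Wp` of total correctness with time bounds. Only written
values have to be bounded there; `Run.exec` deduces the bound for all intermediate values. -/

instance : Add Expr := ⟨.op .add⟩
instance : Sub Expr := ⟨.op .sub⟩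
instance : Mul Expr := ⟨.op .mul⟩
instance : Div Expr := ⟨.op .div⟩
instance : Mod Expr := ⟨.op .mod⟩
instance (m : ℕ) : OfNat Expr m := ⟨.lit m⟩

/-- The test `e₁ < e₂`. -/
def Expr.less (e₁ e₂ : Expr) : Expr := .op .lt e₁ e₂

/-- The test `e₁ = e₂`. -/
def Expr.same (e₁ e₂ : Expr) : Expr := .op .eq e₁ e₂

/-- The minimum of two values, computed with truncated subtraction. -/
def Expr.minimum (e₁ e₂ : Expr) : Expr := e₁ - (e₁ - e₂)

/-- The maximum of two values, computed with truncated subtraction. -/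
def Expr.maximum (e₁ e₂ : Expr) : Expr := e₁ + (e₂ - e₁)

/-! ### Simplification rules for expressions and states -/

section Eval
variable (σ : State) (a b : Expr)
@[simp] theorem eval_add : (a + b).eval σ = a.eval σ + b.eval σ := rfl
@[simp] theorem eval_sub : (a - b).eval σ = a.eval σ - b.eval σ := rfl
@[simp] theorem eval_mul : (a * b).eval σ = a.eval σ * b.eval σ := rfl
@[simp] theorem eval_div : (a / b).eval σ = a.eval σ / b.eval σ := rfl
@[simp] theorem eval_mod : (a % b).eval σ = a.eval σ % b.eval σ := rfl
@[simp] theorem eval_less : (a.less b).eval σ = if a.eval σ < b.eval σ then 1 else 0 := rfl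
@[simp] theorem eval_same : (a.same b).eval σ = if a.eval σ = b.eval σ then 1 else 0 := rfl
@[simp] theorem eval_minimum : (a.minimum b).eval σ = min (a.eval σ) (b.eval σ) := by
  simp only [Expr.minimum, eval_sub]; omega
@[simp] theorem eval_maximum : (a.maximum b).eval σ = max (a.eval σ) (b.eval σ) := by
  simp only [Expr.maximum, eval_sub, eval_add]; omega
@[simp] theorem eval_zero : (0 : Expr).eval σ = 0 := rfl
@[simp] theorem eval_one : (1 : Expr).eval σ = 1 := rfl
@[simp] theorem eval_two : (2 : Expr).eval σ = 2 := rfl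
@[simp] theorem eval_var (x : ℕ) : (Expr.var x).eval σ = σ.reg x := rfl
@[simp] theorem eval_get (x : ℕ) : (Expr.get x a).eval σ = σ.arr x (a.eval σ) := rfl
@[simp] theorem size_add : (a + b).size = a.size + b.size + 1 := rfl
@[simp] theorem size_sub : (a - b).size = a.size + b.size + 1 := rfl
@[simp] theorem size_mul : (a * b).size = a.size + b.size + 1 := rfl
@[simp] theorem size_div : (a / b).size = a.size + b.size + 1 := rfl
@[simp] theorem size_less : (a.less b).size = a.size + b.size + 1 := rfl
@[simp] theorem size_same : (a.same b).size = a.size + b.size + 1 := rfl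
@[simp] theorem size_maximum : (a.maximum b).size = a.size + (b.size + a.size + 1) + 1 := rfl
@[simp] theorem size_zero : (0 : Expr).size = 1 := rfl
@[simp] theorem size_one : (1 : Expr).size = 1 := rfl
@[simp] theorem size_two : (2 : Expr).size = 1 := rfl
@[simp] theorem size_var (x : ℕ) : (Expr.var x).size = 1 := rfl
@[simp] theorem size_get (x : ℕ) : (Expr.get x a).size = a.size + 1 := rfl
end Eval

section Update
variable (σ : State)
@[simp] theorem setReg_reg (x m y : ℕ) :
    (σ.setReg x m).reg y = if y = x then m else σ.reg y := by
  simp [State.setReg, Function.update_apply]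
@[simp] theorem setReg_arr (x m : ℕ) : (σ.setReg x m).arr = σ.arr := rfl
@[simp] theorem setArr_reg (a i m : ℕ) : (σ.setArr a i m).reg = σ.reg := rfl
@[simp] theorem setArr_arr (a i m b j : ℕ) :
    (σ.setArr a i m).arr b j = if b = a ∧ j = i then m else σ.arr b j := by
  by_cases h : b = a
  · subst h; simp [State.setArr, Function.update_apply]
  · simp [State.setArr, h]
end Update

/-- The largest constant of an expression. -/
def Expr.maxLit : Expr → ℕ
  | .lit m => m
  | .var _ => 0
  | .get _ i => i.maxLit
  | .op _ e₁ e₂ => max e₁.maxLit e₂.maxLit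

/-- All expressions of a program have at most `s` nodes and constants at most `s`. -/
def Program.small (s : ℕ) : Program → Bool
  | .skip => true
  | .assign _ e => e.size ≤ s && e.maxLit ≤ s
  | .store _ i e => i.size ≤ s && i.maxLit ≤ s && (e.size ≤ s && e.maxLit ≤ s)
  | .seq p q => p.small s && q.small s
  | .ite e p q => e.size ≤ s && e.maxLit ≤ s && (p.small s && q.small s)
  | .loop e p => e.size ≤ s && e.maxLit ≤ s && p.small s

/-- All registers and array cells hold numbers at most `N`. -/
def State.Bounded (N : ℕ) (σ : State) : Prop := (∀ x, σ.reg x ≤ N) ∧ ∀ a i, σ.arr a i ≤ N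

/-! ### From bounds for written values to the word size -/

theorem Expr.Fits.mono {B B' : ℕ} (h : B ≤ B') {σ : State} {e : Expr} (he : e.Fits B σ) :
    e.Fits B' σ := by
  induction e with
  | lit m => exact le_trans he h
  | var x => exact le_trans he h
  | get a i ih => exact ⟨ih he.1, he.2.trans h⟩
  | op o a b iha ihb => exact ⟨iha he.1, ihb he.2.1, he.2.2.trans h⟩

/-- The extra factor `N ≥ 2` pays for addition, where a sum of two numbers can reach twice their
product; all other operations need less. -/
theorem Op.eval_le (o : Op) {N a b x y : ℕ} (hN : 2 ≤ N) (ha : a ≤ N ^ x) (hb : b ≤ N ^ y) :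
    o.eval a b ≤ N ^ (x + y + 1) := by
  have hx : 1 ≤ N ^ x := Nat.one_le_pow _ _ (by omega)
  have hy : 1 ≤ N ^ y := Nat.one_le_pow _ _ (by omega)
  have hxy : N ^ x * N ^ y * 2 ≤ N ^ (x + y + 1) := by
    rw [pow_succ, pow_add]; exact Nat.mul_le_mul_left _ hN
  have h1 : N ^ x ≤ N ^ x * N ^ y := Nat.le_mul_of_pos_right _ hy
  have h2 : N ^ y ≤ N ^ x * N ^ y := Nat.le_mul_of_pos_left _ hx
  cases o with
  | add => simp only [Op.eval]; omega
  | sub => simp only [Op.eval]; omega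
  | mul => simp only [Op.eval]; exact (Nat.mul_le_mul ha hb).trans (by omega)
  | div => simp only [Op.eval]; exact (Nat.div_le_self _ _).trans (by omega)
  | mod => simp only [Op.eval]; exact (Nat.mod_le _ _).trans (by omega)
  | lt => simp only [Op.eval]; split <;> omega
  | eq => simp only [Op.eval]; split <;> omega

/-- Every constant, register or cell contributes at most one factor `N`, and so does every
operation, so the size of the expression bounds the exponent. -/
theorem Expr.fits_pow_size {N : ℕ} (hN : 2 ≤ N) {σ : State} (hσ : σ.Bounded N) {e : Expr}
    (he : e.maxLit ≤ N) : e.Fits (N ^ e.size) σ ∧ e.eval σ ≤ N ^ e.size := by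
  induction e with
  | lit m => exact ⟨by simpa [Fits, size, maxLit] using he, by simpa [eval, size, maxLit] using he⟩
  | var x => exact ⟨by simpa [Fits, size] using hσ.1 x, by simpa [eval, size] using hσ.1 x⟩
  | get a i ih =>
    obtain ⟨h1, -⟩ := ih he
    have hv : σ.arr a (i.eval σ) ≤ N ^ (i.size + 1) :=
      (hσ.2 _ _).trans (Nat.le_self_pow (by omega) N)
    exact ⟨⟨h1.mono (Nat.pow_le_pow_right (by omega) (by simp [size])), hv⟩, hv⟩
  | op o a b iha ihb =>
    simp only [maxLit, max_le_iff] at he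
    obtain ⟨h1, h1'⟩ := iha he.1
    obtain ⟨h2, h2'⟩ := ihb he.2
    have hv := o.eval_le hN h1' h2'
    exact ⟨⟨h1.mono (Nat.pow_le_pow_right (by omega) (by simp only [size]; omega)),
      h2.mono (Nat.pow_le_pow_right (by omega) (by simp only [size]; omega)), hv⟩, hv⟩

/-- `Run N p σ t τ`: the program `p` started in `σ` halts in `τ` after `t` steps, and all values
that are written are at most `N`. -/
inductive Run (N : ℕ) : Program → State → ℕ → State → Prop
  | skip (σ : State) : Run N .skip σ 1 σ
  | assign (σ : State) (x : ℕ) (e : Expr) (he : e.eval σ ≤ N) :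
      Run N (.assign x e) σ (e.size + 1) (σ.setReg x (e.eval σ))
  | store (σ : State) (a : ℕ) (i e : Expr) (he : e.eval σ ≤ N) :
      Run N (.store a i e) σ (i.size + e.size + 1) (σ.setArr a (i.eval σ) (e.eval σ))
  | seq {σ₁ σ₂ σ₃ : State} {p₁ p₂ : Program} {t₁ t₂ : ℕ}
      (h₁ : Run N p₁ σ₁ t₁ σ₂) (h₂ : Run N p₂ σ₂ t₂ σ₃) :
      Run N (.seq p₁ p₂) σ₁ (t₁ + t₂) σ₃
  | iteTrue {σ₁ σ₂ : State} {e : Expr} {p₁ p₂ : Program} {t : ℕ}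
      (hv : e.eval σ₁ ≠ 0) (h : Run N p₁ σ₁ t σ₂) :
      Run N (.ite e p₁ p₂) σ₁ (e.size + 1 + t) σ₂
  | iteFalse {σ₁ σ₂ : State} {e : Expr} {p₁ p₂ : Program} {t : ℕ}
      (hv : e.eval σ₁ = 0) (h : Run N p₂ σ₁ t σ₂) :
      Run N (.ite e p₁ p₂) σ₁ (e.size + 1 + t) σ₂
  | loopDone {σ : State} {e : Expr} {p : Program} (hv : e.eval σ = 0) :
      Run N (.loop e p) σ (e.size + 1) σ
  | loopStep {σ₁ σ₂ σ₃ : State} {e : Expr} {p : Program} {t₁ t₂ : ℕ} (hv : e.eval σ₁ ≠ 0)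
      (h₁ : Run N p σ₁ t₁ σ₂) (h₂ : Run N (.loop e p) σ₂ t₂ σ₃) :
      Run N (.loop e p) σ₁ (e.size + 1 + t₁ + t₂) σ₃

theorem State.Bounded.setReg {N : ℕ} {σ : State} (h : σ.Bounded N) (x : ℕ) {m : ℕ} (hm : m ≤ N) :
    (σ.setReg x m).Bounded N :=
  ⟨fun y => by rw [setReg_reg]; split; exacts [hm, h.1 y], h.2⟩

theorem State.Bounded.setArr {N : ℕ} {σ : State} (h : σ.Bounded N) (a i : ℕ) {m : ℕ}
    (hm : m ≤ N) : (σ.setArr a i m).Bounded N :=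
  ⟨h.1, fun b j => by rw [setArr_arr]; split; exacts [hm, h.2 b j]⟩

/-- This frees the correctness proofs from overflow: a fixed program has expressions of bounded
size, so bounded memory contents keep all intermediate values below a fixed power of `N`. -/
theorem Run.exec {N s : ℕ} (hN : 2 ≤ N) (hsN : s ≤ N) {p : Program} {σ τ : State} {t : ℕ}
    (h : Run N p σ t τ) (hp : p.small s = true) (hσ : σ.Bounded N) :
    Exec (N ^ s) p σ t τ ∧ τ.Bounded N := by
  have key : ∀ {σ : State} {e : Expr}, σ.Bounded N → e.size ≤ s → e.maxLit ≤ s →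
      e.Fits (N ^ s) σ := fun {σ e} hσ h1 h2 =>
    (Expr.fits_pow_size hN hσ (h2.trans hsN)).1.mono (Nat.pow_le_pow_right (by omega) h1)
  induction h with
  | skip σ => exact ⟨.skip σ, hσ⟩
  | assign σ x e he =>
    simp only [Program.small, Bool.and_eq_true, decide_eq_true_eq] at hp
    exact ⟨.assign σ x e (key hσ hp.1 hp.2), hσ.setReg x he⟩
  | store σ a i e he =>
    simp only [Program.small, Bool.and_eq_true, decide_eq_true_eq] at hp
    exact ⟨.store σ a i e (key hσ hp.1.1 hp.1.2) (key hσ hp.2.1 hp.2.2), hσ.setArr a _ he⟩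
  | seq _ _ ih₁ ih₂ =>
    simp only [Program.small, Bool.and_eq_true] at hp
    obtain ⟨h1, hb⟩ := ih₁ hp.1 hσ
    obtain ⟨h2, hb'⟩ := ih₂ hp.2 hb
    exact ⟨.seq h1 h2, hb'⟩
  | iteTrue hv _ ih =>
    simp only [Program.small, Bool.and_eq_true, decide_eq_true_eq] at hp
    obtain ⟨h1, hb⟩ := ih hp.2.1 hσ
    exact ⟨.iteTrue (key hσ hp.1.1 hp.1.2) hv h1, hb⟩
  | iteFalse hv _ ih =>
    simp only [Program.small, Bool.and_eq_true, decide_eq_true_eq] at hp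
    obtain ⟨h1, hb⟩ := ih hp.2.2 hσ
    exact ⟨.iteFalse (key hσ hp.1.1 hp.1.2) hv h1, hb⟩
  | loopDone hv =>
    simp only [Program.small, Bool.and_eq_true, decide_eq_true_eq] at hp
    exact ⟨.loopDone (key hσ hp.1.1 hp.1.2) hv, hσ⟩
  | loopStep hv _ _ ih₁ ih₂ =>
    have hp' := hp
    simp only [Program.small, Bool.and_eq_true, decide_eq_true_eq] at hp
    obtain ⟨h1, hb⟩ := ih₁ hp.2 hσ
    obtain ⟨h2, hb'⟩ := ih₂ hp' hb
    exact ⟨.loopStep (key hσ hp.1.1 hp.1.2) hv h1 h2, hb'⟩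

/-- Whether a program writes the register `x`. -/
def Program.writesReg (x : ℕ) : Program → Bool
  | .skip => false
  | .assign y _ => y == x
  | .store _ _ _ => false
  | .seq p q => p.writesReg x || q.writesReg x
  | .ite _ p q => p.writesReg x || q.writesReg x
  | .loop _ p => p.writesReg x

/-- Whether a program writes the array `a`. -/
def Program.writesArr (a : ℕ) : Program → Bool
  | .skip => false
  | .assign _ _ => false
  | .store b _ _ => b == a
  | .seq p q => p.writesArr a || q.writesArr a
  | .ite _ p q => p.writesArr a || q.writesArr a
  | .loop _ p => p.writesArr a

/-- The states agree outside of what `p` writes. -/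
structure Frame (p : Program) (σ τ : State) : Prop where
  reg : ∀ x, p.writesReg x = false → τ.reg x = σ.reg x
  arr : ∀ a, p.writesArr a = false → τ.arr a = σ.arr a

/-- What a program may write can be read off its syntax by a Boolean function. Later facts of the
form "this register is unchanged" therefore have side conditions that `rfl` proves. -/
theorem Run.frame {N : ℕ} {p : Program} {σ τ : State} {t : ℕ} (h : Run N p σ t τ) :
    Frame p σ τ := by
  induction h with
  | skip σ => exact ⟨fun _ _ => rfl, fun _ _ => rfl⟩
  | assign σ x e he =>
    refine ⟨fun y hy => ?_, fun _ _ => rfl⟩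
    simp only [Program.writesReg, beq_eq_false_iff_ne, ne_eq] at hy
    simp [Ne.symm hy]
  | store σ a i e he =>
    refine ⟨fun _ _ => rfl, fun b hb => ?_⟩
    simp only [Program.writesArr, beq_eq_false_iff_ne, ne_eq] at hb
    funext j
    simp [Ne.symm hb]
  | seq _ _ ih₁ ih₂ =>
    refine ⟨fun x hx => ?_, fun a ha => ?_⟩
    · simp only [Program.writesReg, Bool.or_eq_false_iff] at hx
      rw [ih₂.reg x hx.2, ih₁.reg x hx.1]
    · simp only [Program.writesArr, Bool.or_eq_false_iff] at ha
      rw [ih₂.arr a ha.2, ih₁.arr a ha.1]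
  | iteTrue hv _ ih =>
    refine ⟨fun x hx => ?_, fun a ha => ?_⟩
    · simp only [Program.writesReg, Bool.or_eq_false_iff] at hx
      exact ih.reg x hx.1
    · simp only [Program.writesArr, Bool.or_eq_false_iff] at ha
      exact ih.arr a ha.1
  | iteFalse hv _ ih =>
    refine ⟨fun x hx => ?_, fun a ha => ?_⟩
    · simp only [Program.writesReg, Bool.or_eq_false_iff] at hx
      exact ih.reg x hx.2
    · simp only [Program.writesArr, Bool.or_eq_false_iff] at ha
      exact ih.arr a ha.2
  | loopDone hv => exact ⟨fun _ _ => rfl, fun _ _ => rfl⟩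
  | loopStep hv _ _ ih₁ ih₂ =>
    refine ⟨fun x hx => ?_, fun a ha => ?_⟩
    · rw [ih₂.reg x hx, ih₁.reg x hx]
    · rw [ih₂.arr a ha, ih₁.arr a ha]

/-- The program `p` started in `σ` halts within `T` steps in a state with property `Q`, and all
values that are written are at most `N`. -/
def Wp (N : ℕ) (p : Program) (T : ℕ) (σ : State) (Q : State → Prop) : Prop :=
  ∃ t τ, Run N p σ t τ ∧ t ≤ T ∧ Q τ

/-! ### Rules for total correctness with time bounds -/

namespace Wp
variable {N T T₁ T₂ : ℕ} {p q : Program} {σ : State} {Q Q₁ : State → Prop}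

theorem mono (h : Wp N p T₁ σ Q₁) (hT : T₁ ≤ T) (hQ : ∀ τ, Frame p σ τ → Q₁ τ → Q τ) :
    Wp N p T σ Q := by
  obtain ⟨t, τ, hr, ht, hq⟩ := h
  exact ⟨t, τ, hr, ht.trans hT, hQ τ hr.frame hq⟩

theorem skip (hT : 1 ≤ T) (hQ : Q σ) : Wp N .skip T σ Q := ⟨1, σ, .skip σ, hT, hQ⟩

theorem assign {x : ℕ} {e : Expr} (he : e.eval σ ≤ N) (hT : e.size + 1 ≤ T)
    (hQ : Q (σ.setReg x (e.eval σ))) : Wp N (.assign x e) T σ Q :=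
  ⟨_, _, .assign σ x e he, hT, hQ⟩

theorem store {a : ℕ} {i e : Expr} (he : e.eval σ ≤ N) (hT : i.size + e.size + 1 ≤ T)
    (hQ : Q (σ.setArr a (i.eval σ) (e.eval σ))) : Wp N (.store a i e) T σ Q :=
  ⟨_, _, .store σ a i e he, hT, hQ⟩

theorem seq (T₁ T₂ : ℕ) (h₁ : Wp N p T₁ σ Q₁) (hT : T₁ + T₂ ≤ T)
    (h₂ : ∀ τ, Frame p σ τ → Q₁ τ → Wp N q T₂ τ Q) : Wp N (.seq p q) T σ Q := by
  obtain ⟨t, τ, hr, ht, hq⟩ := h₁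
  obtain ⟨t', τ', hr', ht', hq'⟩ := h₂ τ hr.frame hq
  exact ⟨_, τ', .seq hr hr', by omega, hq'⟩

theorem assign_seq {x : ℕ} {e : Expr} (he : e.eval σ ≤ N) (hT : e.size + 1 + T₂ ≤ T)
    (h₂ : Wp N q T₂ (σ.setReg x (e.eval σ)) Q) : Wp N (.seq (.assign x e) q) T σ Q := by
  obtain ⟨t', τ', hr', ht', hq'⟩ := h₂
  exact ⟨_, τ', .seq (.assign σ x e he) hr', by omega, hq'⟩

theorem store_seq {a : ℕ} {i e : Expr} (he : e.eval σ ≤ N) (hT : i.size + e.size + 1 + T₂ ≤ T)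
    (h₂ : Wp N q T₂ (σ.setArr a (i.eval σ) (e.eval σ)) Q) :
    Wp N (.seq (.store a i e) q) T σ Q := by
  obtain ⟨t', τ', hr', ht', hq'⟩ := h₂
  exact ⟨_, τ', .seq (.store σ a i e he) hr', by omega, hq'⟩

theorem ite (T₁ : ℕ) {e : Expr} (hT : e.size + 1 + T₁ ≤ T) (h₁ : e.eval σ ≠ 0 → Wp N p T₁ σ Q)
    (h₂ : e.eval σ = 0 → Wp N q T₁ σ Q) : Wp N (.ite e p q) T σ Q := by
  by_cases h : e.eval σ = 0
  · obtain ⟨t, τ, hr, ht, hq⟩ := h₂ h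
    exact ⟨_, τ, .iteFalse h hr, by omega, hq⟩
  · obtain ⟨t, τ, hr, ht, hq⟩ := h₁ h
    exact ⟨_, τ, .iteTrue h hr, by omega, hq⟩

theorem loop {e : Expr} (Inv : ℕ → State → Prop) (M Tb : ℕ) (h0 : Inv 0 σ)
    (hstep : ∀ j τ, Frame (.loop e p) σ τ → Inv j τ → e.eval τ ≠ 0 →
      j < M ∧ Wp N p Tb τ (Inv (j + 1)))
    (hT : M * (Tb + e.size + 1) + e.size + 1 ≤ T)
    (hQ : ∀ j τ, j ≤ M → Frame (.loop e p) σ τ → Inv j τ → e.eval τ = 0 → Q τ) :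
    Wp N (.loop e p) T σ Q := by
  -- The induction is on the number of rounds left, since a run of a loop is decomposed at its first
  -- round.
  suffices H : ∀ d j τ, M - j = d → j ≤ M → Frame (.loop e p) σ τ → Inv j τ →
      ∃ t τ', Run N (.loop e p) τ t τ' ∧ t ≤ d * (Tb + e.size + 1) + e.size + 1 ∧ Q τ' by
    obtain ⟨t, τ, hr, ht, hq⟩ := H (M - 0) 0 σ rfl (Nat.zero_le _)
      ⟨fun _ _ => rfl, fun _ _ => rfl⟩ h0
    exact ⟨t, τ, hr, ht.trans hT, hq⟩
  intro d
  induction d with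
  | zero =>
    intro j τ hd hj hf hi
    by_cases hv : e.eval τ = 0
    · exact ⟨_, τ, .loopDone hv, by omega, hQ j τ hj hf hi hv⟩
    · have := (hstep j τ hf hi hv).1
      omega
  | succ d ih =>
    intro j τ hd hj hf hi
    by_cases hv : e.eval τ = 0
    · exact ⟨_, τ, .loopDone hv, by omega, hQ j τ hj hf hi hv⟩
    · obtain ⟨hj', t₁, τ₁, hr₁, ht₁, hi₁⟩ := hstep j τ hf hi hv
      have hf₁ : Frame (.loop e p) σ τ₁ :=
        ⟨fun x hx => (hr₁.frame.reg x hx).trans (hf.reg x hx),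
          fun a ha => (hr₁.frame.arr a ha).trans (hf.arr a ha)⟩
      obtain ⟨t₂, τ₂, hr₂, ht₂, hq⟩ := ih (j + 1) τ₁ (by omega) (by omega) hf₁ hi₁
      refine ⟨_, τ₂, .loopStep hv hr₁ hr₂, ?_, hq⟩
      rw [Nat.succ_mul]
      omega

end Wp

/-- The loop in which the register `i` runs through the numbers below the content of the
register `b`. -/
def forTo (i b : ℕ) (body : Program) : Program :=
  .seq (.assign i 0)
    (.loop ((Expr.var i).less (.var b)) (.seq body (.assign i (.var i + 1))))

/-- Each round adds 4 steps for the test and 4 for the increment to the body; the initialisation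
takes 2 steps and the last test 4. The invariant is claimed after the increment, and `hw` says that
the body leaves the counter and its bound alone. -/
theorem Wp.forTo {N i b M T : ℕ} {body : Program} {σ : State} {Q : State → Prop} (Tb : ℕ)
    (Inv : ℕ → State → Prop) (hM : σ.reg b = M) (hMN : M ≤ N)
    (h0 : Inv 0 (σ.setReg i 0))
    (hstep : ∀ j < M, ∀ τ, τ.reg i = j → Frame (forTo i b body) σ τ → Inv j τ →
      Wp N body Tb τ fun τ' => Inv (j + 1) (τ'.setReg i (j + 1)))
    (hQ : ∀ τ, τ.reg i = M → Frame (GraphSearch.forTo i b body) σ τ → Inv M τ → Q τ)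
    (hw : (i != b && (!body.writesReg i && !body.writesReg b)) = true)
    (hT : M * (Tb + 8) + 6 ≤ T) :
    Wp N (GraphSearch.forTo i b body) T σ Q := by
  simp only [Bool.and_eq_true, bne_iff_ne, ne_eq, Bool.not_eq_true'] at hw
  obtain ⟨hib, hwi, hwb⟩ := hw
  have hfr : ∀ τ, Frame (.loop ((Expr.var i).less (.var b)) (.seq body (.assign i (.var i + 1))))
      (σ.setReg i 0) τ → Frame (GraphSearch.forTo i b body) σ τ := by
    intro τ hf
    refine ⟨fun x hx => ?_, fun a ha => ?_⟩
    · simp only [GraphSearch.forTo, Program.writesReg, Bool.or_eq_false_iff,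
        beq_eq_false_iff_ne, ne_eq] at hx
      rw [hf.reg x (by simp [Program.writesReg, hx])]
      simp [Ne.symm hx.1]
    · simp only [GraphSearch.forTo, Program.writesArr, Bool.false_or, Bool.or_false] at ha
      rw [hf.arr a (by simp [Program.writesArr, ha])]
      rfl
  have hbM : ∀ τ, Frame (GraphSearch.forTo i b body) σ τ → τ.reg b = M := fun τ hf =>
    (hf.reg b (by simp [GraphSearch.forTo, Program.writesReg, hwb, hib])).trans hM
  refine Wp.assign_seq (T₂ := M * (Tb + 8) + 4) (Nat.zero_le _)
    (by simp only [size_zero]; omega) ?_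
  refine Wp.loop (fun j τ => τ.reg i = j ∧ j ≤ M ∧ Inv j τ) M (Tb + 4) ⟨by simp, by simp, h0⟩
    ?_ le_rfl ?_
  · rintro j τ hf ⟨hj, hjM, hi⟩ hv
    have hfτ := hfr τ hf
    simp only [eval_less, eval_var, hj, hbM τ hfτ, ne_eq, ite_eq_right_iff, one_ne_zero,
      imp_false, not_not] at hv
    refine ⟨hv, Wp.seq Tb 4 (hstep j hv τ hj hfτ hi) le_rfl fun τ₁ hf₁ hi₁ => ?_⟩
    have hj₁ : τ₁.reg i = j := (hf₁.reg i hwi).trans hj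
    refine Wp.assign (by simp [hj₁]; omega) (by simp) ?_
    simp only [eval_add, eval_var, hj₁, eval_one]
    exact ⟨by simp, hv, hi₁⟩
  · rintro j τ - hf ⟨hj, hjM, hi⟩ hv
    have hfτ := hfr τ hf
    simp only [eval_less, eval_var, hj, hbM τ hfτ, ite_eq_right_iff, one_ne_zero,
      imp_false, not_lt] at hv
    obtain rfl : j = M := by omega
    exact hQ τ hj hfτ hi

/-- The sum of the values of `e` for `i = 0, …, b - 1`, computed in the register `x`. -/
def sumTo (x i b : ℕ) (e : Expr) : Program :=
  .seq (.assign x 0) (forTo i b (.assign x (.var x + e)))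

theorem Wp.sumTo {N x i b M T : ℕ} {e : Expr} {σ : State} {Q : State → Prop} (f : ℕ → ℕ)
    (hM : σ.reg b = M) (hMN : M ≤ N)
    (hf : ∀ j < M, ∀ v, e.eval ((σ.setReg x v).setReg i j) = f j)
    (hN : ∑ j ∈ Finset.range M, f j ≤ N)
    (hQ : Q ((σ.setReg x (∑ j ∈ Finset.range M, f j)).setReg i M))
    (hw : (x != i && (x != b && i != b)) = true)
    (hT : M * (e.size + 11) + 8 ≤ T) :
    Wp N (GraphSearch.sumTo x i b e) T σ Q := by
  simp only [Bool.and_eq_true, bne_iff_ne, ne_eq] at hw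
  obtain ⟨hxi, hxb, hib⟩ := hw
  refine Wp.assign_seq (T₂ := M * (e.size + 11) + 6) (Nat.zero_le _)
    (by simp only [size_zero]; omega) ?_
  refine Wp.forTo (e.size + 3)
    (fun j τ => τ = (σ.setReg x (∑ j ∈ Finset.range j, f j)).setReg i j)
    (by simpa [Ne.symm hxb] using hM) hMN (by simp) ?_ ?_ ?_ le_rfl
  · rintro j hj τ - - rfl
    have hs : ∑ j ∈ Finset.range j, f j + f j ≤ N := by
      rw [← Finset.sum_range_succ]
      exact (Finset.sum_le_sum_of_subset (Finset.range_subset_range.2 hj)).trans hN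
    have hev : (Expr.var x + e).eval ((σ.setReg x (∑ j ∈ Finset.range j, f j)).setReg i j)
        = ∑ j ∈ Finset.range j, f j + f j := by
      simp [hf j hj, hxi]
    refine Wp.assign (hev ▸ hs) (by simp; omega) ?_
    rw [hev, ← Finset.sum_range_succ]
    ext y z
    · simp only [setReg_reg]
      split_ifs <;> simp_all
    · rfl
  · rintro τ - - rfl
    exact hQ
  · simp [Program.writesReg, hib, hxi, hxb]

end GraphSearch

namespace GraphSearch

/-! ### Decision trees as rankings of the vertices -/

section Trees
variable {V : Type*} {G : SimpleGraph V}

/-- `Conn G p x y`: there is a walk from `x` to `y` all of whose vertices have the property `p`. -/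
def Conn (G : SimpleGraph V) (p : V → Prop) (x y : V) : Prop :=
  p x ∧ Relation.ReflTransGen (fun a b => G.Adj a b ∧ p a ∧ p b) x y

namespace Conn
variable {p q : V → Prop} {x y z : V}

theorem refl (h : p x) : Conn G p x x := ⟨h, .refl⟩

theorem right (h : Conn G p x y) : p y := by
  rcases Relation.ReflTransGen.cases_tail h.2 with h' | ⟨b, -, h'⟩
  · exact h' ▸ h.1
  · exact h'.2.2

theorem mono (h : Conn G p x y) (hpq : ∀ a, p a → q a) : Conn G q x y :=
  ⟨hpq _ h.1, Relation.ReflTransGen.mono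
    (fun _ _ hab => ⟨hab.1, hpq _ hab.2.1, hpq _ hab.2.2⟩) _ _ h.2⟩

theorem trans (h : Conn G p x y) (h' : Conn G p y z) : Conn G p x z :=
  ⟨h.1, h.2.trans h'.2⟩

theorem symm (h : Conn G p x y) : Conn G p y x := by
  refine ⟨h.right, ?_⟩
  exact Relation.ReflTransGen.mono (fun a b hab => ⟨hab.1.symm, hab.2.2, hab.2.1⟩) _ _
    (Relation.ReflTransGen.swap y x h.2)

theorem head (hx : p x) (ha : G.Adj x y) (h : Conn G p y z) : Conn G p x z :=
  ⟨hx, .head ⟨ha, hx, h.1⟩ h.2⟩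

/-- A walk that does not leave a set closed under steps stays in it. -/
theorem restrict (h : Conn G p x y) (hx : q x)
    (hq : ∀ a b, G.Adj a b → p a → p b → q a → q b) : Conn G (fun a => p a ∧ q a) x y := by
  suffices H : ∀ b, Relation.ReflTransGen (fun a b => G.Adj a b ∧ p a ∧ p b) x b →
      q b ∧ Relation.ReflTransGen (fun a b => G.Adj a b ∧ (p a ∧ q a) ∧ (p b ∧ q b)) x b from
    ⟨⟨h.1, hx⟩, (H y h.2).2⟩
  intro b hb
  induction hb with
  | refl => exact ⟨hx, .refl⟩
  | tail _ hs ih =>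
    have hb := hq _ _ hs.1 hs.2.1 hs.2.2 ih.1
    exact ⟨hb, ih.2.tail ⟨hs.1, ⟨hs.2.1, ih.1⟩, hs.2.2, hb⟩⟩

/-- The first step of a walk between different vertices. -/
theorem exists_adj (h : Conn G p x y) (hxy : x ≠ y) : ∃ z, G.Adj x z ∧ Conn G p z y := by
  rcases Relation.ReflTransGen.cases_head h.2 with h' | ⟨z, hz, h'⟩
  · exact (hxy h').elim
  · exact ⟨z, hz.1, hz.2.2, h'⟩

end Conn

/-- `Anc G key y x`: the vertex `y` is an ancestor of `x` (or equal to it) in the decision tree that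
always queries the candidate with the smallest key. -/
def Anc (G : SimpleGraph V) (key : V → ℕ) (y x : V) : Prop :=
  Conn G (fun z => key y ≤ key z) x y

namespace Anc
variable {key key' : V → ℕ} {x y z : V}

theorem refl (key : V → ℕ) (x : V) : Anc G key x x := Conn.refl le_rfl

theorem key_le (h : Anc G key y x) : key y ≤ key x := h.1

theorem trans (h : Anc G key z y) (h' : Anc G key y x) : Anc G key z x :=
  (h'.mono fun _ ha => h.key_le.trans ha).trans h

/-- Both walks start in `x` and stay at keys at least `key y`; joined at `x` they lead from `z` to
`y`. So the ancestors of a vertex form a chain. -/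
theorem chain (h : Anc G key y x) (h' : Anc G key z x) (hyz : key y ≤ key z) : Anc G key y z :=
  ((h'.mono fun _ ha => hyz.trans ha).symm).trans h

end Anc

theorem mem_component_of_adj {S : Set V} (K : (G.induce S).ConnectedComponent) {a b : V}
    (hab : G.Adj a b) (hb : b ∈ S) (ha : a ∈ Subtype.val '' K.supp) :
    b ∈ Subtype.val '' K.supp := by
  obtain ⟨⟨a, ha'⟩, haK, rfl⟩ := ha
  refine ⟨⟨b, hb⟩, ?_, rfl⟩
  rw [SimpleGraph.ConnectedComponent.mem_supp_iff] at haK ⊢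
  rw [← haK]
  refine SimpleGraph.ConnectedComponent.sound (SimpleGraph.Adj.reachable ?_)
  simpa using hab.symm

theorem conn_of_mem_component {S : Set V} (K : (G.induce S).ConnectedComponent) {a b : V}
    (ha : a ∈ Subtype.val '' K.supp) (hb : b ∈ Subtype.val '' K.supp) :
    Conn G (· ∈ Subtype.val '' K.supp) a b := by
  obtain ⟨a, haK, rfl⟩ := ha
  obtain ⟨b, hbK, rfl⟩ := hb
  have hK : a ∈ Subtype.val ⁻¹' (Subtype.val '' K.supp) := ⟨a, haK, rfl⟩
  rw [SimpleGraph.ConnectedComponent.mem_supp_iff] at haK hbK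
  obtain ⟨p⟩ := SimpleGraph.ConnectedComponent.exact (haK.trans hbK.symm)
  clear haK hbK
  induction p with
  | nil => exact Conn.refl hK
  | @cons u v w h p ih =>
    have h' : G.Adj u v := by simpa using h
    exact Conn.head hK h' (ih (mem_component_of_adj K h' v.2 hK))

/-- The decision tree that always queries the candidate with the smallest key. -/
theorem exists_decisionTree [Finite V] {key : V → ℕ} (hkey : Function.Injective key) {S : Set V}
    (hS : S.Nonempty) (hc : ∀ x ∈ S, ∀ y ∈ S, Conn G (· ∈ S) x y) :
    ∃ D : DecisionTree G S, ∀ x ∈ S, (D.queries x).Pairwise (fun a b => key a < key b) ∧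
      ∀ y, y ∈ D.queries x ↔ Conn G (fun z => z ∈ S ∧ key y ≤ key z) x y := by
  induction hn : S.ncard using Nat.strong_induction_on generalizing S with
  | _ N ih =>
  obtain ⟨r, hr, hmin⟩ := S.toFinite.exists_minimalFor key S hS
  replace hmin : ∀ z ∈ S, key r ≤ key z := fun z hz => by
    by_contra hlt
    exact hlt (hmin hz (by omega))
  have hsub : ∀ K : (G.induce (S \ {r})).ConnectedComponent,
      Subtype.val '' K.supp ⊆ S \ {r} := by
    rintro K _ ⟨x, -, rfl⟩
    exact x.2
  have key' : ∀ K : (G.induce (S \ {r})).ConnectedComponent,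
      ∃ D : DecisionTree G (Subtype.val '' K.supp), ∀ x ∈ Subtype.val '' K.supp,
        (D.queries x).Pairwise (fun a b => key a < key b) ∧ ∀ y, y ∈ D.queries x ↔
          Conn G (fun z => z ∈ Subtype.val '' K.supp ∧ key y ≤ key z) x y := by
    intro K
    refine ih _ ?_ (K.nonempty_supp.image _) (fun x hx y hy => conn_of_mem_component K hx hy) rfl
    rw [← hn]
    refine Set.ncard_lt_ncard ?_ S.toFinite
    exact ⟨(hsub K).trans Set.sdiff_subset, fun h => (hsub K (h hr)).2 rfl⟩
  choose next hnext using key'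
  refine ⟨.query r hr next, fun x hx => ?_⟩
  by_cases hxr : x = r
  · subst hxr
    simp only [DecisionTree.queries, Set.mem_sdiff, Set.mem_singleton_iff, not_true_eq_false,
      and_false, dite_false, List.pairwise_singleton, List.mem_singleton, true_and]
    refine fun y => ⟨?_, fun h => ?_⟩
    · rintro rfl
      exact Conn.refl ⟨hr, le_rfl⟩
    · exact hkey (le_antisymm h.1.2 (hmin _ h.right.1))
  · have hxS : x ∈ S \ {r} := ⟨hx, hxr⟩
    set K := (G.induce (S \ {r})).connectedComponentMk ⟨x, hxS⟩ with hK
    have hxK : x ∈ Subtype.val '' K.supp := ⟨⟨x, hxS⟩, rfl, rfl⟩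
    obtain ⟨h1, h2⟩ := hnext K x hxK
    have hlt : ∀ z ∈ S, z ≠ r → key r < key z := fun z hz hzr =>
      lt_of_le_of_ne (hmin z hz) fun h => hzr (hkey h).symm
    have hq : (DecisionTree.query r hr next).queries x = r :: (next K).queries x := by
      rw [DecisionTree.queries, dif_pos hxS]
    rw [hq]
    refine ⟨List.pairwise_cons.2 ⟨fun y hy => ?_, h1⟩, fun y => ?_⟩
    · have := hsub K ((h2 y).1 hy).right.1
      exact hlt y this.1 this.2
    · rw [List.mem_cons]
      by_cases hyr : y = r
      · subst hyr
        simp only [true_or, true_iff]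
        exact (hc x hx y hr).mono fun a ha => ⟨ha, hmin a ha⟩
      · simp only [hyr, false_or, h2]
        refine ⟨fun h => h.mono fun a ha => ⟨(hsub K ha.1).1, ha.2⟩, fun h => ?_⟩
        have hky := hlt y h.right.1 hyr
        -- A walk at keys at least `key y` avoids `r`, whose key is smaller, so it cannot leave the
        -- component `K`.
        refine (h.restrict (q := (· ∈ Subtype.val '' K.supp)) hxK ?_).mono
          fun a ha => ⟨ha.2, ha.1.2⟩
        intro a b hab _ hb ha
        refine mem_component_of_adj K hab ⟨hb.1, ?_⟩ ha
        rintro rfl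
        omega

/-! ### Ancestors in an arbitrary decision tree -/

namespace DecisionTree

theorem mem_of_mem_queries {S : Set V} (D : DecisionTree G S) {x y : V} (hy : y ∈ D.queries x) :
    y ∈ S := by
  induction D with
  | @query S r hr next ih =>
    rw [queries, List.mem_cons] at hy
    rcases hy with rfl | hy
    · exact hr
    · split_ifs at hy with h
      · obtain ⟨z, -, rfl⟩ := ih _ hy
        exact z.2.1
      · simp at hy

theorem queries_cons {S : Set V} {r : V} {hr : r ∈ S} {next}
    (K : (G.induce (S \ {r})).ConnectedComponent) {x : V} (hx : x ∈ Subtype.val '' K.supp) :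
    (query (G := G) r hr next).queries x = r :: (next K).queries x := by
  obtain ⟨⟨x, hxS⟩, hK, rfl⟩ := hx
  rw [SimpleGraph.ConnectedComponent.mem_supp_iff] at hK
  subst hK
  rw [queries, dif_pos hxS]

theorem queries_root {S : Set V} {r : V} {hr : r ∈ S} {next} :
    (query (G := G) r hr next).queries r = [r] := by
  simp [queries]

theorem eq_root_or_exists {S : Set V} {r x : V} (hx : x ∈ S) :
    x = r ∨ ∃ K : (G.induce (S \ {r})).ConnectedComponent, x ∈ Subtype.val '' K.supp := by
  by_cases h : x = r
  · exact .inl h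
  · exact .inr ⟨(G.induce (S \ {r})).connectedComponentMk ⟨x, hx, h⟩, _, rfl, rfl⟩

theorem getLast?_queries {S : Set V} (D : DecisionTree G S) {x : V} (hx : x ∈ S) :
    (D.queries x).getLast? = some x := by
  induction D with
  | @query S r hr next ih =>
    rcases eq_root_or_exists (G := G) (r := r) hx with rfl | ⟨K, hK⟩
    · simp [queries_root]
    · rw [queries_cons K hK, List.getLast?_cons, ih K hK]
      rfl

theorem mem_queries_self {S : Set V} (D : DecisionTree G S) {x : V} (hx : x ∈ S) :
    x ∈ D.queries x :=
  List.mem_of_getLast? (D.getLast?_queries hx)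

/-- The searches for `x` and for an ancestor `y` of `x` receive the same answers until `y` is
queried. Transitivity, comparability and antisymmetry of the ancestor relation all follow from this.
-/
theorem queries_prefix {S : Set V} (D : DecisionTree G S) {x y : V} (hx : x ∈ S)
    (hy : y ∈ D.queries x) : D.queries y <+: D.queries x := by
  induction D with
  | @query S r hr next ih =>
    rcases eq_root_or_exists (G := G) (r := r) hx with rfl | ⟨K, hK⟩
    · rw [queries_root, List.mem_singleton] at hy
      rw [hy]
    · rw [queries_cons K hK, List.mem_cons] at hy
      rcases hy with rfl | hy
      · rw [queries_root, queries_cons K hK]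
        simp
      · rw [queries_cons K hK, queries_cons K (mem_of_mem_queries _ hy)]
        simpa using ih K hK hy

/-- Adjacent vertices stay in the same component until one of them is queried. -/
theorem mem_queries_of_adj {S : Set V} (D : DecisionTree G S) {x y : V} (hx : x ∈ S) (hy : y ∈ S)
    (h : G.Adj x y) : x ∈ D.queries y ∨ y ∈ D.queries x := by
  induction D with
  | @query S r hr next ih =>
    rcases eq_root_or_exists (G := G) (r := r) hx with rfl | ⟨K, hK⟩
    · left; simp [queries]
    · by_cases hyr : y = r
      · right; simp [queries, hyr]
      · have hyK := mem_component_of_adj K h ⟨hy, hyr⟩ hK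
        rw [queries_cons K hK, queries_cons K hyK]
        exact (ih K hK hyK).imp (List.mem_cons_of_mem _) (List.mem_cons_of_mem _)

section Univ
variable (D : DecisionTree G Set.univ) {x y z : V}

theorem queries_trans (h : z ∈ D.queries y) (h' : y ∈ D.queries x) : z ∈ D.queries x :=
  (D.queries_prefix (Set.mem_univ x) h').subset h

theorem queries_chain (h : y ∈ D.queries x) (h' : z ∈ D.queries x) :
    y ∈ D.queries z ∨ z ∈ D.queries y := by
  rcases List.prefix_or_prefix_of_prefix (D.queries_prefix (Set.mem_univ x) h)
    (D.queries_prefix (Set.mem_univ x) h') with h'' | h''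
  · exact .inl (h''.subset (D.mem_queries_self (Set.mem_univ y)))
  · exact .inr (h''.subset (D.mem_queries_self (Set.mem_univ z)))

theorem queries_antisymm (h : y ∈ D.queries x) (h' : x ∈ D.queries y) : x = y := by
  have h1 := D.queries_prefix (Set.mem_univ x) h
  have h2 := D.queries_prefix (Set.mem_univ y) h'
  have h3 := h1.eq_of_length (le_antisymm h1.length_le h2.length_le)
  have := D.getLast?_queries (Set.mem_univ x)
  rw [← h3, D.getLast?_queries (Set.mem_univ y)] at this
  exact (Option.some.inj this).symm

end Univ

/-- Repeated queries could only raise the cost, so this direction works for any tree without knowing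
that its paths have no repetitions. -/
theorem sum_le_costAt {S : Set V} (D : DecisionTree G S) (c : V → ℕ) (x : V) (s : Finset V)
    (hs : ∀ y ∈ s, y ∈ D.queries x) : ∑ y ∈ s, c y ≤ D.costAt c x := by
  classical
  rw [costAt, Finset.sum_list_map_count]
  refine (Finset.sum_le_sum_of_subset fun y hy => List.mem_toFinset.2 (hs y hy)).trans
    (Finset.sum_le_sum fun y hy => ?_)
  rw [smul_eq_mul]
  exact Nat.le_mul_of_pos_left _ (List.count_pos_iff.2 (List.mem_toFinset.1 hy))

theorem costAt_le_sum {S : Set V} (D : DecisionTree G S) (c : V → ℕ) (x : V) (s : Finset V)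
    (hs : ∀ y ∈ D.queries x, y ∈ s) (hd : (D.queries x).Nodup) : D.costAt c x ≤ ∑ y ∈ s, c y := by
  classical
  rw [costAt, ← List.sum_toFinset _ hd]
  exact Finset.sum_le_sum_of_subset fun y hy => hs y (List.mem_toFinset.1 hy)

end DecisionTree

/-- Keys increase along a path, so the parent is the proper ancestor with the largest key. This is
the form in which the program finds it. -/
theorem dropLast_getLast?_of_pairwise {key : V → ℕ} {l : List V} {x : V}
    (hl : l.Pairwise (fun a b => key a < key b)) (hx : l.getLast? = some x) :
    (∀ z ∈ l, z = x) ∧ l.dropLast.getLast? = none ∨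
    ∃ y, l.dropLast.getLast? = some y ∧ y ∈ l ∧ y ≠ x ∧ ∀ z ∈ l, z ≠ x → key z ≤ key y := by
  obtain ⟨l, rfl⟩ : ∃ l', l = l' ++ [x] :=
    ⟨l.dropLast, by rw [List.dropLast_append_getLast? _ hx]⟩
  rw [List.dropLast_concat]
  rcases List.eq_nil_or_concat l with rfl | ⟨l, y, rfl⟩
  · simp
  · refine .inr ⟨y, ?_⟩
    simp only [List.concat_eq_append, List.append_assoc, List.pairwise_append, List.mem_append,
      List.mem_cons, List.not_mem_nil, or_false] at hl ⊢
    refine ⟨by simp, by simp, ?_, ?_⟩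
    · rintro rfl
      have := hl.2.1.2.2 y rfl y (by simp)
      omega
    · rintro z (hz | rfl | hz) hzx
      · exact (hl.2.2 z hz y (by simp)).le
      · exact le_rfl
      · simp_all

end Trees

end GraphSearch

namespace GraphSearch

/-! ### The dynamic program -/

/-- Raising a digit to a value below `b` causes no carry: lower digits do not see multiples of
higher powers, and the quotient by `b ^ (j + 1)` does not change. -/
theorem digit_add {b X j e : ℕ} (he : e < b) (hd : X / b ^ j % b ≤ e) :
    (X + (e - X / b ^ j % b) * b ^ j) / b ^ j % b = e ∧
    (∀ i, i ≠ j → (X + (e - X / b ^ j % b) * b ^ j) / b ^ i % b = X / b ^ i % b) ∧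
    ∀ k, j < k → X < b ^ k → X + (e - X / b ^ j % b) * b ^ j < b ^ k := by
  have hb : 0 < b := by omega
  set d := X / b ^ j % b with hdd
  have h0 : (X + (e - d) * b ^ j) / b ^ j = X / b ^ j + (e - d) :=
    Nat.add_mul_div_right _ _ (by positivity)
  have h1 := Nat.div_add_mod (X / b ^ j) b
  rw [← hdd] at h1
  have h2 : X / b ^ j + (e - d) = e + b * (X / b ^ j / b) := by omega
  have h3 : ∀ i, j < i → (X + (e - d) * b ^ j) / b ^ i = X / b ^ i := by
    intro i hi
    obtain ⟨l, rfl⟩ := Nat.exists_eq_add_of_lt hi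
    rw [show b ^ (j + l + 1) = b ^ j * b * b ^ l by ring, ← Nat.div_div_eq_div_mul,
      ← Nat.div_div_eq_div_mul, ← Nat.div_div_eq_div_mul, ← Nat.div_div_eq_div_mul, h0, h2,
      Nat.add_mul_div_left _ _ hb, Nat.div_eq_of_lt he, zero_add]
  refine ⟨by rw [h0, h2, Nat.add_mul_mod_self_left, Nat.mod_eq_of_lt he], fun i hi => ?_,
    fun k hk hX => ?_⟩
  · rcases lt_or_gt_of_ne hi with hi | hi
    · obtain ⟨l, rfl⟩ := Nat.exists_eq_add_of_lt hi
      rw [show (e - d) * b ^ (i + l + 1) = ((e - d) * b ^ l * b) * b ^ i by ring,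
        Nat.add_mul_div_right _ _ (by positivity), Nat.add_mul_mod_self_right]
    · rw [h3 i hi]
  · rw [← Nat.div_eq_zero_iff_lt (by positivity), h3 k hk, Nat.div_eq_zero_iff_lt (by positivity)]
    exact hX

/-- The data of the dynamic program: the instance, a grid `g 0 < g 1 < … < g (m - 1)` of loads, and
an order of the vertices (`rk v` is the position of `v`, and `ord i` the vertex at position `i`). -/
structure Setup (n : ℕ) where
  G : SimpleGraph (Fin n)
  c : Fin n → ℕ
  w : Fin n → ℕ
  g : ℕ → ℕ
  m : ℕ
  rk : Fin n → ℕ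
  ord : ℕ → Fin n

namespace Setup
variable {n : ℕ} (A : Setup n)

/-- The vertex is not a leaf. -/
def Inner (v : Fin n) : Prop := (A.G.neighborSet v).ncard ≠ 1

/-- The number of vertices that are not leaves. -/
noncomputable def k : ℕ := nonLeafCount A.G

open scoped Classical

/-- The number of inner vertices before `u`. -/
noncomputable def idx (u : Fin n) : ℕ := (Finset.univ.filter fun v => A.Inner v ∧ v < u).card

/-- The digit of `X` in base `b` that belongs to the inner vertex `u`. -/
noncomputable def dig (b X : ℕ) (u : Fin n) : ℕ := X / b ^ A.idx u % b

/-- The position in the grid after a cost `c v` has been added at position `i`. -/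
def up (i : ℕ) (v : Fin n) : ℕ :=
  ∑ t ∈ Finset.range A.m, if A.g t < A.g i + A.c v then 1 else 0

/-- The key given to the vertices by the guess `P` of the depths of the inner vertices. -/
noncomputable def key (P : ℕ) (v : Fin n) : ℕ :=
  if A.Inner v then (A.dig n P v * n + v) * (n + 1) + n + 1 else n * n * (n + 1) + 1 + v

/-- `u` is an inner vertex that the guess `P` makes an ancestor of `x`. -/
def Above (P : ℕ) (u x : Fin n) : Prop := A.Inner u ∧ Anc A.G (A.key P) u x

/-- The nominal cost of searching for an inner vertex, for the guess `P` of the depths and the guess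
`S` of the costs of the leaves queried immediately before the inner vertices. -/
noncomputable def total (P S : ℕ) (x : Fin n) : ℕ :=
  ∑ u, if A.Above P u x then A.c u + A.g (A.dig A.m S u) else 0

/-- The nominal cost of a decision about the leaf `l`: query it after its neighbour (`none`) or
immediately before the inner vertex `u` (`some u`). -/
noncomputable def stepCost (P S X : ℕ) (l : Fin n) : Option (Fin n) → ℕ
  | none => if A.Inner l then 0 else A.w l * (A.total P S l + A.c l)
  | some u => A.w l * (A.total P S u - (A.c u + A.g (A.dig A.m S u)) +
      A.g (A.up (A.dig A.m X u) l))

/-- The decision about `l` is admissible. -/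
def Feas (P S X : ℕ) (l : Fin n) : Option (Fin n) → Prop
  | none => True
  | some u => ¬ A.Inner l ∧ A.Above P u l ∧ A.up (A.dig A.m X u) l ≤ A.dig A.m S u

/-- The loads after the decision about `l`. -/
noncomputable def next (X : ℕ) (l : Fin n) : Option (Fin n) → ℕ
  | none => X
  | some u => X + (A.up (A.dig A.m X u) l - A.dig A.m X u) * A.m ^ A.idx u

/-- The nominal cost of the last `r` vertices in the order. -/
noncomputable def F (P S : ℕ) : ℕ → ℕ → ℕ
  | 0, _ => 0
  | r + 1, X => sInf {v | ∃ o, A.Feas P S X (A.ord (n - (r + 1))) o ∧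
      v = A.stepCost P S X (A.ord (n - (r + 1))) o + F P S r (A.next X (A.ord (n - (r + 1))) o)}

/-- The nominal cost of the best decision tree for the guesses `P` and `S`. -/
noncomputable def value (P S : ℕ) : ℕ :=
  (∑ v, if A.Inner v then A.w v * A.total P S v else 0) + A.F P S n 0

/-- The conditions that the data of the dynamic program satisfy. -/
structure Valid : Prop where
  leaf : ∀ l, ¬ A.Inner l → ∃ v, A.Inner v ∧ ∀ z, A.G.Adj l z ↔ z = v
  rk_lt : ∀ v, A.rk v < n
  ord_rk : ∀ v, A.ord (A.rk v) = v
  rk_ord : ∀ i < n, A.rk (A.ord i) = i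
  smith : ∀ u v, A.rk u < A.rk v → A.c u * A.w v ≤ A.c v * A.w u
  mono : StrictMono A.g
  zero : A.g 0 = 0
  m_pos : 0 < A.m

variable {A}

theorem idx_lt {u : Fin n} (hu : A.Inner u) : A.idx u < A.k := by
  rw [k, nonLeafCount, Set.ncard_eq_toFinset_card', idx]
  refine Finset.card_lt_card ⟨fun v hv => ?_, fun h => ?_⟩
  · simp only [Finset.mem_filter, Finset.mem_univ, true_and] at hv
    exact Set.mem_toFinset.2 hv.1
  · have := h (Set.mem_toFinset.2 hu)
    simp at this

theorem idx_lt_idx {u v : Fin n} (hu : A.Inner u) (h : u < v) : A.idx u < A.idx v := by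
  refine Finset.card_lt_card ⟨fun z hz => ?_, fun h' => ?_⟩
  · simp only [Finset.mem_filter, Finset.mem_univ, true_and] at hz ⊢
    exact ⟨hz.1, hz.2.trans h⟩
  · have := h' (show u ∈ _ by simpa using ⟨hu, h⟩)
    simp at this

theorem idx_ne {u v : Fin n} (hu : A.Inner u) (hv : A.Inner v) (h : u ≠ v) :
    A.idx u ≠ A.idx v := by
  rcases lt_or_gt_of_ne h with h | h
  · exact (idx_lt_idx hu h).ne
  · exact (idx_lt_idx hv h).ne'

theorem dig_lt {b : ℕ} (hb : 0 < b) (X : ℕ) (u : Fin n) : A.dig b X u < b := Nat.mod_lt _ hb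

theorem dig_add {b X e : ℕ} {u : Fin n} (hu : A.Inner u) (he : e < b) (hd : A.dig b X u ≤ e) :
    A.dig b (X + (e - A.dig b X u) * b ^ A.idx u) u = e ∧
    (∀ v, A.Inner v → v ≠ u → A.dig b (X + (e - A.dig b X u) * b ^ A.idx u) v = A.dig b X v) ∧
    (X < b ^ A.k → X + (e - A.dig b X u) * b ^ A.idx u < b ^ A.k) := by
  obtain ⟨h1, h2, h3⟩ := digit_add he hd
  exact ⟨h1, fun v hv hvu => h2 _ (idx_ne hv hu hvu), h3 _ (idx_lt hu)⟩

/-- Starting from `0`, the digits are raised to their targets one after another with `dig_add`. -/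
theorem exists_dig {b : ℕ} (hb : 0 < b) (t : Fin n → ℕ) (ht : ∀ u, t u < b) :
    ∃ X < b ^ A.k, ∀ u, A.Inner u → A.dig b X u = t u := by
  suffices H : ∀ s : Finset (Fin n), ∃ X < b ^ A.k, ∀ u, A.Inner u →
      A.dig b X u = if u ∈ s then t u else 0 by
    obtain ⟨X, hX, h⟩ := H Finset.univ
    exact ⟨X, hX, fun u hu => by simpa using h u hu⟩
  intro s
  induction s using Finset.induction_on with
  | empty => exact ⟨0, by positivity, fun u _ => by simp [dig]⟩
  | insert a s ha ih =>
    obtain ⟨X, hX, h⟩ := ih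
    by_cases hI : A.Inner a
    · have h0 : A.dig b X a ≤ t a := by rw [h a hI, if_neg ha]; exact Nat.zero_le _
      obtain ⟨h1, h2, h3⟩ := dig_add hI (ht a) h0
      refine ⟨_, h3 hX, fun u hu => ?_⟩
      by_cases hua : u = a
      · subst hua; simp [h1]
      · rw [h2 u hu hua, h u hu]; simp [hua]
    · refine ⟨X, hX, fun u hu => ?_⟩
      have hua : u ≠ a := by rintro rfl; exact hI hu
      rw [h u hu]; simp [hua]

theorem F_le {P S r X : ℕ} {o : Option (Fin n)} (h : A.Feas P S X (A.ord (n - (r + 1))) o) :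
    A.F P S (r + 1) X ≤ A.stepCost P S X (A.ord (n - (r + 1))) o +
      A.F P S r (A.next X (A.ord (n - (r + 1))) o) :=
  Nat.sInf_le ⟨o, h, rfl⟩

/-- Since `F` is an infimum and not a computation, this is how the program is compared with it: an
admissible decision that no other one beats determines the value. -/
theorem F_eq {P S r X v : ℕ} {o : Option (Fin n)} (h : A.Feas P S X (A.ord (n - (r + 1))) o)
    (hv : v = A.stepCost P S X (A.ord (n - (r + 1))) o +
      A.F P S r (A.next X (A.ord (n - (r + 1))) o))
    (hle : ∀ o, A.Feas P S X (A.ord (n - (r + 1))) o →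
      v ≤ A.stepCost P S X (A.ord (n - (r + 1))) o +
        A.F P S r (A.next X (A.ord (n - (r + 1))) o)) : A.F P S (r + 1) X = v := by
  refine le_antisymm (hv ▸ F_le h) (le_csInf ⟨_, _, h, rfl⟩ ?_)
  rintro _ ⟨o, ho, rfl⟩
  exact hle o ho

/-! ### The keys given by a guess of the depths -/

section Keys
variable {P : ℕ} {u v x y l : Fin n}

theorem key_inner (hu : A.Inner u) :
    A.key P u = (A.dig n P u * n + u) * (n + 1) + n + 1 := if_pos hu

theorem key_leaf (hl : ¬ A.Inner l) : A.key P l = n * n * (n + 1) + 1 + l := if_neg hl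

theorem key_inner_le (hu : A.Inner u) : A.key P u ≤ n * n * (n + 1) := by
  rw [key_inner hu]
  have h1 := A.dig_lt (b := n) u.pos P u
  have h2 : A.dig n P u * n + u + 1 ≤ n * n := by
    have : (A.dig n P u + 1) * n ≤ n * n := Nat.mul_le_mul_right _ h1
    have := u.2
    nlinarith
  nlinarith

theorem key_lt_of_inner_of_leaf (hu : A.Inner u) (hl : ¬ A.Inner l) : A.key P u < A.key P l := by
  have := A.key_inner_le (P := P) hu
  rw [key_leaf hl]; omega

theorem key_injective (hu : A.Inner u) (hv : A.Inner v) (h : A.key P u = A.key P v) : u = v := by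
  rw [key_inner hu, key_inner hv] at h
  have h1 : A.dig n P u * n + u = A.dig n P v * n + v :=
    Nat.eq_of_mul_eq_mul_right (Nat.succ_pos n) (by simpa [Nat.add_assoc] using h)
  have h2 : (A.dig n P u * n + u) % n = (A.dig n P v * n + v) % n := by rw [h1]
  rw [Nat.mul_add_mod_self_right, Nat.mul_add_mod_self_right, Nat.mod_eq_of_lt u.2,
    Nat.mod_eq_of_lt v.2] at h2
  exact Fin.ext h2

theorem key_le_of_dig_le (hu : A.Inner u) (hv : A.Inner v) (h : A.key P u ≤ A.key P v) :
    A.dig n P u ≤ A.dig n P v := by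
  rw [key_inner hu, key_inner hv] at h
  have h1 : A.dig n P u * n + u ≤ A.dig n P v * n + v :=
    Nat.le_of_mul_le_mul_right (by simpa [Nat.add_assoc] using h) (Nat.succ_pos n)
  by_contra hlt
  have : (A.dig n P v + 1) * n ≤ A.dig n P u * n := Nat.mul_le_mul_right _ (by omega)
  rw [Nat.add_mul] at this
  have := v.2
  omega

/-- Keys of inner vertices are multiples of `n + 1`. The gaps of `n` free numbers below them are
where `finalKey` puts the leaves, and a shift inside a gap cannot change a comparison of inner
vertices. -/
theorem key_le_of_lt_add (hu : A.Inner u) (hv : A.Inner v) (h : A.key P u < A.key P v + (n + 1)) :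
    A.key P u ≤ A.key P v := by
  rw [key_inner hu, key_inner hv] at h ⊢
  have h1 : A.dig n P u * n + u < A.dig n P v * n + v + 1 := by
    by_contra hge
    have := Nat.mul_le_mul_right (n + 1) (not_lt.1 hge)
    rw [Nat.add_mul] at this
    omega
  have := Nat.mul_le_mul_right (n + 1) (Nat.le_of_lt_succ h1)
  omega

end Keys

/-- The grid is strictly increasing, so its points below `g i + c v` form an initial segment; their
number is the index of the first point that is not below, or `m` if the grid ends too early. -/
theorem up_spec (hA : A.Valid) {i : ℕ} {v : Fin n} :
    (∀ t < A.m, A.g i + A.c v ≤ A.g t → A.up i v ≤ t) ∧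
    (A.up i v < A.m → A.g i + A.c v ≤ A.g (A.up i v)) ∧ ∀ t < A.up i v, A.g t < A.g i + A.c v := by
  have hcard : A.up i v = ((Finset.range A.m).filter fun t => A.g t < A.g i + A.c v).card := by
    rw [up, Finset.card_filter]
  have h1 : ∀ t < A.m, A.g i + A.c v ≤ A.g t → A.up i v ≤ t := by
    intro t _ hge
    rw [hcard]
    refine (Finset.card_le_card (t := Finset.range t) fun s hs => ?_).trans_eq (Finset.card_range t)
    simp only [Finset.mem_filter] at hs
    exact Finset.mem_range.2 (hA.mono.lt_iff_lt.1 (hs.2.trans_le hge))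
  have h2 : ∀ t < A.m, A.g t < A.g i + A.c v → t < A.up i v := by
    intro t ht hlt
    rw [hcard, Nat.lt_iff_add_one_le]
    refine (Finset.card_range (t + 1)).symm.trans_le (Finset.card_le_card fun s hs => ?_)
    simp only [Finset.mem_range, Finset.mem_filter] at hs ⊢
    exact ⟨by omega, (hA.mono.monotone (by omega : s ≤ t)).trans_lt hlt⟩
  have h3 : A.up i v ≤ A.m := by
    rw [hcard]
    exact (Finset.card_filter_le _ _).trans_eq (Finset.card_range _)
  refine ⟨h1, fun hlt => ?_, fun t ht => ?_⟩
  · by_contra hlt'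
    exact lt_irrefl _ (h2 _ hlt (not_le.1 hlt'))
  · by_contra hge
    exact absurd (h1 t (ht.trans_le h3) (not_lt.1 hge)) (by omega)

theorem le_up (hA : A.Valid) {i : ℕ} {v : Fin n} (h : A.up i v < A.m) : i ≤ A.up i v :=
  hA.mono.le_iff_le.1 ((Nat.le_add_right _ _).trans ((up_spec hA).2.1 h))

/-- The cost of the leaves before position `i` that are assigned to `u`. -/
def load (A : Setup n) (a : Fin n → Option (Fin n)) (i : ℕ) (u : Fin n) : ℕ :=
  ∑ y, if A.rk y < i ∧ a y = some u then A.c y else 0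

/-- Exactly one vertex has position `i`. With this lemma sums over the vertices follow the recursion
along the order. -/
theorem sum_rk_succ {M : Type*} [AddCommMonoid M] (hA : A.Valid) {i : ℕ} (hi : i < n)
    (f : Fin n → M) :
    (∑ y, if A.rk y < i + 1 then f y else 0) = (∑ y, if A.rk y < i then f y else 0) +
      f (A.ord i) := by
  have : ∀ y, (if A.rk y < i + 1 then f y else 0) =
      (if A.rk y < i then f y else 0) + if y = A.ord i then f y else 0 := by
    intro y
    have : y = A.ord i ↔ A.rk y = i :=
      ⟨fun h => h ▸ hA.rk_ord i hi, fun h => by rw [← h, hA.ord_rk]⟩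
    simp only [this]
    rcases lt_trichotomy (A.rk y) i with h | h | h
    · simp [h, h.ne, h.trans (Nat.lt_succ_self i)]
    · simp [h]
    · simp [h.ne', h.not_gt, show ¬ A.rk y < i + 1 by omega]
  rw [Finset.sum_congr rfl fun y _ => this y, Finset.sum_add_distrib]
  simp

theorem load_succ (hA : A.Valid) (a : Fin n → Option (Fin n)) {i : ℕ} (hi : i < n) (u : Fin n) :
    A.load a (i + 1) u = A.load a i u + if a (A.ord i) = some u then A.c (A.ord i) else 0 := by
  simp only [load, ite_and]
  exact sum_rk_succ hA hi fun y => if a y = some u then A.c y else 0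

theorem load_eq (hA : A.Valid) (a : Fin n → Option (Fin n)) (u : Fin n) :
    A.load a n u = ∑ y, if a y = some u then A.c y else 0 := by
  simp [load, hA.rk_lt]

/-- The cost of the vertices with property `p` and the leaves assigned to them, counted by
vertices. -/
theorem sum_add_load (hA : A.Valid) (a : Fin n → Option (Fin n)) (p : Fin n → Prop)
    [DecidablePred p]
    (ha : ∀ y u, a y = some u → p u → ¬ p y) :
    (∑ u, if p u then A.c u + A.load a n u else 0) =
      ∑ y, if p y ∨ ∃ u, a y = some u ∧ p u then A.c y else 0 := by
  have h1 : ∀ u, (if p u then A.c u + A.load a n u else 0) =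
      (if p u then A.c u else 0) + ∑ y, if a y = some u ∧ p u then A.c y else 0 := by
    intro u
    by_cases hu : p u <;> simp [hu, load_eq hA]
  rw [Finset.sum_congr rfl fun u _ => h1 u, Finset.sum_add_distrib, Finset.sum_comm,
    ← Finset.sum_add_distrib]
  refine Finset.sum_congr rfl fun y _ => ?_
  rcases hy : a y with _ | u
  · simp
  · have : ∀ z, (if some u = some z ∧ p z then A.c y else 0) =
        if u = z then (if p u then A.c y else 0) else 0 := by
      intro z
      by_cases h : u = z
      · subst h; simp
      · simp [h]
    rw [Finset.sum_congr rfl fun z _ => this z, Finset.sum_ite_eq]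
    -- The hypothesis `ha` prevents a vertex from being counted both for itself and as an assigned
    -- leaf.
    have := ha y u hy
    by_cases hu : p u
    · simp [hu, this hu]
    · simp [hu]

end Setup

end GraphSearch

namespace GraphSearch

namespace Setup
variable {n : ℕ} {A : Setup n}

open scoped Classical

/-! ### Every state of the dynamic program is attained by a decision tree -/

/-- An inner vertex is above itself, so the truncated subtraction in `stepCost` is an exact one. -/
theorem sum_above_self {P : ℕ} {u : Fin n} (hu : A.Inner u) (f : Fin n → ℕ) :
    (∑ z, if A.Above P z u then f z else 0) =
      f u + ∑ z, if A.Above P z u ∧ z ≠ u then f z else 0 := by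
  have : ∀ z, (if A.Above P z u then f z else 0) =
      (if z = u then f z else 0) + if A.Above P z u ∧ z ≠ u then f z else 0 := by
    intro z
    by_cases h : z = u
    · subst h
      have : A.Above P z z := ⟨hu, Anc.refl _ _⟩
      simp [this]
    · simp [h]
  rw [Finset.sum_congr rfl fun z _ => this z, Finset.sum_add_distrib]
  simp

/-- The keys of the vertices after the leaves have been assigned: a leaf assigned to `u` comes
immediately before `u`, in the given order. -/
noncomputable def finalKey (A : Setup n) (P : ℕ) (a : Fin n → Option (Fin n)) (x : Fin n) : ℕ :=
  (a x).elim (A.key P x) fun u => A.key P u - (n - A.rk x)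

section FinalKey
variable {P : ℕ} {a : Fin n → Option (Fin n)} {x y u v : Fin n}

theorem finalKey_none (h : a x = none) : A.finalKey P a x = A.key P x := by simp [finalKey, h]

/-- The key of an inner vertex is at least `n + 1`, so nothing is cut off by the subtraction. -/
theorem finalKey_some (hu : A.Inner u) (h : a x = some u) :
    A.finalKey P a x + (n - A.rk x) = A.key P u := by
  have := A.key_inner (P := P) hu
  simp only [finalKey, h, Option.elim_some]
  omega

variable (hA : A.Valid) (ha : ∀ x u, a x = some u → ¬ A.Inner x ∧ A.Above P u x)
include ha

theorem finalKey_inner (h : A.Inner x) : A.finalKey P a x = A.key P x := by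
  refine finalKey_none ?_
  rcases hx : a x with _ | u
  · rfl
  · exact ((ha x u hx).1 h).elim

theorem finalKey_le (x : Fin n) : A.finalKey P a x ≤ A.key P x := by
  rcases hx : a x with _ | u
  · rw [finalKey_none hx]
  · obtain ⟨h1, h2⟩ := ha x u hx
    have := finalKey_some (A := A) (P := P) h2.1 hx
    have := key_lt_of_inner_of_leaf (P := P) h2.1 h1
    omega

theorem above_of_anc (hy : A.Inner y) (h : Anc A.G (A.finalKey P a) y x) : A.Above P y x := by
  refine ⟨hy, h.mono fun z hz => ?_⟩
  rw [finalKey_inner ha hy] at hz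
  exact hz.trans (finalKey_le ha z)

include hA

/-- A leaf assigned to `u` takes one of the `n` numbers directly below `key u`, which no other inner
vertex uses or shares with its own leaves; inside this gap the position in the order separates the
leaves. -/
theorem finalKey_injective : Function.Injective (A.finalKey P a) := by
  have main : ∀ x u, a x = some u → ∀ y, A.finalKey P a x = A.finalKey P a y → x = y := by
    intro x u hx y hxy
    obtain ⟨h1, h2⟩ := ha x u hx
    have e1 := finalKey_some (A := A) (P := P) h2.1 hx
    have r1 := hA.rk_lt x
    rcases hy : a y with _ | v
    · rw [finalKey_none hy] at hxy
      by_cases hyI : A.Inner y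
      · have := key_le_of_lt_add (P := P) h2.1 hyI (by omega)
        omega
      · have := key_lt_of_inner_of_leaf (P := P) h2.1 hyI
        omega
    · obtain ⟨h3, h4⟩ := ha y v hy
      have e2 := finalKey_some (A := A) (P := P) h4.1 hy
      have r2 := hA.rk_lt y
      have l1 := key_le_of_lt_add (P := P) h2.1 h4.1 (by omega)
      have l2 := key_le_of_lt_add (P := P) h4.1 h2.1 (by omega)
      rw [← hA.ord_rk x, ← hA.ord_rk y]
      congr 1
      omega
  intro x y hxy
  rcases hx : a x with _ | u
  · rcases hy : a y with _ | v
    · rw [finalKey_none hx, finalKey_none hy] at hxy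
      by_cases h1 : A.Inner x <;> by_cases h2 : A.Inner y
      · exact key_injective h1 h2 hxy
      · exact absurd hxy (key_lt_of_inner_of_leaf h1 h2).ne
      · exact absurd hxy (key_lt_of_inner_of_leaf h2 h1).ne'
      · rw [key_leaf h1, key_leaf h2] at hxy
        exact Fin.ext (by omega)
    · exact (main y v hy x hxy.symm).symm
  · exact main x u hx y hxy

/-- A walk that stays at final keys at least that of `y` stays at keys at least `key u`, because
there is no inner key in between and the unshifted keys of leaves exceed all inner keys. -/
theorem above_of_anc_of_some (hy : a y = some u) (h : Anc A.G (A.finalKey P a) y x) :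
    A.Above P u x := by
  obtain ⟨h1, h2⟩ := ha y u hy
  refine ⟨h2.1, (h.mono fun z hz => ?_).trans h2.2⟩
  have e := finalKey_some (A := A) (P := P) h2.1 hy
  have r := hA.rk_lt y
  by_cases hz' : A.Inner z
  · rw [finalKey_inner ha hz'] at hz
    exact key_le_of_lt_add h2.1 hz' (by omega)
  · exact (key_lt_of_inner_of_leaf h2.1 hz').le

/-- Any walk to `y` from another vertex ends through its only neighbour, which has a smaller key. So
a leaf queried after its neighbour delays nobody else. -/
theorem eq_of_anc_of_none (hy : ¬ A.Inner y) (hn : a y = none)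
    (h : Anc A.G (A.finalKey P a) y x) : y = x := by
  by_contra hne
  obtain ⟨z, hz, hc⟩ := (Conn.symm h).exists_adj hne
  obtain ⟨v, hv, hv'⟩ := hA.leaf y hy
  obtain rfl := (hv' z).1 hz
  have := hc.1
  rw [finalKey_none hn, finalKey_inner ha hv] at this
  exact absurd (key_lt_of_inner_of_leaf (P := P) hv hy) (not_lt.2 this)

variable {D : DecisionTree A.G Set.univ} (hd : (D.queries x).Nodup)
  (hD : ∀ y, y ∈ D.queries x → Anc A.G (A.finalKey P a) y x)
include hd hD

/-- The path to `x` contains only inner vertices above `x`, leaves assigned to such vertices, and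
`x` itself. -/
theorem costAt_le_of_none (hx : a x = none) :
    D.costAt A.c x ≤ (∑ u, if A.Above P u x then A.c u + A.load a n u else 0) +
      if A.Inner x then 0 else A.c x := by
  rw [sum_add_load hA a _ fun y u hy _ h => (ha y u hy).1 h.1]
  have hb : (if A.Inner x then 0 else A.c x) =
      ∑ y, if y = x ∧ ¬ A.Inner x then A.c y else 0 := by
    by_cases h : A.Inner x <;> simp [h]
  rw [hb, ← Finset.sum_add_distrib]
  refine (D.costAt_le_sum A.c x (Finset.univ.filter fun y => y ∈ D.queries x) (by simp) hd).trans ?_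
  rw [Finset.sum_filter]
  refine Finset.sum_le_sum fun y _ => ?_
  split_ifs with h1 h2 h3 h4 h5
  all_goals first | omega | exfalso
  have hy := hD y h1
  by_cases hyI : A.Inner y
  · exact h2 (.inl (above_of_anc ha hyI hy))
  · rcases hya : a y with _ | u
    · obtain rfl := eq_of_anc_of_none hA ha hyI hya hy
      exact h4 ⟨rfl, hyI⟩
    · exact h2 (.inr ⟨u, hya, above_of_anc_of_some hA ha hya hy⟩)

/-- The path to `x` contains only the proper ancestors of `u` among the inner vertices, the leaves
assigned to them, and the leaves in front of `u` up to the position of `x`, which includes `x`. -/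
theorem costAt_le_of_some (hx : a x = some u) :
    D.costAt A.c x ≤ (∑ z, if A.Above P z u ∧ z ≠ u then A.c z + A.load a n z else 0) +
      A.load a (A.rk x + 1) u := by
  rw [sum_add_load hA a _ fun y u hy _ h => (ha y u hy).1 h.1.1, load, ← Finset.sum_add_distrib]
  refine (D.costAt_le_sum A.c x (Finset.univ.filter fun y => y ∈ D.queries x) (by simp) hd).trans ?_
  rw [Finset.sum_filter]
  refine Finset.sum_le_sum fun y _ => ?_
  obtain ⟨hxl, hux⟩ := ha x u hx
  have ex := finalKey_some (A := A) (P := P) hux.1 hx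
  have rx := hA.rk_lt x
  split_ifs with h1 h2 h3 h4
  all_goals first | omega | exfalso
  have hy := hD y h1
  have hle := hy.key_le
  by_cases hyI : A.Inner y
  · have hyx := above_of_anc ha hyI hy
    rw [finalKey_inner ha hyI] at hle
    refine h2 (.inl ⟨⟨hyI, hyx.2.chain hux.2 (by omega)⟩, ?_⟩)
    rintro rfl
    omega
  · rcases hya : a y with _ | v
    · obtain rfl := eq_of_anc_of_none hA ha hyI hya hy
      simp [hx] at hya
    · have hv := above_of_anc_of_some hA ha hya hy
      have ey := finalKey_some (A := A) (P := P) hv.1 hya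
      have ry := hA.rk_lt y
      by_cases hvu : v = u
      · subst hvu
        exact h4 ⟨by omega, hya⟩
      · refine h2 (.inr ⟨v, hya, ⟨hv.1, hv.2.chain hux.2 ?_⟩, hvu⟩)
        exact key_le_of_lt_add hv.1 hux.1 (by omega)

end FinalKey

/-- The states of the dynamic program on the way given by the decisions `H`. -/
noncomputable def path (A : Setup n) (H : ℕ → ℕ → Option (Fin n)) : ℕ → ℕ
  | 0 => 0
  | i + 1 => A.next (path A H i) (A.ord i) (H i (path A H i))

/-- The assignment of the leaves given by the decisions `H`. -/
noncomputable def plan (A : Setup n) (H : ℕ → ℕ → Option (Fin n)) (l : Fin n) : Option (Fin n) :=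
  H (A.rk l) (A.path H (A.rk l))

/-- This version does not mention the guess `S`: in `value_le` the guess is read off the end of the
path, so admissibility is not yet available while the path is followed. -/
theorem next_spec' (hA : A.Valid) {X : ℕ} {l : Fin n} {o : Option (Fin n)}
    (h : ∀ u, o = some u → A.Inner u ∧ A.up (A.dig A.m X u) l < A.m) :
    (X < A.m ^ A.k → A.next X l o < A.m ^ A.k) ∧
    (∀ v, A.Inner v → o ≠ some v → A.dig A.m (A.next X l o) v = A.dig A.m X v) ∧
    ∀ u, o = some u → A.dig A.m (A.next X l o) u = A.up (A.dig A.m X u) l ∧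
      A.up (A.dig A.m X u) l < A.m := by
  rcases o with _ | u
  · simp [next]
  · obtain ⟨hu, hlt⟩ := h u rfl
    obtain ⟨d1, d2, d3⟩ := dig_add hu hlt (le_up hA hlt)
    refine ⟨d3, fun v hv hvu => d2 v hv fun h => hvu (h ▸ rfl), ?_⟩
    rintro _ ⟨rfl⟩
    exact ⟨d1, hlt⟩

theorem next_spec (hA : A.Valid) {P S X : ℕ} {l : Fin n} {o : Option (Fin n)}
    (h : A.Feas P S X l o) :
    (X < A.m ^ A.k → A.next X l o < A.m ^ A.k) ∧
    (∀ v, A.Inner v → o ≠ some v → A.dig A.m (A.next X l o) v = A.dig A.m X v) ∧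
    ∀ u, o = some u → A.dig A.m (A.next X l o) u = A.up (A.dig A.m X u) l ∧
      A.up (A.dig A.m X u) l < A.m := by
  refine next_spec' hA fun u hu => ?_
  subst hu
  exact ⟨h.2.1.1, h.2.2.trans_lt (A.dig_lt hA.m_pos S u)⟩

section Path
variable {P S : ℕ} {H : ℕ → ℕ → Option (Fin n)} (hA : A.Valid)
  (hH : ∀ i < n, ∀ X < A.m ^ A.k, A.Feas P S X (A.ord i) (H i X))
include hA hH

/-- Rounding upwards keeps the recorded loads above the true ones, and admissibility keeps them
below the guess. -/
theorem path_spec {i : ℕ} (hi : i ≤ n) :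
    A.path H i < A.m ^ A.k ∧ ∀ u, A.Inner u →
      A.load (A.plan H) i u ≤ A.g (A.dig A.m (A.path H i) u) ∧
      A.dig A.m (A.path H i) u ≤ A.dig A.m S u := by
  induction i with
  | zero =>
    have := hA.m_pos
    exact ⟨by simpa [path] using by positivity, fun u _ => by simp [load, path, dig]⟩
  | succ i ih =>
    obtain ⟨ih1, ih2⟩ := ih (by omega)
    have hf := hH i hi _ ih1
    obtain ⟨n1, n2, n3⟩ := next_spec hA hf
    refine ⟨n1 ih1, fun u hu => ?_⟩
    have hplan : A.plan H (A.ord i) = H i (A.path H i) := by rw [plan, hA.rk_ord i hi]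
    rw [load_succ hA _ hi, hplan]
    by_cases ho : H i (A.path H i) = some u
    · obtain ⟨d1, d2⟩ := n3 u ho
      rw [path, d1, if_pos ho]
      have hf' := hf
      rw [ho] at hf'
      exact ⟨(Nat.add_le_add_right (ih2 u hu).1 _).trans ((up_spec hA).2.1 d2), hf'.2.2⟩
    · rw [path, n2 u hu ho, if_neg ho]
      exact ih2 u hu

/-- The recursion telescopes along the optimal path. -/
theorem path_cost (hF : ∀ i < n, ∀ X < A.m ^ A.k, A.F P S (n - i) X =
      A.stepCost P S X (A.ord i) (H i X) + A.F P S (n - (i + 1)) (A.next X (A.ord i) (H i X))) :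
    A.F P S n 0 = ∑ l, A.stepCost P S (A.path H (A.rk l)) l (A.plan H l) := by
  suffices h : ∀ i ≤ n, A.F P S n 0 = (∑ l, if A.rk l < i then
      A.stepCost P S (A.path H (A.rk l)) l (A.plan H l) else 0) +
      A.F P S (n - i) (A.path H i) by
    simpa [hA.rk_lt, F] using h n le_rfl
  intro i hi
  induction i with
  | zero => simp [path]
  | succ i ih =>
    rw [ih (by omega), hF i hi _ (path_spec hA hH (by omega)).1, sum_rk_succ hA hi, plan,
      hA.rk_ord i hi, path]
    ring

/-- The tree for the final keys costs at most the nominal cost. -/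
theorem cost_le_value (hF : ∀ i < n, ∀ X < A.m ^ A.k, A.F P S (n - i) X =
      A.stepCost P S X (A.ord i) (H i X) + A.F P S (n - (i + 1)) (A.next X (A.ord i) (H i X)))
    {D : DecisionTree A.G Set.univ} (hd : ∀ x, (D.queries x).Nodup)
    (hD : ∀ x y, y ∈ D.queries x → Anc A.G (A.finalKey P (A.plan H)) y x) :
    D.cost A.c A.w ≤ A.value P S := by
  have hfe : ∀ l, A.Feas P S (A.path H (A.rk l)) l (A.plan H l) := fun l => by
    have := hH (A.rk l) (hA.rk_lt l) _ (path_spec hA hH (hA.rk_lt l).le).1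
    rwa [hA.ord_rk] at this
  have ha : ∀ x u, A.plan H x = some u → ¬ A.Inner x ∧ A.Above P u x := fun x u hx => by
    have := hfe x
    rw [hx] at this
    exact ⟨this.1, this.2.1⟩
  -- The guessed loads dominate the true loads at the end, hence the nominal costs dominate the true
  -- ones.
  have hload : ∀ u, A.Inner u → A.load (A.plan H) n u ≤ A.g (A.dig A.m S u) := fun u hu =>
    ((path_spec hA hH le_rfl).2 u hu).1.trans
      (hA.mono.monotone ((path_spec hA hH le_rfl).2 u hu).2)
  rw [value, path_cost hA hH hF, ← Finset.sum_add_distrib, DecisionTree.cost]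
  refine Finset.sum_le_sum fun x _ => ?_
  rcases hx : A.plan H x with _ | u
  · have h1 := costAt_le_of_none hA ha (hd x) (hD x) hx
    have h2 : (∑ u, if A.Above P u x then A.c u + A.load (A.plan H) n u else 0) ≤
        A.total P S x := by
      refine Finset.sum_le_sum fun u _ => ?_
      split_ifs with h
      · exact Nat.add_le_add_left (hload u h.1) _
      · exact le_rfl
    by_cases hI : A.Inner x
    · rw [if_pos hI] at h1
      simp only [hI, if_true, stepCost]
      exact Nat.mul_le_mul_left _ (by omega)
    · rw [if_neg hI] at h1
      simp only [hI, if_false, stepCost, zero_add]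
      exact Nat.mul_le_mul_left _ (by omega)
  · have h1 := costAt_le_of_some hA ha (hd x) (hD x) hx
    obtain ⟨hI, hu⟩ := ha x u hx
    have h2 : (∑ z, if A.Above P z u ∧ z ≠ u then A.c z + A.load (A.plan H) n z else 0) ≤
        ∑ z, if A.Above P z u ∧ z ≠ u then A.c z + A.g (A.dig A.m S z) else 0 := by
      refine Finset.sum_le_sum fun z _ => ?_
      split_ifs with h
      · exact Nat.add_le_add_left (hload z h.1.1) _
      · exact le_rfl
    have h3 := sum_above_self (P := P) hu.1 fun z => A.c z + A.g (A.dig A.m S z)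
    have h4 := ((path_spec hA hH (Nat.succ_le_of_lt (hA.rk_lt x))).2 u hu.1).1
    have h5 := (next_spec hA (hfe x)).2.2 u hx
    have h6 : A.path H (A.rk x + 1) = A.next (A.path H (A.rk x)) x (A.plan H x) := by
      rw [path, plan, hA.ord_rk]
    rw [Nat.succ_eq_add_one, h6, h5.1] at h4
    simp only [hI, if_false, zero_add, stepCost, total]
    exact Nat.mul_le_mul_left _ (by omega)

end Path

end Setup

end GraphSearch

namespace GraphSearch

namespace Setup
variable {n : ℕ} {A : Setup n}

open scoped Classical

/-! ### Every decision tree is approximated by a state of the dynamic program -/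

section Lower
variable (D : DecisionTree A.G Set.univ) {P : ℕ}

/-- The guess `P` contains the depths of the inner vertices in the decision tree. -/
def Depths (D : DecisionTree A.G Set.univ) (P : ℕ) : Prop :=
  ∀ u, A.Inner u → A.dig n P u + 1 = (D.queries u).toFinset.card

/-- The number of vertices on a path is between `1` and `n`, so after subtracting one it is a digit
in base `n`. -/
theorem exists_depths : ∃ P < n ^ A.k, Depths D P := by
  rcases Nat.eq_zero_or_pos n with rfl | hn
  · by_cases hk : A.k = 0
    · exact ⟨0, by simp [hk], fun u => u.elim0⟩
    · exact (hk (by simp [k, nonLeafCount, Set.eq_empty_of_isEmpty])).elim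
  · have hpos : ∀ u, 0 < (D.queries u).toFinset.card := fun u =>
      Finset.card_pos.2 ⟨u, List.mem_toFinset.2 (D.mem_queries_self (Set.mem_univ u))⟩
    have hle : ∀ u, (D.queries u).toFinset.card ≤ n := fun u =>
      (Finset.card_le_univ _).trans_eq (Fintype.card_fin n)
    obtain ⟨P, hP, h⟩ := A.exists_dig hn (fun u => (D.queries u).toFinset.card - 1)
      (fun u => by have := hpos u; have := hle u; omega)
    exact ⟨P, hP, fun u hu => by have := hpos u; rw [h u hu]; omega⟩

variable {D}

theorem Depths.dig_lt (hP : Depths D P) {u v : Fin n} (hu : A.Inner u) (hv : A.Inner v)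
    (h : u ∈ D.queries v) (huv : u ≠ v) : A.dig n P u < A.dig n P v := by
  have h1 := hP u hu
  have h2 := hP v hv
  have hsub : (D.queries u).toFinset ⊆ (D.queries v).toFinset := fun z hz =>
    List.mem_toFinset.2 (D.queries_trans (List.mem_toFinset.1 hz) h)
  have := Finset.card_lt_card (s := (D.queries u).toFinset) (t := (D.queries v).toFinset)
    ⟨hsub, fun hsup => huv ((D.queries_antisymm h (List.mem_toFinset.1
      (hsup (List.mem_toFinset.2 (D.mem_queries_self (Set.mem_univ v)))))).symm)⟩
  omega

variable (hA : A.Valid) (hP : Depths D P)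
include hA hP

/-- The proof goes backwards along the walk from `x` to `u`. Neighbouring inner vertices `x` and `y`
are comparable in `D`. If `y` is queried before `x`, transitivity suffices; otherwise `x` and `u`
are both ancestors of `y`, hence comparable, and `x` cannot come strictly before `u`, because it
would then have smaller depth and smaller key. A leaf on the walk is passed through its only
neighbour. -/
theorem mem_queries_of_above {u x : Fin n} (h : A.Above P u x) :
    (A.Inner x → u ∈ D.queries x) ∧
      (¬ A.Inner x → ∀ v, A.G.Adj x v → u ∈ D.queries v) := by
  obtain ⟨hu, -, hc⟩ := h
  induction hc using Relation.ReflTransGen.head_induction_on with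
  | refl => exact ⟨fun _ => D.mem_queries_self (Set.mem_univ u), fun h => (h hu).elim⟩
  | @head x y hxy _ ih =>
    obtain ⟨hadj, hx, hy⟩ := hxy
    refine ⟨fun hxI => ?_, fun hxl v hv => ?_⟩
    · by_cases hyI : A.Inner y
      · have huy := ih.1 hyI
        rcases D.mem_queries_of_adj (Set.mem_univ x) (Set.mem_univ y) hadj with h | h
        · rcases D.queries_chain h huy with h' | h'
          · by_cases hxu : x = u
            · exact hxu ▸ D.mem_queries_self (Set.mem_univ u)
            · exact absurd (hP.dig_lt hxI hu h' hxu) (not_lt.2 (key_le_of_dig_le hu hxI hx))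
          · exact h'
        · exact D.queries_trans huy h
      · exact ih.2 hyI x hadj.symm
    · obtain ⟨z, hz, hz'⟩ := hA.leaf x hxl
      obtain rfl := (hz' y).1 hadj
      obtain rfl := (hz' v).1 hv
      exact ih.1 hz

/-- The assignment of the leaves in a decision tree. -/
theorem exists_assignment : ∃ a : Fin n → Option (Fin n),
    (∀ x, a x = none → ¬ A.Inner x → ∀ u, A.Above P u x → u ∈ D.queries x) ∧
    ∀ x u, a x = some u → ¬ A.Inner x ∧ A.Above P u x ∧ x ∈ D.queries u ∧
      ∀ z, A.Above P z u → z ≠ u → z ∈ D.queries x := by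
  suffices H : ∀ x, ∃ o : Option (Fin n),
      (o = none → ¬ A.Inner x → ∀ u, A.Above P u x → u ∈ D.queries x) ∧
      ∀ u, o = some u → ¬ A.Inner x ∧ A.Above P u x ∧ x ∈ D.queries u ∧
        ∀ z, A.Above P z u → z ≠ u → z ∈ D.queries x by
    choose a h1 h2 using H
    exact ⟨a, h1, h2⟩
  intro x
  by_cases hx : A.Inner x
  · exact ⟨none, fun _ h => (h hx).elim, by simp⟩
  obtain ⟨v, hv, hv'⟩ := hA.leaf x hx
  have hadj : A.G.Adj x v := (hv' v).2 rfl
  by_cases hq : v ∈ D.queries x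
  · refine ⟨none, fun _ _ u hu => ?_, by simp⟩
    exact D.queries_trans ((mem_queries_of_above hA hP hu).2 hx v hadj) hq
  · have hxv : x ∈ D.queries v :=
      (D.mem_queries_of_adj (Set.mem_univ x) (Set.mem_univ v) hadj).resolve_right hq
    have hvx : A.Above P v x :=
      ⟨hv, Conn.head (key_lt_of_inner_of_leaf hv hx).le hadj (Conn.refl le_rfl)⟩
    -- Here `x` comes before its neighbour. It is assigned to the vertex of smallest key among those
    -- above `x` that `D` queries after `x`. A proper ancestor `z` of this `u` is comparable with
    -- `x` in `D`, and by minimality it is not queried after `x`.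
    obtain ⟨u, hu, hmin⟩ := Finset.exists_min_image
      (Finset.univ.filter fun u => A.Above P u x ∧ x ∈ D.queries u) (A.key P)
      ⟨v, by simp [hvx, hxv]⟩
    simp only [Finset.mem_filter, Finset.mem_univ, true_and] at hu hmin
    refine ⟨some u, by simp, ?_⟩
    rintro _ ⟨rfl⟩
    refine ⟨hx, hu.1, hu.2, fun z hz hzu => ?_⟩
    have hzq : z ∈ D.queries u := (mem_queries_of_above hA hP hz).1 hu.1.1
    refine (D.queries_chain hzq hu.2).resolve_right fun hxz => hzu ?_
    have := hmin z ⟨⟨hz.1, hz.2.trans hu.1.2⟩, hxz⟩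
    exact key_injective hz.1 hu.1.1 (le_antisymm hz.2.key_le this)

end Lower

/-- The cost of `x` without the cost of the leaves assigned to the same inner vertex as `x`. -/
noncomputable def baseCost (A : Setup n) (P : ℕ) (a : Fin n → Option (Fin n)) (x : Fin n) : ℕ :=
  (a x).elim ((∑ u, if A.Above P u x then A.c u + A.load a n u else 0) +
    if A.Inner x then 0 else A.c x)
  fun u => ∑ z, if A.Above P z u ∧ z ≠ u then A.c z + A.load a n z else 0

theorem baseCost_none {P : ℕ} {a : Fin n → Option (Fin n)} {x : Fin n} (h : a x = none) :
    A.baseCost P a x = (∑ u, if A.Above P u x then A.c u + A.load a n u else 0) +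
      if A.Inner x then 0 else A.c x := by simp only [baseCost, h, Option.elim_none]

theorem baseCost_some {P : ℕ} {a : Fin n → Option (Fin n)} {x u : Fin n} (h : a x = some u) :
    A.baseCost P a x = ∑ z, if A.Above P z u ∧ z ≠ u then A.c z + A.load a n z else 0 := by
  simp only [baseCost, h, Option.elim_some]

/-- Twice a double sum is the sum of its symmetrised terms. This reduces the exchange argument to
unordered pairs, without any sorting of the leaves in `D`. -/
theorem sum_pairs_le {ι : Type*} [Fintype ι] (f f' : ι → ι → ℕ)
    (h : ∀ x y, f x y + f y x ≤ f' x y + f' y x) : ∑ x, ∑ y, f x y ≤ ∑ x, ∑ y, f' x y := by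
  have key : ∀ f : ι → ι → ℕ, 2 * ∑ x, ∑ y, f x y = ∑ x, ∑ y, (f x y + f y x) := by
    intro f
    simp only [Finset.sum_add_distrib]
    rw [Finset.sum_comm (f := fun x y => f y x)]
    ring
  have := Finset.sum_le_sum fun x (_ : x ∈ Finset.univ) =>
    Finset.sum_le_sum fun y (_ : y ∈ Finset.univ) => h x y
  rw [← key, ← key] at this
  omega

/-- The nominal cost of the assignment of the leaves in a decision tree, before rounding. -/
theorem sum_baseCost_le (hA : A.Valid) {D : DecisionTree A.G Set.univ} {P : ℕ} (hP : Depths D P)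
    {a : Fin n → Option (Fin n)}
    (h0 : ∀ x, a x = none → ¬ A.Inner x → ∀ u, A.Above P u x → u ∈ D.queries x)
    (h1 : ∀ x u, a x = some u → ¬ A.Inner x ∧ A.Above P u x ∧ x ∈ D.queries u ∧
      ∀ z, A.Above P z u → z ≠ u → z ∈ D.queries x) :
    ∑ x, A.w x * (A.baseCost P a x +
      ∑ y, if a x ≠ none ∧ a y = a x ∧ A.rk y ≤ A.rk x then A.c y else 0) ≤
    D.cost A.c A.w := by
  -- For each target, `D` pays the base cost and, separately, the leaves of the same group that it
  -- queries on the way.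
  have hq : ∀ x, A.baseCost P a x +
      (∑ y, if a x ≠ none ∧ a y = a x ∧ y ∈ D.queries x then A.c y else 0) ≤ D.costAt A.c x := by
    intro x
    have hassoc : ∀ z y, z ∈ D.queries x → a y = some z → y ∈ D.queries x := fun z y hz hy =>
      D.queries_trans (h1 y z hy).2.2.1 hz
    rcases hx : a x with _ | u
    · rw [baseCost_none hx, sum_add_load hA a _ fun y u hy _ h => (h1 y u hy).1 h.1]
      have hb : (if A.Inner x then 0 else A.c x) =
          ∑ y, if y = x ∧ ¬ A.Inner x then A.c y else 0 := by
        by_cases h : A.Inner x <;> simp [h]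
      have hmem : ∀ z, A.Above P z x → z ∈ D.queries x := fun z hz => by
        by_cases hI : A.Inner x
        · exact (mem_queries_of_above hA hP hz).1 hI
        · exact h0 x hx hI z hz
      refine le_trans (le_of_eq ?_) (D.sum_le_costAt A.c x (Finset.univ.filter fun y =>
        (A.Above P y x ∨ ∃ u, a y = some u ∧ A.Above P u x) ∨ (y = x ∧ ¬ A.Inner x)) ?_)
      · rw [hb, ← Finset.sum_add_distrib, ← Finset.sum_add_distrib, Finset.sum_filter]
        refine Finset.sum_congr rfl fun y _ => ?_
        have hdis : y = x ∧ ¬ A.Inner x →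
            ¬ (A.Above P y x ∨ ∃ u, a y = some u ∧ A.Above P u x) := by
          rintro ⟨rfl, hI⟩ (h | ⟨u, hu, -⟩)
          · exact hI h.1
          · simp [hx] at hu
        by_cases e1 : A.Above P y x ∨ ∃ u, a y = some u ∧ A.Above P u x
        · have e2 : ¬ (y = x ∧ ¬ A.Inner x) := fun h => hdis h e1
          simp only [e1, e2, ne_eq, not_true_eq_false, false_and, if_true, if_false, true_or,
            add_zero]
        · simp only [e1, ne_eq, not_true_eq_false, false_and, if_false, false_or, zero_add,
            add_zero]
      · simp only [Finset.mem_filter, Finset.mem_univ, true_and]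
        rintro y ((h | ⟨u, hy, h⟩) | ⟨rfl, -⟩)
        · exact hmem y h
        · exact hassoc u y (hmem u h) hy
        · exact D.mem_queries_self (Set.mem_univ _)
    · obtain ⟨hI, hu, hxu, hpre⟩ := h1 x u hx
      rw [baseCost_some hx, sum_add_load hA a _ fun y u hy _ h => (h1 y u hy).1 h.1.1]
      refine le_trans (le_of_eq ?_) (D.sum_le_costAt A.c x (Finset.univ.filter fun y =>
        ((A.Above P y u ∧ y ≠ u) ∨ ∃ z, a y = some z ∧ A.Above P z u ∧ z ≠ u) ∨
          (a y = some u ∧ y ∈ D.queries x)) ?_)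
      · rw [← Finset.sum_add_distrib, Finset.sum_filter]
        refine Finset.sum_congr rfl fun y _ => ?_
        have hdis : a y = some u ∧ y ∈ D.queries x →
            ¬ ((A.Above P y u ∧ y ≠ u) ∨ ∃ z, a y = some z ∧ A.Above P z u ∧ z ≠ u) := by
          rintro ⟨hy, -⟩ (h | ⟨z, hz, -, hzu⟩)
          · exact (h1 y u hy).1 h.1.1
          · rw [hy] at hz
            exact hzu (Option.some.inj hz).symm
        by_cases e1 : (A.Above P y u ∧ y ≠ u) ∨ ∃ z, a y = some z ∧ A.Above P z u ∧ z ≠ u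
        · have e2 : ¬ (a y = some u ∧ y ∈ D.queries x) := fun h => hdis h e1
          simp only [e1, e2, and_false, if_true, if_false, true_or, add_zero]
        · simp only [e1, ne_eq, reduceCtorEq, not_false_eq_true, true_and, if_false, false_or,
            zero_add]
      · simp only [Finset.mem_filter, Finset.mem_univ, true_and]
        rintro y ((h | ⟨z, hy, h⟩) | h)
        · exact hpre y h.1 h.2
        · exact hassoc z y (hpre z h.1 h.2) hy
        · exact h.2
  rw [DecisionTree.cost]
  refine le_trans ?_ (Finset.sum_le_sum fun x _ => Nat.mul_le_mul_left (A.w x) (hq x))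
  simp only [mul_add, Finset.sum_add_distrib, Finset.mul_sum]
  -- Two leaves of one group both precede the same inner vertex in `D`, so one of them precedes the
  -- other and `D` pays at least one of the two cross terms. Smith's order pays the smaller one.
  refine Nat.add_le_add_left (sum_pairs_le _ _ fun x y => ?_) _
  by_cases hxy : a x ≠ none ∧ a y = a x
  · have hyx : a y ≠ none ∧ a x = a y := ⟨hxy.2 ▸ hxy.1, hxy.2.symm⟩
    obtain ⟨u, hu⟩ := Option.ne_none_iff_exists'.1 hxy.1
    have hchain := D.queries_chain (h1 x u hu).2.2.1 (h1 y u (hxy.2.trans hu)).2.2.1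
    simp only [hxy.1, hxy.2, ne_eq, not_false_eq_true, true_and]
    have s1 := hA.smith x y
    have s2 := hA.smith y x
    by_cases hne : x = y
    · subst hne
      have := D.mem_queries_self (Set.mem_univ x)
      simp [this]
    · have hrk : A.rk x ≠ A.rk y := fun h => hne (by rw [← hA.ord_rk x, h, hA.ord_rk])
      rcases lt_or_gt_of_ne hrk with hlt | hlt
      · have := s1 hlt
        rw [if_neg hlt.not_ge, if_pos hlt.le]
        rcases hchain with h | h <;> simp only [h, if_true] <;> split_ifs <;> nlinarith
      · have := s2 hlt
        rw [if_pos hlt.le, if_neg hlt.not_ge]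
        rcases hchain with h | h <;> simp only [h, if_true] <;> split_ifs <;> nlinarith
  · have hyx : ¬ (a y ≠ none ∧ a x = a y) := fun h => hxy ⟨h.2 ▸ h.1, h.2.symm⟩
    have e1 : ∀ q : Prop, ¬ (a x ≠ none ∧ a y = a x ∧ q) := fun q h => hxy ⟨h.1, h.2.1⟩
    have e2 : ∀ q : Prop, ¬ (a y ≠ none ∧ a x = a y ∧ q) := fun q h => hyx ⟨h.1, h.2.1⟩
    simp only [e1, e2, if_false, mul_zero, le_refl]

/-- Up to a factor `1 + ε`, the dynamic program is as good as any decision tree. -/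
theorem value_le (hA : A.Valid) (D : DecisionTree A.G Set.univ) {δ ε : ℝ} (hδ : 0 ≤ δ)
    (hε : ε ≤ 1) (hn : (1 + δ) ^ n ≤ 1 + ε)
    (hgrid : ∀ i < A.m, ∀ v, A.g i + A.c v ≤ 2 * ∑ v, A.c v →
      A.up i v < A.m ∧ (A.g (A.up i v) : ℝ) ≤ (1 + δ) * (A.g i + A.c v : ℕ)) :
    ∃ P < n ^ A.k, ∃ S < A.m ^ A.k, (A.value P S : ℝ) ≤ (1 + ε) * D.cost A.c A.w := by
  obtain ⟨P, hPlt, hP⟩ := exists_depths D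
  obtain ⟨a, h0, h1⟩ := exists_assignment hA hP
  -- The decisions come from `D` and ignore the state of the dynamic program.
  set H : ℕ → ℕ → Option (Fin n) := fun i _ => a (A.ord i) with hH
  have hone : ∀ i, 1 ≤ (1 + δ) ^ i := fun i => one_le_pow₀ (by linarith)
  have hpow : ∀ i ≤ n, (1 + δ) ^ i ≤ 2 := fun i hi =>
    (pow_le_pow_right₀ (by linarith) hi).trans (by linarith)
  have hloadC : ∀ i u, A.load a i u ≤ ∑ v, A.c v := fun i u =>
    Finset.sum_le_sum fun y _ => by split_ifs <;> omega
  -- One more rounding costs one more factor `1 + δ`. The rounded loads stay below twice the total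
  -- cost because `(1 + δ) ^ i ≤ 2`, so they never leave the grid.
  have hstep : ∀ i < n, (∀ u, A.Inner u →
      (A.g (A.dig A.m (A.path H i) u) : ℝ) ≤ (1 + δ) ^ i * A.load a i u) →
      ∀ u, a (A.ord i) = some u → A.up (A.dig A.m (A.path H i) u) (A.ord i) < A.m ∧
        (A.g (A.up (A.dig A.m (A.path H i) u) (A.ord i)) : ℝ) ≤
          (1 + δ) ^ (i + 1) * A.load a (i + 1) u := by
    intro i hi ih u hu
    have hle : ((A.g (A.dig A.m (A.path H i) u) + A.c (A.ord i) : ℕ) : ℝ) ≤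
        (1 + δ) ^ i * A.load a (i + 1) u := by
      rw [load_succ hA a hi, if_pos hu]
      have := ih u (h1 _ u hu).2.1.1
      have := mul_le_mul_of_nonneg_right (hone i) (Nat.cast_nonneg (α := ℝ) (A.c (A.ord i)))
      push_cast
      linarith
    have hle2 : (A.g (A.dig A.m (A.path H i) u) + A.c (A.ord i) : ℕ) ≤ 2 * ∑ v, A.c v := by
      have hc : (A.load a (i + 1) u : ℝ) ≤ (∑ v, A.c v : ℕ) := by exact_mod_cast hloadC _ _
      have := hle.trans (mul_le_mul (hpow i hi.le) hc (by positivity) (by norm_num))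
      exact_mod_cast this
    obtain ⟨g1, g2⟩ := hgrid _ (A.dig_lt hA.m_pos _ u) (A.ord i) hle2
    refine ⟨g1, g2.trans ?_⟩
    rw [pow_succ', mul_assoc]
    exact mul_le_mul_of_nonneg_left hle (by linarith)
  have hinv : ∀ i ≤ n, A.path H i < A.m ^ A.k ∧ ∀ u, A.Inner u →
      (A.g (A.dig A.m (A.path H i) u) : ℝ) ≤ (1 + δ) ^ i * A.load a i u := by
    intro i hi
    induction i with
    | zero =>
      have := hA.m_pos
      exact ⟨by simpa [path] using by positivity, fun u _ => by simp [load, path, dig, hA.zero]⟩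
    | succ i ih =>
      obtain ⟨ih1, ih2⟩ := ih (by omega)
      have hs := hstep i hi ih2
      obtain ⟨n1, n2, n3⟩ := next_spec' hA (X := A.path H i) (l := A.ord i) (o := a (A.ord i))
        fun u hu => ⟨(h1 _ u hu).2.1.1, (hs u hu).1⟩
      refine ⟨n1 ih1, fun u hu => ?_⟩
      by_cases ho : a (A.ord i) = some u
      · have := (hs u ho).2
        rwa [← (n3 u ho).1] at this
      · have := n2 u hu ho
        rw [path, this, load_succ hA a hi, if_neg ho, pow_succ, add_zero]
        refine (ih2 u hu).trans (mul_le_mul_of_nonneg_right ?_ (Nat.cast_nonneg _))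
        exact le_mul_of_one_le_right (by linarith [hone i]) (by linarith)
  -- Recorded loads never decrease, so all intermediate loads respect a guess that equals the final
  -- ones.
  have hmono : ∀ u, A.Inner u → ∀ i ≤ n, ∀ j ≤ i,
      A.dig A.m (A.path H j) u ≤ A.dig A.m (A.path H i) u := by
    intro u hu i hi
    induction i with
    | zero => intro j hj; rw [Nat.le_zero.1 hj]
    | succ i ih =>
      intro j hj
      rcases Nat.le_succ_iff.1 hj with hj | rfl
      · refine (ih (by omega) j hj).trans ?_
        have hs := hstep i hi (hinv i (by omega)).2
        obtain ⟨-, n2, n3⟩ := next_spec' hA (X := A.path H i) (l := A.ord i) (o := a (A.ord i))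
          fun u hu => ⟨(h1 _ u hu).2.1.1, (hs u hu).1⟩
        by_cases ho : a (A.ord i) = some u
        · rw [path, (n3 u ho).1]
          exact le_up hA (hs u ho).1
        · rw [path, n2 u hu ho]
      · exact le_rfl
  obtain ⟨hSlt, hS⟩ := hinv n le_rfl
  -- The guess `S` is the load vector at the end of the path.
  refine ⟨P, hPlt, A.path H n, hSlt, ?_⟩
  have hupS : ∀ i < n, ∀ u, a (A.ord i) = some u →
      A.dig A.m (A.path H (i + 1)) u = A.up (A.dig A.m (A.path H i) u) (A.ord i) := by
    intro i hi u hu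
    have hs := hstep i hi (hinv i (by omega)).2
    exact ((next_spec' hA (X := A.path H i) (l := A.ord i) (o := a (A.ord i))
      fun u hu => ⟨(h1 _ u hu).2.1.1, (hs u hu).1⟩).2.2 u hu).1
  have hfeas : ∀ i < n, A.Feas P (A.path H n) (A.path H i) (A.ord i) (a (A.ord i)) := by
    intro i hi
    rcases ho : a (A.ord i) with _ | u
    · trivial
    · have := h1 _ u ho
      refine ⟨this.1, this.2.1, ?_⟩
      rw [← hupS i hi u ho]
      exact hmono u this.2.1.1 n le_rfl _ hi
  -- An inequality is enough here, because the dynamic program minimises over all admissible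
  -- decisions.
  have hF : ∀ i ≤ n, A.F P (A.path H n) n 0 ≤ (∑ l, if A.rk l < i then
      A.stepCost P (A.path H n) (A.path H (A.rk l)) l (a l) else 0) +
      A.F P (A.path H n) (n - i) (A.path H i) := by
    intro i hi
    induction i with
    | zero => simp [path]
    | succ i ih =>
      refine (ih (by omega)).trans ?_
      rw [sum_rk_succ hA hi, hA.rk_ord i hi, add_assoc]
      refine Nat.add_le_add_left ?_ _
      have e1 : n - i = (n - (i + 1)) + 1 := by omega
      have e2 : n - (n - (i + 1) + 1) = i := by omega
      have := F_le (A := A) (P := P) (S := A.path H n) (r := n - (i + 1)) (X := A.path H i)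
        (o := a (A.ord i)) (by rw [e2]; exact hfeas i hi)
      rw [e2] at this
      rwa [e1]
  have hF' := hF n le_rfl
  simp only [hA.rk_lt, if_true, Nat.sub_self, F, add_zero] at hF'
  have hval : A.value P (A.path H n) ≤ ∑ x, ((if A.Inner x then
      A.w x * A.total P (A.path H n) x else 0) +
      A.stepCost P (A.path H n) (A.path H (A.rk x)) x (a x)) := by
    rw [Finset.sum_add_distrib]
    exact Nat.add_le_add_left hF' _
  have hlam : 1 ≤ 1 + ε := (hone n).trans hn
  have hgload : ∀ u, A.Inner u → ((A.c u + A.g (A.dig A.m (A.path H n) u) : ℕ) : ℝ) ≤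
      (1 + ε) * (A.c u + A.load a n u : ℕ) := by
    intro u hu
    have b1 := hS u hu
    have b2 := mul_le_mul_of_nonneg_right hn (Nat.cast_nonneg (α := ℝ) (A.load a n u))
    have b3 := mul_le_mul_of_nonneg_right hlam (Nat.cast_nonneg (α := ℝ) (A.c u))
    push_cast
    linarith
  have hsum : ∀ (p : Fin n → Prop) [DecidablePred p], (∀ u, p u → A.Inner u) →
      ((∑ u, if p u then A.c u + A.g (A.dig A.m (A.path H n) u) else 0 : ℕ) : ℝ) ≤
      (1 + ε) * (∑ u, if p u then A.c u + A.load a n u else 0 : ℕ) := by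
    intro p _ hp
    rw [Nat.cast_sum, Nat.cast_sum, Finset.mul_sum]
    refine Finset.sum_le_sum fun u _ => ?_
    split_ifs with h
    · exact hgload u (hp u h)
    · simp
  have hcost := sum_baseCost_le hA hP h0 h1
  refine (Nat.cast_le.2 hval).trans (le_trans ?_
    (mul_le_mul_of_nonneg_left (Nat.cast_le.2 hcost) (by linarith)))
  rw [Nat.cast_sum, Nat.cast_sum, Finset.mul_sum]
  refine Finset.sum_le_sum fun x _ => ?_
  rw [Nat.cast_mul, mul_left_comm]
  rcases hx : a x with _ | u
  · have b1 := hsum (fun u => A.Above P u x) fun u hu => hu.1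
    have b2 : (A.c x : ℝ) ≤ (1 + ε) * A.c x :=
      le_mul_of_one_le_left (Nat.cast_nonneg _) hlam
    rw [baseCost_none hx]
    by_cases hI : A.Inner x
    · simp only [hI, if_true, stepCost, add_zero, ne_eq, not_true_eq_false, false_and, if_false,
        Finset.sum_const_zero, Nat.cast_mul]
      exact mul_le_mul_of_nonneg_left b1 (Nat.cast_nonneg _)
    · simp only [hI, if_false, stepCost, add_zero, zero_add, ne_eq, not_true_eq_false, false_and,
        Finset.sum_const_zero, Nat.cast_mul]
      refine mul_le_mul_of_nonneg_left ?_ (Nat.cast_nonneg _)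
      rw [Nat.cast_add, Nat.cast_add, mul_add]
      exact add_le_add b1 b2
  · obtain ⟨hI, hu, -⟩ := h1 x u hx
    have b1 := hsum (fun z => A.Above P z u ∧ z ≠ u) fun z hz => hz.1.1
    have b2 := (hstep (A.rk x) (hA.rk_lt x) (hinv _ (hA.rk_lt x).le).2 u
      (by rw [hA.ord_rk]; exact hx)).2
    rw [hA.ord_rk] at b2
    have b3 : (A.load a (A.rk x + 1) u : ℝ) * (1 + δ) ^ (A.rk x + 1) ≤
        A.load a (A.rk x + 1) u * (1 + ε) :=
      mul_le_mul_of_nonneg_left ((pow_le_pow_right₀ (by linarith) (hA.rk_lt x)).trans hn)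
        (Nat.cast_nonneg _)
    have b4 := sum_above_self (P := P) hu.1 fun z =>
      A.c z + A.g (A.dig A.m (A.path H n) z)
    have b5 : (∑ y, if some u ≠ none ∧ a y = some u ∧ A.rk y ≤ A.rk x then A.c y else 0) =
        A.load a (A.rk x + 1) u := by
      refine Finset.sum_congr rfl fun y _ => ?_
      simp only [ne_eq, reduceCtorEq, not_false_eq_true, true_and, Nat.lt_succ_iff, and_comm]
    rw [baseCost_some hx, b5]
    simp only [hI, if_false, stepCost, zero_add, Nat.cast_mul]
    refine mul_le_mul_of_nonneg_left ?_ (Nat.cast_nonneg _)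
    rw [total, b4, Nat.add_sub_cancel_left, Nat.cast_add, Nat.cast_add, mul_add]
    exact add_le_add b1 (by linarith)

end Setup

end GraphSearch

namespace GraphSearch

/-! ### The order of the vertices and the grid of loads -/

section Instance
variable {n : ℕ}

/-- `u` comes before `v`: the ratio of cost to weight of `u` is smaller, where weights `x` are
replaced by `x + 1 / M` to avoid divisions by zero. -/
def Before (c w : Fin n → ℕ) (M : ℕ) (u v : Fin n) : Prop :=
  c u * (w v * M + 1) < c v * (w u * M + 1) ∨
    c u * (w v * M + 1) = c v * (w u * M + 1) ∧ u < v

instance (c w : Fin n → ℕ) (M : ℕ) (u v : Fin n) : Decidable (Before c w M u v) :=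
  inferInstanceAs (Decidable (_ ∨ _))

/-- The number of vertices before `v`. -/
def rank (c w : Fin n → ℕ) (M : ℕ) (v : Fin n) : ℕ := ∑ u, if Before c w M u v then 1 else 0

variable {c w : Fin n → ℕ} {M : ℕ}

/-- With positive denominators the comparison is the order of the ratios, ties broken by the index,
hence linear. The plain comparison of cross products fails to be transitive as soon as cost and
weight of a vertex both vanish. -/
theorem before_iff {u v : Fin n} : Before c w M u v ↔
    toLex ((c u : ℚ) / (w u * M + 1), u) < toLex ((c v : ℚ) / (w v * M + 1), v) := by
  have h : ∀ v, (0 : ℚ) < w v * M + 1 := fun v => by positivity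
  rw [Prod.Lex.toLex_lt_toLex, div_lt_div_iff₀ (h u) (h v), div_eq_div_iff (h u).ne' (h v).ne',
    Before]
  norm_cast

theorem rank_lt {u v : Fin n} (h : Before c w M u v) : rank c w M u < rank c w M v := by
  refine Finset.sum_lt_sum (fun z _ => ?_) ⟨u, Finset.mem_univ u, ?_⟩
  · split_ifs with h1 h2
    · exact le_rfl
    · exact absurd (before_iff.2 ((before_iff.1 h1).trans (before_iff.1 h))) h2
    · exact Nat.zero_le _
    · exact le_rfl
  · rw [if_pos h, if_neg fun h' => lt_irrefl _ (before_iff.1 h')]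
    exact Nat.zero_lt_one

theorem before_or_before {u v : Fin n} (h : u ≠ v) : Before c w M u v ∨ Before c w M v u := by
  rw [before_iff, before_iff]
  exact lt_or_gt_of_ne fun h' => h (congrArg Prod.snd (toLex.injective h'))

theorem rank_injective : Function.Injective (rank c w M) := by
  intro u v huv
  by_contra hne
  rcases before_or_before hne with h | h
  · exact (rank_lt h).ne huv
  · exact (rank_lt h).ne' huv

theorem rank_lt_card (v : Fin n) : rank c w M v < n := by
  refine (Finset.sum_lt_sum (g := fun _ => 1) (fun z _ => by split_ifs <;> simp)
    ⟨v, Finset.mem_univ v, ?_⟩).trans_eq (by simp)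
  rw [if_neg fun h' => lt_irrefl _ (before_iff.1 h')]
  exact Nat.zero_lt_one

theorem before_of_rank_lt {u v : Fin n} (h : rank c w M u < rank c w M v) : Before c w M u v :=
  (before_or_before fun huv => h.ne (congrArg _ huv)).resolve_right fun h' => (rank_lt h').not_gt h

/-- The modification of the weights is too small to matter: if `c u * w v` exceeded `c v * w u`, it
would do so by at least one, and after scaling by at least `M`, while the correction is at most `c v
< M`. -/
theorem smith_of_rank_lt (hM : ∀ v, c v < M) {u v : Fin n}
    (h : rank c w M u < rank c w M v) : c u * w v ≤ c v * w u := by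
  have h1 : c u * (w v * M + 1) ≤ c v * (w u * M + 1) :=
    (before_of_rank_lt h).elim le_of_lt fun h => h.1.le
  by_contra hlt
  have h2 : (c v * w u + 1) * M ≤ c u * w v * M := Nat.mul_le_mul_right _ (by omega)
  have := hM v
  nlinarith

/-- The grid of loads: it starts at `0` and grows by a factor of about `1 + a / b`. -/
def grid (a b : ℕ) : ℕ → ℕ
  | 0 => 0
  | i + 1 => grid a b i + max 1 (grid a b i * a / b)

theorem grid_strictMono (a b : ℕ) : StrictMono (grid a b) :=
  strictMono_nat_of_lt_succ fun i => by rw [grid]; omega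

theorem exists_le_grid (a b x : ℕ) : ∃ i, x ≤ grid a b i :=
  ⟨x, (grid_strictMono a b).le_apply⟩

open scoped Classical in
/-- The number of grid points up to the first one that is at least `x`. -/
noncomputable def gridSize (a b x : ℕ) : ℕ := Nat.find (exists_le_grid a b x) + 1

theorem le_grid_gridSize (a b x : ℕ) : x ≤ grid a b (gridSize a b x - 1) := by
  classical
  exact Nat.find_spec (exists_le_grid a b x)

theorem grid_lt {a b x i : ℕ} (h : i + 1 < gridSize a b x) : grid a b i < x := by
  classical
  exact not_le.1 (Nat.find_min (exists_le_grid a b x) (by rw [gridSize] at h; omega))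

theorem lt_gridSize {a b x i : ℕ} (h : grid a b i < x) : i + 1 < gridSize a b x := by
  by_contra hle
  have h1 := (grid_strictMono a b).monotone (show gridSize a b x - 1 ≤ i by omega)
  have := le_grid_gridSize a b x
  omega

theorem gridSize_eq {a b x i : ℕ} (h : x ≤ grid a b i) (h' : ∀ j < i, grid a b j < x) :
    gridSize a b x = i + 1 := by
  have h1 : gridSize a b x ≤ i + 1 := by
    by_contra hlt
    exact absurd (grid_lt (not_le.1 hlt)) (not_lt.2 h)
  rcases i with _ | i
  · exact le_antisymm h1 (Nat.succ_le_succ (Nat.zero_le _))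
  · have := lt_gridSize (h' i (Nat.lt_succ_self i))
    omega

end Instance

/-- The data of the dynamic program for an instance of the problem. -/
noncomputable def setup (ε : ℚ) {n : ℕ} [NeZero n] (G : SimpleGraph (Fin n)) (c w : Fin n → ℕ) :
    Setup n where
  G := G
  c := c
  w := w
  g := grid ε.num.toNat (2 * n * ε.den)
  m := gridSize ε.num.toNat (2 * n * ε.den) (2 * ∑ v, c v)
  rk := rank c w ((∑ v, c v) + 1)
  ord := Function.invFun (rank c w ((∑ v, c v) + 1))

/-- If the neighbour of a leaf were a leaf too, the edge between them would be a whole component, so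
by connectedness there would be no inner vertex. -/
theorem setup_leaf {n : ℕ} {G : SimpleGraph (Fin n)} (hG : G.Connected)
    (hk : ∃ v, (G.neighborSet v).ncard ≠ 1) (l : Fin n) (hl : (G.neighborSet l).ncard = 1) :
    ∃ v, (G.neighborSet v).ncard ≠ 1 ∧ ∀ z, G.Adj l z ↔ z = v := by
  obtain ⟨v, hv⟩ := Set.ncard_eq_one.1 hl
  have hlv : ∀ z, G.Adj l z ↔ z = v := fun z => by
    rw [← SimpleGraph.mem_neighborSet, hv, Set.mem_singleton_iff]
  refine ⟨v, fun hv1 => ?_, hlv⟩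
  obtain ⟨u, hu⟩ := hk
  obtain ⟨v', hv'⟩ := Set.ncard_eq_one.1 hv1
  have hvl : ∀ z, G.Adj v z ↔ z = v' := fun z => by
    rw [← SimpleGraph.mem_neighborSet, hv', Set.mem_singleton_iff]
  obtain rfl := (hvl l).1 ((hlv v).2 rfl).symm
  have hreach : ∀ z, Relation.ReflTransGen G.Adj l z → z = l ∨ z = v := by
    intro z hz
    induction hz with
    | refl => exact .inl rfl
    | tail _ hab ih =>
      rcases ih with rfl | rfl
      · exact .inr ((hlv _).1 hab)
      · exact .inl ((hvl _).1 hab)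
  rcases hreach u ((SimpleGraph.reachable_iff_reflTransGen l u).1 (hG.preconnected l u))
    with rfl | rfl
  · exact hu hl
  · exact hu hv1

theorem setup_valid (ε : ℚ) {n : ℕ} [NeZero n] {G : SimpleGraph (Fin n)} (c w : Fin n → ℕ)
    (hG : G.Connected) (hk : ∃ v, (G.neighborSet v).ncard ≠ 1) : (setup ε G c w).Valid where
  leaf l hl := setup_leaf hG hk l (not_not.1 hl)
  rk_lt := rank_lt_card
  ord_rk := Function.leftInverse_invFun rank_injective
  rk_ord i hi := by
    have hb : Function.Bijective fun v => (⟨rank c w ((∑ v, c v) + 1) v, rank_lt_card v⟩ : Fin n) :=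
      (Finite.injective_iff_bijective).1 fun u v h => rank_injective (Fin.mk.inj h)
    obtain ⟨v, hv⟩ := hb.2 ⟨i, hi⟩
    have hv' : rank c w ((∑ v, c v) + 1) v = i := Fin.mk.inj hv
    exact Function.invFun_eq ⟨v, hv'⟩
  smith u v h := smith_of_rank_lt (fun v => Nat.lt_succ_of_le
    (Finset.single_le_sum (f := c) (fun _ _ => Nat.zero_le _) (Finset.mem_univ v))) h
  mono := grid_strictMono _ _
  zero := rfl
  m_pos := Nat.succ_pos _

/-- Let the rounded value be the successor of the grid point `g j < y`. If the step is `1`,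
integrality gives `g (j + 1) ≤ y`, so nothing is lost; otherwise the step is at most `δ * g j`. The
last grid point is at least twice the total cost, so rounding succeeds. -/
theorem setup_grid (ε : ℚ) (hε : 0 < ε) {n : ℕ} [NeZero n] {G : SimpleGraph (Fin n)}
    {c w : Fin n → ℕ} (hA : (setup ε G c w).Valid) :
    ∀ i < (setup ε G c w).m, ∀ v,
      (setup ε G c w).g i + (setup ε G c w).c v ≤ 2 * ∑ v, (setup ε G c w).c v →
      (setup ε G c w).up i v < (setup ε G c w).m ∧
      ((setup ε G c w).g ((setup ε G c w).up i v) : ℝ) ≤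
        (1 + (ε : ℝ) / (2 * n)) * ((setup ε G c w).g i + (setup ε G c w).c v : ℕ) := by
  intro i hi v hle
  set A := setup ε G c w with hAdef
  obtain ⟨h1, h2, h3⟩ := Setup.up_spec hA (i := i) (v := v)
  have hm := hA.m_pos
  have hlast : A.g i + A.c v ≤ A.g (A.m - 1) := hle.trans (le_grid_gridSize _ _ _)
  have hup : A.up i v ≤ A.m - 1 := h1 _ (by omega) hlast
  refine ⟨by omega, ?_⟩
  have hδ : (0 : ℝ) ≤ (ε : ℝ) / (2 * n) := by positivity
  set y := A.g i + A.c v with hy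
  rcases hj : A.up i v with _ | j
  · rw [hA.zero, Nat.cast_zero]
    positivity
  · have hlt := h3 j (by omega)
    have hg : A.g (j + 1) = A.g j + max 1 (A.g j * ε.num.toNat / (2 * n * ε.den)) := rfl
    have hgj : (A.g j : ℝ) + 1 ≤ y := by exact_mod_cast hlt
    rw [hg]
    rcases le_total (A.g j * ε.num.toNat / (2 * n * ε.den)) 1 with h | h
    · rw [max_eq_left h]
      push_cast
      nlinarith [mul_nonneg hδ (Nat.cast_nonneg (α := ℝ) y)]
    · rw [max_eq_right h]
      have hd : ((A.g j * ε.num.toNat / (2 * n * ε.den) : ℕ) : ℝ) ≤ A.g j * (ε / (2 * n)) := by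
        refine Nat.cast_div_le.trans (le_of_eq ?_)
        have hn : (n : ℝ) ≠ 0 := Nat.cast_ne_zero.2 (NeZero.ne n)
        have hden : (ε.den : ℝ) ≠ 0 := Nat.cast_ne_zero.2 ε.den_nz
        have hnum : ((ε.num.toNat : ℕ) : ℝ) = ε.num := by
          exact_mod_cast Int.toNat_of_nonneg (Rat.num_pos.2 hε).le
        have he : (ε : ℝ) = ε.num / ε.den := Rat.cast_def ε
        push_cast
        rw [hnum, he]
        field_simp
      push_cast
      nlinarith [mul_nonneg hδ (Nat.cast_nonneg (α := ℝ) y)]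

end GraphSearch

namespace GraphSearch

/-! ### The program: preparation

Registers: `3` holds `n ^ k`, `4` the size `m` of the grid, `5` holds `m ^ k`, `6` the total cost,
`7` the denominator of the step of the grid, `8` one plus the value of the best tree found so far (or
`0`), `9` and `10` the guesses; the other ones are temporary.
Arrays: `4` marks the inner vertices, `5` and `6` hold the powers of `n` and of `m` that belong to
the inner vertices, `7` the order of the vertices, `8` the grid, `9` the table of `Setup.up`, `10` the
keys, `11` the ancestor table, `12` the guessed loads, `13` the nominal costs, `14` and `15` the
values and the decisions of the dynamic program. -/

open GraphSearch.Expr GraphSearch.Program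

infixr:60 ";;" => Program.seq

/-- Mark the inner vertices. -/
def markInner : Program :=
  forTo 11 0 (sumTo 12 13 0 (get 0 (var 11 * var 0 + var 13)) ;;
    store 4 (var 11) (1 - (var 12).same 1))

/-- Store the powers of the register `base` for the inner vertices in the array `a`, and the last
one in the register `out`. -/
def powers (base out a : ℕ) : Program :=
  assign out 1 ;;
  forTo 11 0 (ite (get 4 (var 11)) (store a (var 11) (var out) ;; assign out (var out * var base))
    skip)

/-- Compute the total cost. -/
def sumCosts : Program := sumTo 6 11 0 (get 1 (var 11))

/-- The product of the cost of `u` and the modified weight of `v`. -/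
def ratioExpr (u v : ℕ) : Expr := get 1 (var u) * (get 2 (var v) * (var 6 + 1) + 1)

/-- Sort the vertices. -/
def sortVertices : Program :=
  forTo 11 0 (sumTo 12 13 0 ((ratioExpr 13 11).less (ratioExpr 11 13) +
      (ratioExpr 13 11).same (ratioExpr 11 13) * (var 13).less (var 11)) ;;
    store 7 (var 12) (var 11))

/-- Compute the grid. -/
def makeGrid : Program :=
  assign 7 (2 * var 0 * var 2) ;; assign 4 0 ;; store 8 0 0 ;;
  loop ((get 8 (var 4)).less (2 * var 6))
    (store 8 (var 4 + 1) (get 8 (var 4) + maximum 1 (get 8 (var 4) * var 1 / var 7)) ;;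
      assign 4 (var 4 + 1)) ;;
  assign 4 (var 4 + 1)

/-- Compute the table of `Setup.up`. -/
def roundUp : Program :=
  forTo 11 4 (forTo 12 0 (
    sumTo 13 14 4 ((get 8 (var 14)).less (get 8 (var 11) + get 1 (var 12))) ;;
    store 9 (var 11 * var 0 + var 12) (var 13)))

theorem index_injective {n : ℕ} {a b : ℕ} {u v : Fin n} (h : a * n + u = b * n + v) :
    a = b ∧ u = v := by
  have hn : 0 < n := u.pos
  have h1 : (a * n + u) / n = (b * n + v) / n := by rw [h]
  have h2 : (a * n + u) % n = (b * n + v) % n := by rw [h]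
  rw [Nat.mul_add_mod_self_right, Nat.mul_add_mod_self_right, Nat.mod_eq_of_lt u.2,
    Nat.mod_eq_of_lt v.2] at h2
  refine ⟨?_, Fin.ext h2⟩
  rw [h2] at h
  exact Nat.eq_of_mul_eq_mul_right hn (Nat.add_right_cancel h)

open scoped Classical

theorem Wp.markInner {N n T : ℕ} {A : Setup n} {σ : State} (hN : n < N) (h0 : σ.reg 0 = n)
    (hadj : ∀ u v : Fin n, σ.arr 0 (u * n + v) = if A.G.Adj u v then 1 else 0)
    (hT : n * (n * 17 + 23) + 6 ≤ T) :
    Wp N markInner T σ fun τ => ∀ v : Fin n, τ.arr 4 v = if A.Inner v then 1 else 0 := by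
  refine Wp.forTo (n * 17 + 15) (fun j τ => ∀ v : Fin n, v.1 < j →
    τ.arr 4 v = if A.Inner v then 1 else 0) h0 hN.le (by simp) ?_ ?_ rfl hT
  · intro j hj τ hr hf hi
    have e0 : τ.reg 0 = n := (hf.reg 0 rfl).trans h0
    have e1 : τ.arr 0 = σ.arr 0 := hf.arr 0 rfl
    have hsum : ∑ u ∈ Finset.range n, τ.arr 0 (j * n + u) =
        (A.G.neighborSet ⟨j, hj⟩).ncard := by
      rw [Finset.sum_range, Set.ncard_eq_toFinset_card', Finset.card_eq_sum_ones, e1]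
      rw [Finset.sum_congr rfl fun u _ => hadj ⟨j, hj⟩ u, ← Finset.sum_filter]
      congr 1
      ext u
      simp
    have hdeg : (A.G.neighborSet ⟨j, hj⟩).ncard ≤ n := by
      rw [Set.ncard_eq_toFinset_card']
      exact (Finset.card_le_univ _).trans_eq (Fintype.card_fin n)
    refine Wp.seq (n * (6 + 11) + 8) 7 (Q₁ := fun τ' => τ'.reg 12 =
      (A.G.neighborSet ⟨j, hj⟩).ncard) (Wp.sumTo (fun u => τ.arr 0 (j * n + u)) e0 hN.le
      ?_ (hsum.trans_le (hdeg.trans hN.le)) ?_ rfl le_rfl) le_rfl ?_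
    · intro u hu v
      simp [hr, e0]
    · simp [hsum]
    · intro τ₁ hf₁ h12
      have e11 : τ₁.reg 11 = j := (hf₁.reg 11 rfl).trans hr
      have e4 : τ₁.arr 4 = τ.arr 4 := hf₁.arr 4 rfl
      refine Wp.store ?_ le_rfl ?_
      · simp only [eval_sub, eval_one]; omega
      · intro v hv
        simp only [setReg_arr, setArr_arr, eval_var, e11, eval_sub, eval_same, eval_one, h12, e4,
          true_and]
        by_cases hvj : (v : ℕ) = j
        · obtain rfl : v = ⟨j, hj⟩ := Fin.ext hvj
          by_cases hI : (A.G.neighborSet ⟨j, hj⟩).ncard = 1 <;> simp [Setup.Inner, hI]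
        · rw [if_neg hvj]
          exact hi v (by omega)
  · intro τ _ _ hi v
    exact hi v v.2

theorem Wp.powers {N n T base out a b : ℕ} {A : Setup n} {σ : State} (hN : n ≤ N)
    (h0 : σ.reg 0 = n) (hb : σ.reg base = b) (hb0 : 0 < b) (hbN : b ^ A.k ≤ N)
    (hin : ∀ v : Fin n, σ.arr 4 v = if A.Inner v then 1 else 0)
    (ha : a ≠ 4) (ho : out ≠ 0 ∧ out ≠ 11 ∧ out ≠ base ∧ base ≠ 11)
    (hT : n * 18 + 8 ≤ T) :
    Wp N (powers base out a) T σ fun τ => τ.reg out = b ^ A.k ∧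
      ∀ v : Fin n, A.Inner v → τ.arr a v = b ^ A.idx v := by
  obtain ⟨o0, o11, ob, b11⟩ := ho
  have hpN : ∀ i, i ≤ A.k → b ^ i ≤ N := fun i hi => (Nat.pow_le_pow_right hb0 hi).trans hbN
  -- This extends `idx` from vertices to all values of the loop counter, including `n`, where it
  -- equals `k`.
  set cnt : ℕ → ℕ := fun j => (Finset.univ.filter fun v : Fin n => A.Inner v ∧ v.1 < j).card
    with hcnt
  have hidx : ∀ v, A.idx v = cnt v := fun v => rfl
  have hk : cnt n = A.k := by
    rw [Setup.k, nonLeafCount, Set.ncard_eq_toFinset_card', hcnt]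
    refine congrArg Finset.card ?_
    ext v
    simp only [Finset.mem_filter, Finset.mem_univ, true_and, v.2, and_true, Set.mem_toFinset]
    rfl
  have hmono : ∀ j ≤ n, cnt j ≤ A.k := fun j hj => hk ▸ Finset.card_le_card fun v hv => by
    simp only [Finset.mem_filter, Finset.mem_univ, true_and] at hv ⊢
    exact ⟨hv.1, hv.2.trans_le hj⟩
  have hsucc : ∀ j (hj : j < n), cnt (j + 1) = cnt j + if A.Inner ⟨j, hj⟩ then 1 else 0 := by
    intro j hj
    have : (Finset.univ.filter fun v : Fin n => A.Inner v ∧ v.1 < j + 1) =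
        (Finset.univ.filter fun v : Fin n => A.Inner v ∧ v.1 < j) ∪
          if A.Inner ⟨j, hj⟩ then {⟨j, hj⟩} else ∅ := by
      ext v
      simp only [Finset.mem_union, Finset.mem_filter, Finset.mem_univ, true_and]
      have hv : v.1 < j + 1 ↔ v.1 < j ∨ v = ⟨j, hj⟩ := by
        rw [Nat.lt_succ_iff_lt_or_eq, Fin.ext_iff]
      rw [hv]
      split_ifs with hI
      · simp only [Finset.mem_singleton]
        constructor
        · rintro ⟨h1, h2 | h2⟩
          exacts [.inl ⟨h1, h2⟩, .inr h2]
        · rintro (⟨h1, h2⟩ | rfl)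
          exacts [⟨h1, .inl h2⟩, ⟨hI, .inr rfl⟩]
      · simp only [Finset.notMem_empty, or_false]
        constructor
        · rintro ⟨h1, h2 | rfl⟩
          exacts [⟨h1, h2⟩, (hI h1).elim]
        · rintro ⟨h1, h2⟩
          exact ⟨h1, .inl h2⟩
    rw [hcnt]
    simp only [this]
    rw [Finset.card_union_of_disjoint]
    · split_ifs <;> simp
    · rw [Finset.disjoint_left]
      intro v hv
      simp only [Finset.mem_filter, Finset.mem_univ, true_and] at hv
      split_ifs
      · simp only [Finset.mem_singleton]
        rintro rfl
        exact lt_irrefl _ hv.2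
      · simp
  refine Wp.assign_seq (T₂ := n * 18 + 6) ?_ (by simp only [size_one]; omega) ?_
  · exact (Nat.one_le_pow _ _ hb0).trans hbN
  refine Wp.forTo 10 (fun j τ => τ.reg out = b ^ cnt j ∧ ∀ v : Fin n, v.1 < j → A.Inner v →
    τ.arr a v = b ^ cnt v) (by simpa [Ne.symm o0] using h0) hN ?_ ?_ ?_ ?_ le_rfl
  · simp [hcnt, o11]
  · rintro j hj τ hr hf ⟨hi1, hi2⟩
    have e4 : τ.arr 4 = σ.arr 4 := hf.arr 4 (by simp [GraphSearch.forTo, writesArr, ha])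
    have eb : τ.reg base = b := by
      rw [hf.reg base (by simp [GraphSearch.forTo, writesReg, ob, b11.symm])]
      simp [Ne.symm ob, hb]
    have hev : (get 4 (var 11)).eval τ = if A.Inner ⟨j, hj⟩ then 1 else 0 := by
      simpa [hr, e4] using hin ⟨j, hj⟩
    refine Wp.ite 7 le_rfl (fun h => ?_) (fun h => ?_)
    · rw [hev] at h
      have hI : A.Inner ⟨j, hj⟩ := by
        by_contra hI
        simp [hI] at h
      have hs := hsucc j hj
      rw [if_pos hI] at hs
      refine Wp.store_seq (T₂ := 4) ?_ le_rfl ?_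
      · simp only [eval_var, hi1]
        exact hpN _ (hmono _ hj.le)
      refine Wp.assign ?_ le_rfl ?_
      · simp only [eval_mul, eval_var, setArr_reg, hi1, eb]
        rw [← pow_succ, ← hs]
        exact hpN _ (hmono _ hj)
      · simp only [setReg_reg, setReg_arr, setArr_reg, setArr_arr, eval_var, eval_mul, hi1, eb, hr,
          true_and, o11, if_false, if_true]
        refine ⟨by rw [← pow_succ, ← hs], fun v hv hvI => ?_⟩
        split_ifs with hvj
        · rw [← hvj]
        · exact hi2 v (by omega) hvI
    · rw [hev] at h
      have hI : ¬ A.Inner ⟨j, hj⟩ := by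
        intro hI
        simp [hI] at h
      have hs := hsucc j hj
      rw [if_neg hI] at hs
      refine Wp.skip (by omega) ?_
      simp only [setReg_reg, setReg_arr, o11, if_false]
      refine ⟨by rw [hi1, hs, add_zero], fun v hv hvI => ?_⟩
      rcases Nat.lt_succ_iff_lt_or_eq.1 hv with h' | h'
      · exact hi2 v h' hvI
      · exact (hI ((Fin.ext h' : v = ⟨j, hj⟩) ▸ hvI)).elim
  · rintro τ - - ⟨hi1, hi2⟩
    exact ⟨by rw [hi1, hk], fun v hv => by rw [hi2 v v.2 hv, hidx]⟩
  · simp [writesReg, o11, o0]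

theorem Wp.sumCosts {N n T : ℕ} {c : Fin n → ℕ} {σ : State} (hN : n ≤ N) (h0 : σ.reg 0 = n)
    (hc : ∀ v : Fin n, σ.arr 1 v = c v) (hcN : ∑ v, c v ≤ N) (hT : n * 13 + 8 ≤ T) :
    Wp N sumCosts T σ fun τ => τ.reg 6 = ∑ v, c v := by
  have hsum : ∑ v ∈ Finset.range n, σ.arr 1 v = ∑ v, c v := by
    rw [Finset.sum_range]
    exact Finset.sum_congr rfl fun v _ => hc v
  refine Wp.sumTo (fun j => σ.arr 1 j) h0 hN ?_ (by rwa [hsum]) ?_ rfl hT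
  · intro j _ v; simp
  · simp [hsum]

/-- The position of a vertex is the number of vertices before it; positions are distinct, so no
entry is overwritten. The two summands of the test exclude each other, hence their sum is `0` or
`1`. -/
theorem Wp.sortVertices {N n T C : ℕ} {c w : Fin n → ℕ} {σ : State} (hN : n ≤ N)
    (h0 : σ.reg 0 = n) (hc : ∀ v : Fin n, σ.arr 1 v = c v) (hw : ∀ v : Fin n, σ.arr 2 v = w v)
    (h6 : σ.reg 6 = C) (hT : n * (n * 62 + 19) + 6 ≤ T) :
    Wp N sortVertices T σ fun τ => ∀ v : Fin n, τ.arr 7 (rank c w (C + 1) v) = v := by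
  refine Wp.forTo (n * 62 + 11) (fun j τ => ∀ v : Fin n, v.1 < j →
    τ.arr 7 (rank c w (C + 1) v) = v) h0 hN (by simp) ?_ ?_ rfl hT
  · intro j hj τ hr hf hi
    have e0 : τ.reg 0 = n := (hf.reg 0 rfl).trans h0
    have e6 : τ.reg 6 = C := (hf.reg 6 rfl).trans h6
    have e1 : τ.arr 1 = σ.arr 1 := hf.arr 1 rfl
    have e2 : τ.arr 2 = σ.arr 2 := hf.arr 2 rfl
    set f : ℕ → ℕ := fun u => if h : u < n then
      (if Before c w (C + 1) ⟨u, h⟩ ⟨j, hj⟩ then 1 else 0) else 0 with hf'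
    have hsum : ∑ u ∈ Finset.range n, f u = rank c w (C + 1) ⟨j, hj⟩ := by
      rw [Finset.sum_range, rank]
      exact Finset.sum_congr rfl fun u _ => by simp [hf']
    refine Wp.seq (n * (51 + 11) + 8) 3 (Q₁ := fun τ' => τ'.reg 12 =
      rank c w (C + 1) ⟨j, hj⟩) (Wp.sumTo f e0 hN ?_ ?_ ?_ rfl le_rfl) le_rfl ?_
    · intro u hu v
      have hcu := hc ⟨u, hu⟩
      have hcj := hc ⟨j, hj⟩
      have hwu := hw ⟨u, hu⟩
      have hwj := hw ⟨j, hj⟩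
      simp only at hcu hcj hwu hwj
      simp only [ratioExpr, eval_add, eval_mul, eval_less, eval_same, eval_get, eval_var, eval_one,
        setReg_reg, setReg_arr, e1, e2, e6, hr, if_true, Nat.reduceEqDiff, if_false, hcu, hcj, hwu,
        hwj, hf', hu, dite_true, Before, Fin.mk_lt_mk]
      split_ifs <;> omega
    · rw [hsum]; exact (rank_lt_card _).le.trans hN
    · simp [hsum]
    · intro τ₁ hf₁ h12
      have e11 : τ₁.reg 11 = j := (hf₁.reg 11 rfl).trans hr
      have e7 : τ₁.arr 7 = τ.arr 7 := hf₁.arr 7 rfl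
      refine Wp.store ?_ le_rfl ?_
      · simp only [eval_var, e11]; omega
      · intro v hv
        simp only [setReg_arr, setArr_arr, eval_var, e11, h12, e7, true_and]
        split_ifs with hvj
        · exact (congrArg Fin.val (rank_injective hvj)).symm
        · refine hi v ?_
          rcases Nat.lt_succ_iff_lt_or_eq.1 hv with h | h
          · exact h
          · exact (hvj (by rw [(Fin.ext h : v = ⟨j, hj⟩)])).elim
  · intro τ _ _ hi v
    exact hi v v.2

/-- The loop stops at the index of the first point that is at least twice the total cost; the final
increment turns this index into the number of points. -/
theorem Wp.makeGrid {N n a d x T : ℕ} {σ : State} (h0 : σ.reg 0 = n)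
    (h1 : σ.reg 1 = a) (h2 : σ.reg 2 = d) (h6 : σ.reg 6 = x)
    (hnN : 2 * n * d ≤ N) (hgN : grid a (2 * n * d) (gridSize a (2 * n * d) (2 * x) - 1) ≤ N)
    (hmN : gridSize a (2 * n * d) (2 * x) ≤ N)
    (hT : gridSize a (2 * n * d) (2 * x) * 34 + 30 ≤ T) :
    Wp N makeGrid T σ fun τ => τ.reg 4 = gridSize a (2 * n * d) (2 * x) ∧
      ∀ i < gridSize a (2 * n * d) (2 * x), τ.arr 8 i = grid a (2 * n * d) i := by
  set m := gridSize a (2 * n * d) (2 * x) with hm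
  have hm1 : 1 ≤ m := Nat.succ_pos _
  refine Wp.assign_seq (T₂ := m * 34 + 24) ?_ (by simp only [size_mul, size_var, size_two]; omega) ?_
  · simpa [h0, h2] using hnN
  refine Wp.assign_seq (T₂ := m * 34 + 22) (by simp) (by simp only [size_zero]; omega) ?_
  refine Wp.store_seq (T₂ := m * 34 + 19) (by simp) (by simp only [size_zero]; omega) ?_
  refine Wp.seq (m * 34 + 15) 4 (Wp.loop (Q := fun τ => τ.reg 4 + 1 = m ∧ ∀ i < m,
    τ.arr 8 i = grid a (2 * n * d) i) (fun j τ => τ.reg 4 = j ∧ j < m ∧ ∀ i ≤ j,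
    τ.arr 8 i = grid a (2 * n * d) i) m 27 ?_ ?_ ?_ ?_) le_rfl ?_
  · refine ⟨by simp, hm1, fun i hi => ?_⟩
    rw [Nat.le_zero.1 hi]
    simp [grid]
  · rintro j τ hf ⟨hj, hjm, hi⟩ hv
    have e1 : τ.reg 1 = a := by rw [hf.reg 1 rfl]; simpa using h1
    have e6 : τ.reg 6 = x := by rw [hf.reg 6 rfl]; simpa using h6
    have e7 : τ.reg 7 = 2 * n * d := by rw [hf.reg 7 rfl]; simp [h0, h2]
    have hlt : grid a (2 * n * d) j < 2 * x := by
      have h := hv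
      simp only [eval_less, eval_get, eval_var, eval_mul, eval_two, hj, e6, hi j le_rfl] at h
      by_contra hge
      simp [hge] at h
    have hjm' : j + 1 < m := lt_gridSize hlt
    have hval : (get 8 (var 4) + maximum 1 (get 8 (var 4) * var 1 / var 7)).eval τ =
        grid a (2 * n * d) (j + 1) := by
      simp [hj, hi j le_rfl, e1, e7, grid]
    refine ⟨hjm, Wp.store_seq (T₂ := 4) ?_ (by simp) (Wp.assign ?_ le_rfl ?_)⟩
    · rw [hval]
      exact ((grid_strictMono _ _).monotone (by omega)).trans hgN
    · simp [hj]; omega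
    · rw [hval]
      simp only [eval_add, eval_var, eval_one, setReg_reg, setReg_arr, setArr_reg, setArr_arr, hj,
        if_true, true_and]
      refine ⟨hjm', fun i hij => ?_⟩
      split_ifs with h
      · rw [h]
      · exact hi i (by omega)
  · simp only [size_less, size_get, size_var, size_mul, size_two]; omega
  · rintro j τ - hf ⟨hj, hjm, hi⟩ hv
    have e6 : τ.reg 6 = x := by rw [hf.reg 6 rfl]; simpa using h6
    have hge : 2 * x ≤ grid a (2 * n * d) j := by
      simp only [eval_less, eval_get, eval_var, eval_mul, eval_two, hj, e6, hi j le_rfl] at hv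
      by_contra hlt
      simp [not_le.1 hlt] at hv
    have : m = j + 1 := gridSize_eq hge fun i hij =>
      grid_lt (show i + 1 < gridSize a (2 * n * d) (2 * x) by omega)
    exact ⟨by rw [hj, this], fun i hi' => hi i (by omega)⟩
  · rintro τ - ⟨h4, hi⟩
    refine Wp.assign ?_ le_rfl ⟨by simp [h4], fun i hi' => by simpa using hi i hi'⟩
    simpa [h4] using hmN

theorem Wp.roundUp {N n T : ℕ} {A : Setup n} {σ : State} (hN : n ≤ N) (hmN : A.m ≤ N)
    (h0 : σ.reg 0 = n) (h4 : σ.reg 4 = A.m) (hc : ∀ v : Fin n, σ.arr 1 v = A.c v)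
    (hg : ∀ i < A.m, σ.arr 8 i = A.g i) (hT : A.m * (n * (A.m * 19 + 23) + 14) + 6 ≤ T) :
    Wp N roundUp T σ fun τ => ∀ i < A.m, ∀ v : Fin n, τ.arr 9 (i * n + v) = A.up i v := by
  refine Wp.forTo (n * (A.m * 19 + 23) + 6) (fun i τ => ∀ i' < i, ∀ v : Fin n,
    τ.arr 9 (i' * n + v) = A.up i' v) h4 hmN (by simp) ?_ ?_ rfl hT
  · intro i hi τ hr hf hinv
    have e0 : τ.reg 0 = n := (hf.reg 0 rfl).trans h0
    have e4 : τ.reg 4 = A.m := (hf.reg 4 rfl).trans h4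
    have e1 : τ.arr 1 = σ.arr 1 := hf.arr 1 rfl
    have e8 : τ.arr 8 = σ.arr 8 := hf.arr 8 rfl
    refine Wp.forTo (A.m * 19 + 15) (fun j τ => ∀ i' ≤ i, ∀ v : Fin n, (i' < i ∨ v.1 < j) →
      τ.arr 9 (i' * n + v) = A.up i' v) e0 hN ?_ ?_ ?_ rfl le_rfl
    · intro i' _ v h
      rcases h with h | h
      · simpa using hinv i' h v
      · exact absurd h (Nat.not_lt_zero _)
    · intro j hj τ₁ hr₁ hf₁ hi₁
      have f0 : τ₁.reg 0 = n := (hf₁.reg 0 rfl).trans e0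
      have f4 : τ₁.reg 4 = A.m := (hf₁.reg 4 rfl).trans e4
      have f11 : τ₁.reg 11 = i := (hf₁.reg 11 rfl).trans hr
      have f1 : τ₁.arr 1 = σ.arr 1 := (hf₁.arr 1 rfl).trans e1
      have f8 : τ₁.arr 8 = σ.arr 8 := (hf₁.arr 8 rfl).trans e8
      have hle : A.up i ⟨j, hj⟩ ≤ N := by
        refine (Finset.sum_le_sum (g := fun _ => 1) fun t _ => ?_).trans (by simpa using hmN)
        split_ifs <;> simp
      refine Wp.seq (A.m * (8 + 11) + 8) 7 (Q₁ := fun τ' => τ'.reg 13 = A.up i ⟨j, hj⟩)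
        (Wp.sumTo (fun t => if σ.arr 8 t < A.g i + A.c ⟨j, hj⟩ then 1 else 0) f4 hmN ?_ ?_ ?_ rfl
          le_rfl) le_rfl ?_
      · intro t _ v
        have := hc ⟨j, hj⟩
        simp only at this
        simp [f8, f11, f1, hr₁, hg i hi, this]
      · rw [Finset.sum_congr rfl fun t ht => by rw [hg t (Finset.mem_range.1 ht)]]
        exact hle
      · simp only [setReg_reg, Nat.reduceEqDiff, if_false, if_true]
        exact Finset.sum_congr rfl fun t ht => by rw [hg t (Finset.mem_range.1 ht)]
      · intro τ₂ hf₂ h13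
        have g0 : τ₂.reg 0 = n := (hf₂.reg 0 rfl).trans f0
        have g11 : τ₂.reg 11 = i := (hf₂.reg 11 rfl).trans f11
        have g12 : τ₂.reg 12 = j := (hf₂.reg 12 rfl).trans hr₁
        have g9 : τ₂.arr 9 = τ₁.arr 9 := hf₂.arr 9 rfl
        refine Wp.store (by simpa [h13] using hle) le_rfl ?_
        intro i' hi' v hv
        simp only [setReg_arr, setArr_arr, eval_add, eval_mul, eval_var, g0, g11, g12, g9, h13,
          true_and]
        split_ifs with h
        · obtain ⟨h1, h2⟩ := index_injective (v := ⟨j, hj⟩) h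
          rw [h1, h2]
        · refine hi₁ i' hi' v ?_
          rcases hv with hv | hv
          · exact .inl hv
          · by_contra hcon
            push Not at hcon
            have e1 : i' = i := by omega
            have e2 : (v : ℕ) = j := by omega
            exact h (by rw [e1, e2])
    · intro τ₁ _ _ h i' hi' v
      exact h i' (Nat.lt_succ_iff.1 hi') v (.inr v.2)
  · intro τ _ _ h i hi v
    exact h i hi v

end GraphSearch

namespace GraphSearch
open GraphSearch.Expr GraphSearch.Program

/-! ### The program: ancestors and nominal costs for given guesses -/

/-- Compute the keys for the guess in register `9`. -/
def makeKeys : Program :=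
  forTo 11 0 (store 10 (var 11) (get 4 (var 11) *
      (((var 9 / get 5 (var 11)) % var 0 * var 0 + var 11) * (var 0 + 1) + var 0 + 1) +
    (1 - get 4 (var 11)) * (var 0 * var 0 * (var 0 + 1) + 1 + var 11)))

/-- Fill the `n × n` table `a` with the values of `e`. -/
def fillTable (a : ℕ) (e : Expr) : Program :=
  forTo 11 0 (forTo 12 0 (store a (var 11 * var 0 + var 12) e))

/-- For all pairs of vertices, compute the largest `t` for which there is a walk through vertices
with keys at least `t` (Floyd and Warshall). -/
def closure : Program :=
  fillTable 11 ((var 11).same (var 12) * get 10 (var 11) +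
    get 0 (var 11 * var 0 + var 12) * minimum (get 10 (var 11)) (get 10 (var 12))) ;;
  forTo 13 0 (fillTable 11 (maximum (get 11 (var 11 * var 0 + var 12))
    (minimum (get 11 (var 11 * var 0 + var 13)) (get 11 (var 13 * var 0 + var 12)))))

/-- Whether the vertex in register `u` is an ancestor of the vertex in register `x`. -/
def ancExpr (u x : ℕ) : Expr := 1 - (get 11 (var u * var 0 + var x)).less (get 10 (var u))

/-- Compute the guessed loads for the guess in register `10`. -/
def makeLimits : Program :=
  forTo 11 0 (store 12 (var 11) ((var 10 / get 6 (var 11)) % var 4))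

/-- Compute the nominal costs. -/
def makeTotals : Program :=
  forTo 11 0 (sumTo 12 13 0 (get 4 (var 13) * (ancExpr 13 11 *
      (get 1 (var 13) + get 8 (get 12 (var 13))))) ;;
    store 13 (var 11) (var 12))

/-- Compute the nominal cost of the inner vertices in register `14`. -/
def sumInner : Program := sumTo 14 11 0 (get 4 (var 11) * (get 2 (var 11) * get 13 (var 11)))

open scoped Classical

variable {n : ℕ}

/-- The state holds the data of the dynamic program. -/
structure Env (A : Setup n) (σ : State) : Prop where
  card : σ.reg 0 = n
  np : σ.reg 3 = n ^ A.k
  m : σ.reg 4 = A.m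
  nm : σ.reg 5 = A.m ^ A.k
  adj : ∀ u v : Fin n, σ.arr 0 (u * n + v) = if A.G.Adj u v then 1 else 0
  c : ∀ v : Fin n, σ.arr 1 v = A.c v
  w : ∀ v : Fin n, σ.arr 2 v = A.w v
  inner : ∀ v : Fin n, σ.arr 4 v = if A.Inner v then 1 else 0
  pn : ∀ v : Fin n, A.Inner v → σ.arr 5 v = n ^ A.idx v
  pm : ∀ v : Fin n, A.Inner v → σ.arr 6 v = A.m ^ A.idx v
  ord : ∀ i < n, σ.arr 7 i = A.ord i
  g : ∀ i < A.m, σ.arr 8 i = A.g i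
  up : ∀ i < A.m, ∀ v : Fin n, σ.arr 9 (i * n + v) = A.up i v

/-- The program does not write the data of the dynamic program. -/
def Program.keepsEnv (p : Program) : Bool :=
  [0, 3, 4, 5].all (fun x => !p.writesReg x) &&
    [0, 1, 2, 4, 5, 6, 7, 8, 9].all (fun a => !p.writesArr a)

/-- Everything after the preparation only reads these data, and the Boolean `keepsEnv` certifies
this from the program text. -/
theorem Env.frame {A : Setup n} {σ τ : State} {p : Program} (h : Env A σ) (hf : Frame p σ τ)
    (hp : p.keepsEnv = true) : Env A τ := by
  simp only [keepsEnv, List.all_cons, List.all_nil, Bool.and_true, Bool.and_eq_true,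
    Bool.not_eq_true'] at hp
  obtain ⟨⟨r0, r3, r4, r5⟩, a0, a1, a2, a4, a5, a6, a7, a8, a9⟩ := hp
  constructor
  · rw [hf.reg 0 r0]; exact h.card
  · rw [hf.reg 3 r3]; exact h.np
  · rw [hf.reg 4 r4]; exact h.m
  · rw [hf.reg 5 r5]; exact h.nm
  · rw [hf.arr 0 a0]; exact h.adj
  · rw [hf.arr 1 a1]; exact h.c
  · rw [hf.arr 2 a2]; exact h.w
  · rw [hf.arr 4 a4]; exact h.inner
  · rw [hf.arr 5 a5]; exact h.pn
  · rw [hf.arr 6 a6]; exact h.pm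
  · rw [hf.arr 7 a7]; exact h.ord
  · rw [hf.arr 8 a8]; exact h.g
  · rw [hf.arr 9 a9]; exact h.up

/-- A bound for the nominal costs of the vertices. -/
def Setup.maxTotal (A : Setup n) : ℕ := ∑ v, A.c v + n * A.g (A.m - 1)

/-- A bound for the nominal costs of the decisions. -/
def Setup.maxStep (A : Setup n) : ℕ :=
  (∑ v, A.w v) * (A.maxTotal + ∑ v, A.c v + A.g (A.m - 1))

/-- The number `N` is larger than all numbers in the dynamic program. -/
structure Big (A : Setup n) (N : ℕ) : Prop where
  key : n * n * (n + 1) + 1 + n ≤ N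
  np : n ^ A.k ≤ N
  nm : A.m ^ A.k ≤ N
  m : A.m ≤ N
  total : A.maxTotal ≤ N
  value : (n + 2) * A.maxStep + 1 ≤ N

theorem Big.le {A : Setup n} {N : ℕ} (h : Big A N) : n < N := by have := h.key; omega

/-! ### Bounds for the numbers in the dynamic program -/

namespace Setup
variable {A : Setup n} {P S X r : ℕ}

theorem g_le (hA : A.Valid) {i : ℕ} (hi : i < A.m) : A.g i ≤ A.g (A.m - 1) :=
  hA.mono.monotone (by omega)

theorem total_le (hA : A.Valid) (x : Fin n) : A.total P S x ≤ A.maxTotal := by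
  have h : ∀ u, (if A.Above P u x then A.c u + A.g (A.dig A.m S u) else 0) ≤
      A.c u + A.g (A.m - 1) := fun u => by
    have := g_le hA (A.dig_lt hA.m_pos S u)
    split_ifs <;> omega
  exact (Finset.sum_le_sum fun u _ => h u).trans (by simp [maxTotal, Finset.sum_add_distrib])

theorem stepCost_le (hA : A.Valid) {l : Fin n} {o : Option (Fin n)} (h : A.Feas P S X l o) :
    A.stepCost P S X l o ≤ A.maxStep := by
  have hw : A.w l ≤ ∑ v, A.w v :=
    Finset.single_le_sum (f := A.w) (fun _ _ => Nat.zero_le _) (Finset.mem_univ l)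
  have hc : A.c l ≤ ∑ v, A.c v :=
    Finset.single_le_sum (f := A.c) (fun _ _ => Nat.zero_le _) (Finset.mem_univ l)
  rcases o with _ | u
  · have := total_le (P := P) (S := S) hA l
    simp only [stepCost]
    split_ifs
    · exact Nat.zero_le _
    · exact Nat.mul_le_mul hw (by omega)
  · have h1 := total_le (P := P) (S := S) hA u
    have h2 := g_le hA (h.2.2.trans_lt (A.dig_lt hA.m_pos S u))
    exact Nat.mul_le_mul hw (by omega)

/-- The decision `none` is always admissible, so bounding its cost at each position suffices. -/
theorem F_le_mul (hA : A.Valid) : A.F P S r X ≤ r * A.maxStep := by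
  induction r generalizing X with
  | zero => simp [F]
  | succ r ih =>
    have h := F_le (A := A) (P := P) (S := S) (r := r) (X := X) (o := none) trivial
    have := stepCost_le (A := A) (P := P) (S := S) (X := X) (l := A.ord (n - (r + 1)))
      (o := none) hA trivial
    have := ih (X := A.next X (A.ord (n - (r + 1))) none)
    rw [Nat.add_mul]
    omega

theorem value_le_mul (hA : A.Valid) : A.value P S ≤ (n + 1) * A.maxStep := by
  have h1 : (∑ v, if A.Inner v then A.w v * A.total P S v else 0) ≤ A.maxStep := by
    rw [maxStep, Finset.sum_mul]
    refine Finset.sum_le_sum fun v _ => ?_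
    have := total_le (P := P) (S := S) hA v
    split_ifs
    · exact Nat.mul_le_mul_left _ (by omega)
    · exact Nat.zero_le _
  have := F_le_mul (P := P) (S := S) (X := 0) (r := n) hA
  rw [value, Nat.add_mul]
  omega

end Setup

/-- The case distinction is a multiplication by the mark of inner vertices. The entry of array `5`
is unspecified for leaves, but there it is multiplied by `0`. -/
theorem Wp.makeKeys {N P T : ℕ} {A : Setup n} {σ : State} (hE : Env A σ) (hN : Big A N)
    (h9 : σ.reg 9 = P) (hT : n * 50 + 6 ≤ T) :
    Wp N makeKeys T σ fun τ => ∀ v : Fin n, τ.arr 10 v = A.key P v := by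
  refine Wp.forTo 42 (fun j τ => ∀ v : Fin n, v.1 < j → τ.arr 10 v = A.key P v) hE.card hN.le.le
    (by simp) ?_ ?_ rfl hT
  · intro j hj τ hr hf hi
    have hE' := hE.frame hf rfl
    have e9 : τ.reg 9 = P := (hf.reg 9 rfl).trans h9
    have hv := hE'.inner ⟨j, hj⟩
    have hp := hE'.pn ⟨j, hj⟩
    simp only at hv hp
    have hval : (get 4 (var 11) *
        (((var 9 / get 5 (var 11)) % var 0 * var 0 + var 11) * (var 0 + 1) + var 0 + 1) +
        (1 - get 4 (var 11)) * (var 0 * var 0 * (var 0 + 1) + 1 + var 11)).eval τ =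
        A.key P ⟨j, hj⟩ := by
      by_cases hI : A.Inner ⟨j, hj⟩
      · rw [Setup.key_inner hI]
        simp [hr, hE'.card, hv, hI, hp hI, e9, Setup.dig]
      · rw [Setup.key_leaf hI]
        simp [hr, hE'.card, hv, hI]
    refine Wp.store ?_ (by decide) ?_
    · rw [hval]
      by_cases hI : A.Inner ⟨j, hj⟩
      · have := A.key_inner_le (P := P) hI
        have := hN.key
        omega
      · rw [Setup.key_leaf hI]
        have := hN.key
        simp only
        omega
    · rw [hval]
      intro v hv
      simp only [setReg_arr, setArr_arr, eval_var, hr, true_and]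
      split_ifs with hvj
      · rw [(Fin.ext hvj : v = ⟨j, hj⟩)]
      · exact hi v (by omega)
  · intro τ _ _ hi v
    exact hi v v.2

/-- Fill an `n × n` table. -/
theorem Wp.fillTable {N T a : ℕ} {e : Expr} {σ : State} (hN : n ≤ N) (h0 : σ.reg 0 = n)
    (f : Fin n → Fin n → ℕ)
    (hf : ∀ x y : Fin n, ∀ τ : State, τ.reg 11 = (x : ℕ) → τ.reg 12 = (y : ℕ) →
      Frame (fillTable a e) σ τ →
      (∀ x' y' : Fin n, τ.arr a (x' * n + y') = if x' < x ∨ x' = x ∧ y' < y then f x' y' else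
        σ.arr a (x' * n + y')) → e.eval τ = f x y ∧ f x y ≤ N)
    (hT : n * (n * (e.size + 14) + 14) + 6 ≤ T) :
    Wp N (fillTable a e) T σ fun τ => ∀ x y : Fin n, τ.arr a (x * n + y) = f x y := by
  refine Wp.forTo (n * (e.size + 14) + 6) (fun j τ => ∀ x y : Fin n, τ.arr a (x * n + y) =
    if x.1 < j then f x y else σ.arr a (x * n + y)) h0 hN (by simp) ?_ ?_ rfl hT
  · intro j hj τ hr hfr hi
    have e0 : τ.reg 0 = n := (hfr.reg 0 rfl).trans h0
    refine Wp.forTo (e.size + 6) (fun l τ => ∀ x y : Fin n, τ.arr a (x * n + y) =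
      if x.1 < j ∨ x.1 = j ∧ y.1 < l then f x y else σ.arr a (x * n + y)) e0 hN ?_ ?_ ?_ rfl le_rfl
    · intro x y
      simpa using hi x y
    · intro l hl τ₁ hr₁ hfr₁ hi₁
      have f0 : τ₁.reg 0 = n := (hfr₁.reg 0 rfl).trans e0
      have f11 : τ₁.reg 11 = j := (hfr₁.reg 11 rfl).trans hr
      have hfr' : Frame (GraphSearch.fillTable a e) σ τ₁ := by
        refine ⟨fun x hx => ?_, fun b hb => ?_⟩
        · rw [hfr₁.reg x, hfr.reg x hx]
          simp only [GraphSearch.fillTable, GraphSearch.forTo, writesReg, Bool.or_eq_false_iff] at hx ⊢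
          tauto
        · rw [hfr₁.arr b, hfr.arr b hb]
          simp only [GraphSearch.fillTable, GraphSearch.forTo, writesArr, Bool.or_eq_false_iff] at hb ⊢
          tauto
      obtain ⟨h1, h2⟩ := hf ⟨j, hj⟩ ⟨l, hl⟩ τ₁ f11 hr₁ hfr' fun x y => by
        rw [hi₁ x y]
        simp [Fin.lt_def, Fin.ext_iff]
      refine Wp.store (h1 ▸ h2) (by simp; omega) ?_
      intro x y
      simp only [setReg_arr, setArr_arr, eval_add, eval_mul, eval_var, f0, f11, hr₁, h1, true_and]
      split_ifs with c1 c2 c2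
      · obtain ⟨h3, h4⟩ := index_injective (v := ⟨l, hl⟩) c1
        rw [(Fin.ext h3 : x = ⟨j, hj⟩), h4]
      · obtain ⟨h3, h4⟩ := index_injective (v := ⟨l, hl⟩) c1
        rw [h4] at c2
        simp only at c2
        omega
      · rw [hi₁ x y, if_pos]
        rcases c2 with c2 | ⟨c2, c3⟩
        · exact .inl c2
        · refine .inr ⟨c2, ?_⟩
          rcases Nat.lt_succ_iff_lt_or_eq.1 c3 with h | h
          · exact h
          · exact (c1 (by rw [c2, h])).elim
      · rw [hi₁ x y, if_neg]
        omega
    · intro τ₁ _ _ hi₁ x y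
      rw [setReg_arr, hi₁ x y]
      have : (x.1 < j ∨ x.1 = j ∧ y.1 < n) ↔ x.1 < j + 1 := by have := y.2; omega
      simp only [this]
  · intro τ _ _ hi x y
    rw [hi x y, if_pos x.2]

/-- The state of the closure after the intermediate vertices below `z`. -/
structure ClosureInv (G : SimpleGraph (Fin n)) (κ : Fin n → ℕ) (z : ℕ) (B : Fin n → Fin n → ℕ) :
    Prop where
  sound : ∀ x y t, 1 ≤ t → t ≤ B x y → Conn G (fun v => t ≤ κ v) x y
  diag : ∀ x, κ x ≤ B x x
  edge : ∀ x y, G.Adj x y → min (κ x) (κ y) ≤ B x y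
  closed : ∀ i : Fin n, i.1 < z → ∀ x y, min (B x i) (B i y) ≤ B x y

theorem ClosureInv.le {G : SimpleGraph (Fin n)} {κ : Fin n → ℕ} {z : ℕ} {B : Fin n → Fin n → ℕ}
    (h : ClosureInv G κ z B) (x y : Fin n) : B x y ≤ κ x := by
  rcases Nat.eq_zero_or_pos (B x y) with h0 | h0
  · rw [h0]; exact Nat.zero_le _
  · exact (h.sound x y _ h0 le_rfl).1

/-- This is the Floyd–Warshall step for `max` and `min` in place of sum and product: a walk through
`z` is as good as the worse of its two halves. -/
theorem ClosureInv.step {G : SimpleGraph (Fin n)} {κ : Fin n → ℕ} {B : Fin n → Fin n → ℕ}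
    {z : Fin n} (h : ClosureInv G κ z B) :
    ClosureInv G κ (z + 1) fun x y => max (B x y) (min (B x z) (B z y)) where
  sound x y t ht hle := by
    rcases le_max_iff.1 hle with hle | hle
    · exact h.sound x y t ht hle
    · exact (h.sound x z t ht (hle.trans (min_le_left _ _))).trans
        (h.sound z y t ht (hle.trans (min_le_right _ _)))
  diag x := (h.diag x).trans (le_max_left _ _)
  edge x y hxy := (h.edge x y hxy).trans (le_max_left _ _)
  closed i hi x y := by
    rcases Nat.lt_succ_iff_lt_or_eq.1 hi with hi | hi
    · have h1 := h.closed i hi x y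
      have h2 := h.closed i hi x z
      have h3 := h.closed i hi z y
      omega
    · obtain rfl := Fin.ext hi
      omega

/-- Once all vertices are allowed as intermediate ones, the table can be followed edge by edge along
a walk. Keys are positive because the entry `0` stands for the absence of a walk. -/
theorem ClosureInv.iff {G : SimpleGraph (Fin n)} {κ : Fin n → ℕ} {B : Fin n → Fin n → ℕ}
    (h : ClosureInv G κ n B) {x y : Fin n} (hy : 1 ≤ κ y) : κ y ≤ B y x ↔ Anc G κ y x := by
  refine ⟨fun hle => (h.sound y x _ hy hle).symm, fun hc => ?_⟩
  obtain ⟨-, hc'⟩ := Conn.symm hc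
  clear hc
  induction hc' with
  | refl => exact h.diag y
  | @tail a b _ hab ih =>
    have h1 := h.edge a b hab.1
    have h2 := h.closed a a.2 y b
    have h3 : κ y ≤ κ a := hab.2.1
    have h4 : κ y ≤ κ b := hab.2.2
    omega

theorem Wp.closure {N T : ℕ} {A : Setup n} {κ : Fin n → ℕ} {σ : State} (hE : Env A σ)
    (hN : Big A N) (hκ : ∀ v, 1 ≤ κ v ∧ κ v ≤ N) (h10 : ∀ v : Fin n, σ.arr 10 v = κ v)
    (hT : n * (n * (n * 48 + 14) + 14) + 6 + (n * (n * 36 + 14) + 6) ≤ T) :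
    Wp N closure T σ fun τ =>
      ∀ u x : Fin n, κ u ≤ τ.arr 11 (u * n + x) ↔ Anc A.G κ u x := by
  refine Wp.seq (n * (n * 36 + 14) + 6) (n * (n * (n * 48 + 14) + 14) + 6)
    (Q₁ := fun τ => ∀ x y : Fin n, τ.arr 11 (x * n + y) =
      (if x = y then κ x else 0) + if A.G.Adj x y then min (κ x) (κ y) else 0)
    (Wp.fillTable hN.le.le hE.card _ ?_ le_rfl) (by omega) ?_
  · intro x y τ hx hy hf _
    have e0 : τ.arr 0 = σ.arr 0 := hf.arr 0 rfl
    have e10 : τ.arr 10 = σ.arr 10 := hf.arr 10 rfl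
    have er : τ.reg 0 = n := (hf.reg 0 rfl).trans hE.card
    refine ⟨?_, ?_⟩
    · simp only [eval_add, eval_mul, eval_same, eval_var, eval_get, eval_minimum, hx, hy, e0, e10,
        er, hE.adj x y, h10, Fin.ext_iff]
      split_ifs <;> simp
    · have := (hκ x).2
      by_cases hxy : x = y
      · subst hxy; simpa using this
      · rw [if_neg hxy, zero_add]
        split_ifs <;> omega
  · intro τ hf h11
    have hE₁ := hE.frame hf rfl
    refine Wp.forTo (n * (n * 48 + 14) + 6)
      (fun z τ => ClosureInv A.G κ z fun x y => τ.arr 11 (x * n + y)) hE₁.card hN.le.le ?_ ?_ ?_ rfl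
      le_rfl
    · constructor
      · intro x y t ht hle
        rw [setReg_arr, h11] at hle
        by_cases hxy : x = y
        · subst hxy
          simp only [if_true, SimpleGraph.irrefl, if_false, add_zero] at hle
          exact Conn.refl hle
        · rw [if_neg hxy, zero_add] at hle
          by_cases ha : A.G.Adj x y
          · rw [if_pos ha] at hle
            exact Conn.head (hle.trans (min_le_left _ _)) ha
              (Conn.refl (hle.trans (min_le_right _ _)))
          · rw [if_neg ha] at hle
            omega
      · intro x
        simp [h11]
      · intro x y hxy
        simp [h11, hxy]
      · intro i hi
        exact absurd hi (Nat.not_lt_zero _)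
    · intro z hz τ₁ hr hf₁ hi
      have e0 : τ₁.reg 0 = n := (hf₁.reg 0 rfl).trans hE₁.card
      refine Wp.mono (Wp.fillTable hN.le.le e0 (fun x y => max (τ₁.arr 11 (x * n + y))
        (min (τ₁.arr 11 (x * n + z)) (τ₁.arr 11 (z * n + y)))) ?_ le_rfl) le_rfl ?_
      · intro x y τ₂ hx hy hf₂ h₂
        have f0 : τ₂.reg 0 = n := (hf₂.reg 0 rfl).trans e0
        have f13 : τ₂.reg 13 = z := (hf₂.reg 13 rfl).trans hr
        have c1 := h₂ x y
        rw [if_neg (by omega)] at c1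
        -- The table is overwritten while it is read. This is safe because row and column `z` do not
        -- change in round `z`: the minimum with a second factor never exceeds the old entry.
        have c2 : τ₂.arr 11 (x * n + z) = τ₁.arr 11 (x * n + z) := by
          rw [h₂ x ⟨z, hz⟩]
          split_ifs
          · simp only
            omega
          · rfl
        have c3 : τ₂.arr 11 (z * n + y) = τ₁.arr 11 (z * n + y) := by
          have := h₂ ⟨z, hz⟩ y
          simp only at this
          rw [this]
          split_ifs
          · omega
          · rfl
        refine ⟨?_, ?_⟩
        · simp only [eval_maximum, eval_minimum, eval_get, eval_add, eval_mul, eval_var, hx, hy, f0,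
            f13, c1, c2, c3]
        · have h1 := hi.le x y
          have h2 := hi.le x ⟨z, hz⟩
          have h3 := (hκ x).2
          simp only at h1 h2
          omega
      · intro τ₂ _ h₂
        have := hi.step (z := ⟨z, hz⟩)
        simpa only [setReg_arr, h₂] using this
    · intro τ₁ _ _ hi u x
      exact hi.iff (hκ u).1

theorem Wp.makeLimits {N S T : ℕ} {A : Setup n} {σ : State} (hE : Env A σ) (hN : Big A N)
    (hA : A.Valid) (h10 : σ.reg 10 = S) (hT : n * 16 + 6 ≤ T) :
    Wp N makeLimits T σ fun τ => ∀ v : Fin n, A.Inner v → τ.arr 12 v = A.dig A.m S v := by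
  refine Wp.forTo 8 (fun j τ => ∀ v : Fin n, v.1 < j → A.Inner v → τ.arr 12 v = A.dig A.m S v)
    hE.card hN.le.le (by simp) ?_ ?_ rfl hT
  · intro j hj τ hr hf hi
    have hE' := hE.frame hf rfl
    have e10 : τ.reg 10 = S := (hf.reg 10 rfl).trans h10
    have hp := hE'.pm ⟨j, hj⟩
    simp only at hp
    refine Wp.store ?_ (by decide) ?_
    · simp only [eval_mod, eval_var, hE'.m]
      exact (Nat.mod_lt _ hA.m_pos).le.trans hN.m
    · intro v hv hI
      simp only [setReg_arr, setArr_arr, eval_var, hr, true_and]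
      split_ifs with hvj
      · obtain rfl : v = ⟨j, hj⟩ := Fin.ext hvj
        simp [hr, hE'.m, hp hI, e10, Setup.dig]
      · exact hi v (by omega) hI
  · intro τ _ _ hi v
    exact hi v v.2

theorem Wp.makeTotals {N P S T : ℕ} {A : Setup n} {σ : State} (hE : Env A σ) (hN : Big A N)
    (hA : A.Valid) (h10 : ∀ v : Fin n, σ.arr 10 v = A.key P v)
    (h11 : ∀ u x : Fin n, A.key P u ≤ σ.arr 11 (u * n + x) ↔ Anc A.G (A.key P) u x)
    (h12 : ∀ v : Fin n, A.Inner v → σ.arr 12 v = A.dig A.m S v)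
    (hT : n * (n * 32 + 19) + 6 ≤ T) :
    Wp N makeTotals T σ fun τ => ∀ x : Fin n, τ.arr 13 x = A.total P S x := by
  refine Wp.forTo (n * 32 + 11) (fun j τ => ∀ x : Fin n, x.1 < j → τ.arr 13 x = A.total P S x)
    hE.card hN.le.le (by simp) ?_ ?_ rfl hT
  · intro j hj τ hr hf hi
    have hE' := hE.frame hf rfl
    have e10 : τ.arr 10 = σ.arr 10 := hf.arr 10 rfl
    have e11 : τ.arr 11 = σ.arr 11 := hf.arr 11 rfl
    have e12 : τ.arr 12 = σ.arr 12 := hf.arr 12 rfl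
    set f : ℕ → ℕ := fun u => if h : u < n then
      (if A.Above P ⟨u, h⟩ ⟨j, hj⟩ then A.c ⟨u, h⟩ + A.g (A.dig A.m S ⟨u, h⟩) else 0) else 0 with hf'
    have hsum : ∑ u ∈ Finset.range n, f u = A.total P S ⟨j, hj⟩ := by
      rw [Finset.sum_range, Setup.total]
      exact Finset.sum_congr rfl fun u _ => by simp [hf']
    have hle := (A.total_le (P := P) (S := S) hA ⟨j, hj⟩).trans hN.total
    refine Wp.seq (n * (21 + 11) + 8) 3 (Q₁ := fun τ' => τ'.reg 12 = A.total P S ⟨j, hj⟩)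
      (Wp.sumTo f hE'.card hN.le.le ?_ (hsum.trans_le hle) ?_ rfl le_rfl) le_rfl ?_
    · intro u hu v
      have i1 := hE'.inner ⟨u, hu⟩
      have i2 := hE'.c ⟨u, hu⟩
      have i3 := h10 ⟨u, hu⟩
      have i4 := h11 ⟨u, hu⟩ ⟨j, hj⟩
      have i5 := h12 ⟨u, hu⟩
      have i6 := hE'.g _ (A.dig_lt hA.m_pos S ⟨u, hu⟩)
      simp only at i1 i2 i3 i4 i5
      simp only [ancExpr, eval_mul, eval_get, eval_var, eval_sub, eval_one, eval_less, eval_add,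
        setReg_reg, setReg_arr, Nat.reduceEqDiff, if_true, if_false, hE'.card, i1, i2, e10, e11, e12,
        i3, hr, hf', hu, dite_true, Setup.Above, ← i4]
      by_cases hI : A.Inner ⟨u, hu⟩
      · rw [i5 hI, i6]
        by_cases hle' : A.key P ⟨u, hu⟩ ≤ σ.arr 11 (u * n + j)
        · simp [hI, hle', not_lt.2 hle']
        · simp [hI, hle', not_le.1 hle']
      · simp [hI]
    · simp [hsum]
    · intro τ₁ hf₁ hr₁
      have g11 : τ₁.reg 11 = j := (hf₁.reg 11 rfl).trans hr
      have g13 : τ₁.arr 13 = τ.arr 13 := hf₁.arr 13 rfl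
      refine Wp.store (by simpa [hr₁] using hle) le_rfl ?_
      intro v hv
      simp only [setReg_arr, setArr_arr, eval_var, g11, g13, hr₁, true_and]
      split_ifs with hvj
      · rw [(Fin.ext hvj : v = ⟨j, hj⟩)]
      · exact hi v (by omega)
  · intro τ _ _ hi v
    exact hi v v.2

theorem Wp.sumInner {N P S T : ℕ} {A : Setup n} {σ : State} (hE : Env A σ) (hN : Big A N)
    (hA : A.Valid) (h13 : ∀ x : Fin n, σ.arr 13 x = A.total P S x) (hT : n * 19 + 8 ≤ T) :
    Wp N sumInner T σ fun τ =>
      τ.reg 14 = ∑ v, if A.Inner v then A.w v * A.total P S v else 0 := by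
  have hsum : ∑ v ∈ Finset.range n, σ.arr 4 v * (σ.arr 2 v * σ.arr 13 v) =
      ∑ v, if A.Inner v then A.w v * A.total P S v else 0 := by
    rw [Finset.sum_range]
    refine Finset.sum_congr rfl fun v _ => ?_
    rw [hE.inner, hE.w, h13]
    split_ifs <;> simp
  refine Wp.sumTo (fun v => σ.arr 4 v * (σ.arr 2 v * σ.arr 13 v)) hE.card hN.le.le ?_ ?_ ?_ rfl hT
  · intro j _ v
    simp
  · rw [hsum]
    have h1 := A.value_le_mul (P := P) (S := S) hA
    have h2 := hN.value
    have h3 : (n + 1) * A.maxStep ≤ (n + 2) * A.maxStep := Nat.mul_le_mul_right _ (by omega)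
    rw [Setup.value] at h1
    omega
  · simp [hsum]

end GraphSearch

namespace GraphSearch
open GraphSearch.Expr GraphSearch.Program

/-! ### The program: the dynamic program -/

/-- Try the decision to query the leaf in register `17` immediately before the vertex in register
`12`; registers `18` and `19` hold the value of the best decision and the decision. -/
def tryInner : Program :=
  ite (get 4 (var 12) * ancExpr 12 17)
    (assign 20 ((var 11 / get 6 (var 12)) % var 4) ;;
      assign 21 (get 9 (var 20 * var 0 + var 17)) ;;
      ite ((get 12 (var 12)).less (var 21)) skip
        (assign 22 (get 14 ((var 16 + 1) * var 5 +
              (var 11 + (var 21 - var 20) * get 6 (var 12))) +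
            get 2 (var 17) * (get 13 (var 12) - (get 1 (var 12) + get 8 (get 12 (var 12))) +
              get 8 (var 21))) ;;
          ite ((var 22).less (var 18)) (assign 18 (var 22) ;; assign 19 (var 12)) skip))
    skip

/-- Compute the cell of the dynamic program for the position in register `16` and the loads in
register `11`. -/
def fillCell : Program :=
  assign 18 (get 14 ((var 16 + 1) * var 5 + var 11) +
    (1 - get 4 (var 17)) * (get 2 (var 17) * (get 13 (var 17) + get 1 (var 17)))) ;;
  assign 19 (var 0) ;;
  ite (get 4 (var 17)) skip (forTo 12 0 tryInner) ;;
  store 14 (var 16 * var 5 + var 11) (var 18) ;;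
  store 15 (var 16 * var 5 + var 11) (var 19)

/-- The dynamic program. -/
def dynamicProgram : Program :=
  forTo 11 5 (store 14 (var 0 * var 5 + var 11) 0) ;;
  forTo 15 0 (assign 16 (var 0 - 1 - var 15) ;; assign 17 (get 7 (var 16)) ;; forTo 11 5 fillCell)

open scoped Classical

variable {n : ℕ}

/-- The state holds the tables for the guesses `P` and `S`. -/
structure Tables (A : Setup n) (P S : ℕ) (σ : State) : Prop where
  env : Env A σ
  key : ∀ v : Fin n, σ.arr 10 v = A.key P v
  anc : ∀ u x : Fin n, A.key P u ≤ σ.arr 11 (u * n + x) ↔ Anc A.G (A.key P) u x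
  limit : ∀ v : Fin n, A.Inner v → σ.arr 12 v = A.dig A.m S v
  total : ∀ x : Fin n, σ.arr 13 x = A.total P S x

/-- The program does not write the tables for the guesses. -/
def Program.keepsTables (p : Program) : Bool :=
  p.keepsEnv && [10, 11, 12, 13].all (fun a => !p.writesArr a)

theorem Tables.frame {A : Setup n} {P S : ℕ} {σ τ : State} {p : Program} (h : Tables A P S σ)
    (hf : Frame p σ τ) (hp : p.keepsTables = true) : Tables A P S τ := by
  simp only [keepsTables, List.all_cons, List.all_nil, Bool.and_true, Bool.and_eq_true,
    Bool.not_eq_true'] at hp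
  obtain ⟨he, a10, a11, a12, a13⟩ := hp
  refine ⟨h.env.frame hf he, ?_, ?_, ?_, ?_⟩
  · rw [hf.arr 10 a10]; exact h.key
  · rw [hf.arr 11 a11]; exact h.anc
  · rw [hf.arr 12 a12]; exact h.limit
  · rw [hf.arr 13 a13]; exact h.total

theorem Setup.up_le (A : Setup n) (i : ℕ) (v : Fin n) : A.up i v ≤ A.m := by
  rw [Setup.up]
  exact (Finset.sum_le_sum fun t _ => (by split_ifs <;> omega :
    (if A.g t < A.g i + A.c v then 1 else 0) ≤ 1)).trans_eq (by simp)

/-- The nominal cost of the vertices from `l` on, if `l` is the `r`-th vertex from the end and `o` is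
the decision about `l`. -/
noncomputable def Setup.choiceCost (A : Setup n) (P S r X : ℕ) (l : Fin n) (o : Option (Fin n)) :
    ℕ :=
  A.stepCost P S X l o + A.F P S r (A.next X l o)

theorem choiceCost_le {A : Setup n} {N P S r X : ℕ} {l : Fin n} {o : Option (Fin n)} (hA : A.Valid)
    (hN : Big A N) (hr : r ≤ n) (ho : A.Feas P S X l o) : A.choiceCost P S r X l o ≤ N := by
  have h1 := A.stepCost_le hA ho
  have h2 := A.F_le_mul (P := P) (S := S) (r := r) (X := A.next X l o) hA
  have h3 : r * A.maxStep ≤ n * A.maxStep := Nat.mul_le_mul_right _ hr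
  have h4 := hN.value
  rw [Nat.add_mul] at h4
  rw [Setup.choiceCost]
  omega

theorem Wp.tryInner {N P S X i : ℕ} {A : Setup n} {l u : Fin n} {σ : State}
    (hσ : Tables A P S σ) (hA : A.Valid) (hN : Big A N) (hi : i < n) (hX : X < A.m ^ A.k)
    (h11 : σ.reg 11 = X) (h12 : σ.reg 12 = (u : ℕ)) (h16 : σ.reg 16 = i) (h17 : σ.reg 17 = (l : ℕ))
    (h14 : ∀ X < A.m ^ A.k, σ.arr 14 ((i + 1) * A.m ^ A.k + X) = A.F P S (n - (i + 1)) X)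
    (hl : ¬ A.Inner l) :
    Wp N tryInner 80 σ fun τ =>
      if A.Feas P S X l (some u) ∧ A.choiceCost P S (n - (i + 1)) X l (some u) < σ.reg 18 then
        τ.reg 18 = A.choiceCost P S (n - (i + 1)) X l (some u) ∧ τ.reg 19 = (u : ℕ)
      else τ.reg 18 = σ.reg 18 ∧ τ.reg 19 = σ.reg 19 := by
  have hE := hσ.env
  have hcond : (get 4 (var 12) * ancExpr 12 17).eval σ = if A.Above P u l then 1 else 0 := by
    simp only [ancExpr, eval_mul, eval_get, eval_var, eval_sub, eval_one, eval_less, eval_add, h12,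
      h17, hE.card, hE.inner, hσ.key, Setup.Above, ← hσ.anc]
    by_cases hI : A.Inner u
    · by_cases hle : A.key P u ≤ σ.arr 11 (u * n + l)
      · simp [hI, hle, not_lt.2 hle]
      · simp [hI, hle, not_le.1 hle]
    · simp [hI]
  have hdm := A.dig_lt hA.m_pos X u
  refine Wp.ite 64 (by decide) (fun hv => ?_) (fun hv => ?_)
  · rw [hcond] at hv
    have hab : A.Above P u l := by by_contra h; simp [h] at hv
    have e20 : ((var 11 / get 6 (var 12)) % var 4).eval σ = A.dig A.m X u := by
      simp [h11, h12, hE.m, hE.pm u hab.1, Setup.dig]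
    refine Wp.assign_seq (T₂ := 57) (e20 ▸ hdm.le.trans hN.m) (by decide) ?_
    rw [e20]
    have e21 : (get 9 (var 20 * var 0 + var 17)).eval (σ.setReg 20 (A.dig A.m X u)) =
        A.up (A.dig A.m X u) l := by
      simp [hE.card, h17, hE.up _ hdm]
    refine Wp.assign_seq (T₂ := 50) (e21 ▸ (A.up_le _ _).trans hN.m) (by decide) ?_
    rw [e21]
    have hc : ((get 12 (var 12)).less (var 21)).eval
        ((σ.setReg 20 (A.dig A.m X u)).setReg 21 (A.up (A.dig A.m X u) l)) =
        if A.dig A.m S u < A.up (A.dig A.m X u) l then 1 else 0 := by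
      simp [h12, hσ.limit u hab.1]
    refine Wp.ite 44 (by decide) (fun hv => ?_) (fun hv => ?_)
    · rw [hc] at hv
      have hnf : ¬ A.Feas P S X l (some u) := fun h => by
        rw [if_neg (not_lt.2 h.2.2)] at hv
        exact hv rfl
      refine Wp.skip (by omega) ?_
      simp [hnf]
    · rw [hc] at hv
      have hf : A.Feas P S X l (some u) := ⟨hl, hab, by by_contra h; simp [not_le.1 h] at hv⟩
      -- Admissibility keeps the new load inside the grid, so the grid entry and the cell of the
      -- next state that are read are meaningful.
      have hupm := hf.2.2.trans_lt (A.dig_lt hA.m_pos S u)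
      have hnext := (Setup.next_spec hA hf).1 hX
      have e22 : (get 14 ((var 16 + 1) * var 5 +
              (var 11 + (var 21 - var 20) * get 6 (var 12))) +
            get 2 (var 17) * (get 13 (var 12) - (get 1 (var 12) + get 8 (get 12 (var 12))) +
              get 8 (var 21))).eval
          ((σ.setReg 20 (A.dig A.m X u)).setReg 21 (A.up (A.dig A.m X u) l)) =
          A.choiceCost P S (n - (i + 1)) X l (some u) := by
        rw [Setup.next] at hnext
        simp [h11, h12, h16, h17, hE.nm, hE.pm u hab.1, h14 _ hnext, hE.w, hσ.total, hE.c,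
          hσ.limit u hab.1, hE.g _ (A.dig_lt hA.m_pos S u), hE.g _ hupm, Setup.choiceCost,
          Setup.stepCost, Setup.next, add_comm]
      refine Wp.assign_seq (T₂ := 10) (e22 ▸ choiceCost_le hA hN (by omega) hf) (by decide) ?_
      rw [e22]
      refine Wp.ite 4 (by decide) (fun hv => ?_) (fun hv => ?_)
      · have hlt : A.choiceCost P S (n - (i + 1)) X l (some u) < σ.reg 18 := by
          simpa using hv
        refine Wp.assign_seq (T₂ := 2) ?_ (by decide) (Wp.assign ?_ (by decide) ?_)
        · simpa using choiceCost_le hA hN (by omega) hf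
        · simpa [h12] using u.2.le.trans hN.le.le
        · simp [hf, hlt, h12]
      · have hlt : ¬ A.choiceCost P S (n - (i + 1)) X l (some u) < σ.reg 18 := by
          simpa using hv
        refine Wp.skip (by omega) ?_
        rw [if_neg fun h => hlt h.2]
        simp
  · rw [hcond] at hv
    have hnf : ¬ A.Feas P S X l (some u) := fun h => by simp [h.2.1] at hv
    refine Wp.skip (by omega) ?_
    simp [hnf]

theorem Wp.fillCell {N P S X i T : ℕ} {A : Setup n} {σ : State}
    (hσ : Tables A P S σ) (hA : A.Valid) (hN : Big A N) (hi : i < n) (hX : X < A.m ^ A.k)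
    (h11 : σ.reg 11 = X) (h16 : σ.reg 16 = i) (h17 : σ.reg 17 = (A.ord i : ℕ))
    (h14 : ∀ X < A.m ^ A.k, σ.arr 14 ((i + 1) * A.m ^ A.k + X) = A.F P S (n - (i + 1)) X)
    (hT : n * 88 + 50 ≤ T) :
    Wp N fillCell T σ fun τ => ∃ o, A.Feas P S X (A.ord i) o ∧
      A.F P S (n - i) X = A.stepCost P S X (A.ord i) o +
        A.F P S (n - (i + 1)) (A.next X (A.ord i) o) ∧
      τ.arr 14 = Function.update (σ.arr 14) (i * A.m ^ A.k + X) (A.F P S (n - i) X) ∧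
      τ.arr 15 = Function.update (σ.arr 15) (i * A.m ^ A.k + X) (o.elim n fun u => (u : ℕ)) := by
  have hE := hσ.env
  set l := A.ord i with hl
  have hnone : A.Feas P S X l none := trivial
  have e18 : (get 14 ((var 16 + 1) * var 5 + var 11) +
      (1 - get 4 (var 17)) * (get 2 (var 17) * (get 13 (var 17) + get 1 (var 17)))).eval σ =
      A.choiceCost P S (n - (i + 1)) X l none := by
    rw [Setup.choiceCost, add_comm]
    by_cases hI : A.Inner l <;>
    simp [h11, h16, h17, hE.nm, hE.inner, hE.w, hE.c, hσ.total, hI, h14 X hX, Setup.stepCost,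
      Setup.next]
  refine Wp.assign_seq (T₂ := n * 88 + 27) (e18 ▸ choiceCost_le hA hN (by omega) hnone)
    (by simp; omega) ?_
  rw [e18]
  refine Wp.assign_seq (T₂ := n * 88 + 24) (by simpa [hE.card] using hN.le.le) (by simp; omega) ?_
  simp only [eval_var, setReg_reg, Nat.reduceEqDiff, if_false, hE.card]
  refine Wp.seq (n * 88 + 9) 14 (Q₁ := fun τ => ∃ o, A.Feas P S X l o ∧
    τ.reg 18 = A.choiceCost P S (n - (i + 1)) X l o ∧ τ.reg 19 = (o.elim n fun u => (u : ℕ)) ∧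
    ∀ o', A.Feas P S X l o' → τ.reg 18 ≤ A.choiceCost P S (n - (i + 1)) X l o')
    (Wp.ite (n * 88 + 6) (by simp; omega) (fun hv => ?_) (fun hv => ?_)) (by omega) ?_
  · have hI : A.Inner l := by
      by_contra h
      simp [h17, hE.inner, h] at hv
    refine Wp.skip (by omega) ⟨none, hnone, by simp, by simp, fun o' ho' => ?_⟩
    rcases o' with _ | u
    · simp
    · exact absurd hI ho'.1
  · have hI : ¬ A.Inner l := by
      intro h
      simp [h17, hE.inner, h] at hv
    -- The invariant is optimality among `none` and the vertices tried so far; `none` is the initial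
    -- choice and is encoded by the number `n`.
    refine Wp.forTo 80 (fun j τ => ∃ o, A.Feas P S X l o ∧
      τ.reg 18 = A.choiceCost P S (n - (i + 1)) X l o ∧ τ.reg 19 = (o.elim n fun u => (u : ℕ)) ∧
      ∀ o', A.Feas P S X l o' → (∀ u, o' = some u → u.1 < j) →
        τ.reg 18 ≤ A.choiceCost P S (n - (i + 1)) X l o') (by simpa using hE.card) hN.le.le ?_ ?_
      ?_ rfl le_rfl
    · refine ⟨none, hnone, by simp, by simp, fun o' ho' h => ?_⟩
      rcases o' with _ | u
      · simp
      · exact absurd (h u rfl) (Nat.not_lt_zero _)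
    · rintro j hj τ hr hf ⟨o, ho, r18, r19, hmin⟩
      have hτ : Tables A P S τ := by
        -- The program named here is only a witness for the set of written registers and arrays; its
        -- expressions are irrelevant.
        refine Tables.frame (p := Program.assign 18 0 ;; Program.assign 19 0 ;; GraphSearch.forTo 12 0
          GraphSearch.tryInner) hσ ⟨fun x hx => ?_, fun a ha => ?_⟩ rfl
        · simp only [writesReg, Bool.or_eq_false_iff, beq_eq_false_iff_ne, ne_eq] at hx
          rw [hf.reg x hx.2.2]
          simp [Ne.symm hx.1, Ne.symm hx.2.1]
        · exact hf.arr a ha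
      refine Wp.mono (Wp.tryInner (u := ⟨j, hj⟩) hτ hA hN hi hX ((hf.reg 11 rfl).trans h11) hr
        ((hf.reg 16 rfl).trans h16) ((hf.reg 17 rfl).trans h17) ?_ hI) le_rfl ?_
      · rw [hf.arr 14 rfl]
        exact h14
      · intro τ' _ hq
        simp only [setReg_reg, Nat.reduceEqDiff, if_false]
        have hcase : ∀ o' : Option (Fin n), (∀ u, o' = some u → u.1 < j + 1) →
            (∀ u, o' = some u → u.1 < j) ∨ o' = some ⟨j, hj⟩ := by
          intro o' h
          rcases o' with _ | u
          · exact .inl (by simp)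
          · have := h u rfl
            by_cases huj : u.1 = j
            · exact .inr (congrArg some (Fin.ext huj))
            · refine .inl fun v hv => ?_
              obtain rfl := Option.some.inj hv
              omega
        split_ifs at hq with hc
        · refine ⟨some ⟨j, hj⟩, hc.1, hq.1, hq.2, fun o' ho' h => ?_⟩
          rw [hq.1]
          rcases hcase o' h with h | rfl
          · exact hc.2.le.trans (hmin o' ho' h)
          · exact le_rfl
        · refine ⟨o, ho, hq.1.trans r18, hq.2.trans r19, fun o' ho' h => ?_⟩
          rw [hq.1]
          rcases hcase o' h with h | rfl
          · exact hmin o' ho' h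
          · exact not_lt.1 fun h' => hc ⟨ho', h'⟩
    · rintro τ - - ⟨o, ho, r18, r19, hmin⟩
      exact ⟨o, ho, r18, r19, fun o' ho' => hmin o' ho' fun u _ => u.2⟩
  · rintro τ hf ⟨o, ho, r18, r19, hmin⟩
    have f11 : τ.reg 11 = X := (hf.reg 11 rfl).trans (by simpa using h11)
    have f16 : τ.reg 16 = i := (hf.reg 16 rfl).trans (by simpa using h16)
    have f5 : τ.reg 5 = A.m ^ A.k := (hf.reg 5 rfl).trans (by simpa using hE.nm)
    have hn : n - i = (n - (i + 1)) + 1 := by omega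
    have hord : A.ord (n - (n - (i + 1) + 1)) = l := by
      rw [hl]
      congr 1
      omega
    have hF : A.F P S (n - i) X = A.choiceCost P S (n - (i + 1)) X l o := by
      rw [hn]
      refine Setup.F_eq (o := o) (by rwa [hord]) (by rw [hord]; rfl) fun o' ho' => ?_
      rw [hord] at ho' ⊢
      rw [← r18]
      exact hmin o' ho'
    have hle := choiceCost_le (r := n - (i + 1)) hA hN (by omega) ho
    refine Wp.store_seq (T₂ := 7) (by simpa [r18] using hle) (by decide)
      (Wp.store ?_ (by decide) ⟨o, ho, hF, ?_, ?_⟩)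
    · simp only [eval_var, setArr_reg, r19]
      rcases o with _ | u
      · exact hN.le.le
      · exact u.2.le.trans hN.le.le
    · funext j
      have a14 : τ.arr 14 = σ.arr 14 := hf.arr 14 rfl
      simp [f11, f16, f5, r18, hF, a14, Function.update_apply]
    · funext j
      have a15 : τ.arr 15 = σ.arr 15 := hf.arr 15 rfl
      simp [f11, f16, f5, r19, a15, Function.update_apply]

/-- The state holds the table of the dynamic program. -/
structure Solved (A : Setup n) (P S : ℕ) (σ : State) : Prop where
  value : ∀ i ≤ n, ∀ X < A.m ^ A.k, σ.arr 14 (i * A.m ^ A.k + X) = A.F P S (n - i) X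
  choice : ∀ i < n, ∀ X < A.m ^ A.k, ∃ o, A.Feas P S X (A.ord i) o ∧
    A.F P S (n - i) X = A.stepCost P S X (A.ord i) o +
      A.F P S (n - (i + 1)) (A.next X (A.ord i) o) ∧
    σ.arr 15 (i * A.m ^ A.k + X) = o.elim n fun u => (u : ℕ)

theorem cell_injective {M i j X Y : ℕ} (hX : X < M) (hY : Y < M) (h : i * M + X = j * M + Y) :
    i = j ∧ X = Y := by
  obtain ⟨h1, h2⟩ := index_injective (n := M) (u := ⟨X, hX⟩) (v := ⟨Y, hY⟩) h
  exact ⟨h1, congrArg Fin.val h2⟩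

theorem Wp.dynamicProgram {N P S T : ℕ} {A : Setup n} {σ : State} (hσ : Tables A P S σ)
    (hA : A.Valid) (hN : Big A N)
    (hT : A.m ^ A.k * 15 + n * (A.m ^ A.k * (n * 88 + 58) + 28) + 12 ≤ T) :
    Wp N dynamicProgram T σ (Solved A P S) := by
  refine Wp.seq (A.m ^ A.k * 15 + 6) (n * (A.m ^ A.k * (n * 88 + 58) + 28) + 6)
    (Q₁ := fun τ => ∀ X < A.m ^ A.k, τ.arr 14 (n * A.m ^ A.k + X) = 0)
    (Wp.forTo 7 (fun j τ => ∀ X < j, τ.arr 14 (n * A.m ^ A.k + X) = 0) hσ.env.nm hN.nm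
      (by simp) ?_ (fun τ _ _ h => h) rfl le_rfl) (by omega) ?_
  · intro j hj τ hr hf hi
    have e0 : τ.reg 0 = n := (hf.reg 0 rfl).trans hσ.env.card
    have e5 : τ.reg 5 = A.m ^ A.k := (hf.reg 5 rfl).trans hσ.env.nm
    refine Wp.store (Nat.zero_le _) (by decide) ?_
    intro X hX
    simp only [setReg_arr, setArr_arr, eval_add, eval_mul, eval_var, eval_zero, e0, e5, hr]
    split_ifs with h
    · rfl
    · refine hi X (lt_of_le_of_ne (Nat.lt_succ_iff.1 hX) ?_)
      rintro rfl
      exact h ⟨trivial, rfl⟩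
  · intro τ hf h0
    have hτ := hσ.frame hf rfl
    refine Wp.forTo (A.m ^ A.k * (n * 88 + 58) + 20) (fun j τ =>
      (∀ i ≤ n, n ≤ i + j → ∀ X < A.m ^ A.k, τ.arr 14 (i * A.m ^ A.k + X) = A.F P S (n - i) X) ∧
      (∀ i < n, n ≤ i + j → ∀ X < A.m ^ A.k, ∃ o, A.Feas P S X (A.ord i) o ∧
        A.F P S (n - i) X = A.stepCost P S X (A.ord i) o +
          A.F P S (n - (i + 1)) (A.next X (A.ord i) o) ∧
        τ.arr 15 (i * A.m ^ A.k + X) = o.elim n fun u => (u : ℕ))) hτ.env.card hN.le.le ?_ ?_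
      (fun τ _ _ h => ⟨fun i hi => h.1 i hi (by omega), fun i hi => h.2 i hi (by omega)⟩) rfl le_rfl
    · refine ⟨fun i hi hn X hX => ?_, fun i hi hn => by omega⟩
      obtain rfl : i = n := by omega
      simp [h0 X hX, Setup.F]
    · rintro j hj τ₁ hr hf₁ ⟨hi₁, hi₂⟩
      have hτ₁ := hτ.frame hf₁ rfl
      have e0 := hτ₁.env.card
      refine Wp.assign_seq (T₂ := A.m ^ A.k * (n * 88 + 58) + 9) ?_ (by simp; omega) ?_
      · have := hN.le
        simp [e0]
        omega
      have e16 : (var 0 - 1 - var 15).eval τ₁ = n - 1 - j := by simp [e0, hr]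
      rw [e16]
      -- Rows are filled from the last position backwards. From here on only these relations between
      -- the row and the counter are needed.
      have hin : n - 1 - j < n := by omega
      have hj1 : n - 1 - j + 1 = n - j := by omega
      have hex : n - 1 - (n - 1 - j) = j := by omega
      generalize n - 1 - j = i at hin hj1 hex
      have e17 : (get 7 (var 16)).eval (τ₁.setReg 16 i) = (A.ord i : ℕ) := by
        simp [hτ₁.env.ord i hin]
      refine Wp.assign_seq (T₂ := A.m ^ A.k * (n * 88 + 58) + 6)
        (e17 ▸ (A.ord i).2.le.trans hN.le.le) (by simp; omega) ?_
      rw [e17]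
      have hrow : ∀ X < A.m ^ A.k,
          τ₁.arr 14 ((i + 1) * A.m ^ A.k + X) = A.F P S (n - (i + 1)) X :=
        hi₁ (i + 1) (by omega) (by omega)
      have hτ₂ : Tables A P S ((τ₁.setReg 16 i).setReg 17 (A.ord i)) := by
        refine Tables.frame (p := Program.assign 16 0 ;; Program.assign 17 0) hτ₁
          ⟨fun x hx => ?_, fun a ha => rfl⟩ rfl
        simp only [writesReg, Bool.or_eq_false_iff, beq_eq_false_iff_ne, ne_eq] at hx
        simp [Ne.symm hx.1, Ne.symm hx.2]
      refine Wp.forTo (n * 88 + 50) (fun x τ =>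
        (∀ i' ≤ n, i < i' → ∀ X < A.m ^ A.k,
          τ.arr 14 (i' * A.m ^ A.k + X) = A.F P S (n - i') X) ∧
        (∀ i' < n, i < i' → ∀ X < A.m ^ A.k, ∃ o, A.Feas P S X (A.ord i') o ∧
          A.F P S (n - i') X = A.stepCost P S X (A.ord i') o +
            A.F P S (n - (i' + 1)) (A.next X (A.ord i') o) ∧
          τ.arr 15 (i' * A.m ^ A.k + X) = o.elim n fun u => (u : ℕ)) ∧
        ∀ X < x, τ.arr 14 (i * A.m ^ A.k + X) = A.F P S (n - i) X ∧
          ∃ o, A.Feas P S X (A.ord i) o ∧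
          A.F P S (n - i) X = A.stepCost P S X (A.ord i) o +
            A.F P S (n - (i + 1)) (A.next X (A.ord i) o) ∧
          τ.arr 15 (i * A.m ^ A.k + X) = o.elim n fun u => (u : ℕ)) hτ₂.env.nm hN.nm ?_ ?_ ?_ rfl
        le_rfl
      · exact ⟨fun i' h1 h2 => hi₁ i' h1 (by omega), fun i' h1 h2 => hi₂ i' h1 (by omega),
          fun X hX => absurd hX (Nat.not_lt_zero _)⟩
      · rintro x hx τ₃ hr₃ hf₃ ⟨k1, k2, k3⟩
        refine Wp.mono (Wp.fillCell (hτ₂.frame hf₃ rfl) hA hN hin hx hr₃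
          ((hf₃.reg 16 rfl).trans (by simp)) ((hf₃.reg 17 rfl).trans (by simp))
          (k1 (i + 1) (by omega) (by omega)) le_rfl) le_rfl ?_
        rintro τ₄ - ⟨o, ho, hF, h14, h15⟩
        have hne : ∀ i' X, i < i' → X < A.m ^ A.k → i' * A.m ^ A.k + X ≠ i * A.m ^ A.k + x :=
          fun i' X h1 h2 h => by
            have := (cell_injective h2 hx h).1
            omega
        refine ⟨fun i' h1 h2 X hX => ?_, fun i' h1 h2 X hX => ?_, fun X hX => ?_⟩
        · rw [setReg_arr, h14, Function.update_of_ne (hne i' X h2 hX)]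
          exact k1 i' h1 h2 X hX
        · rw [setReg_arr, h15, Function.update_of_ne (hne i' X h2 hX)]
          exact k2 i' h1 h2 X hX
        · rw [setReg_arr, h14, h15]
          by_cases hXx : X = x
          · subst hXx
            exact ⟨by simp, o, ho, hF, by simp⟩
          · rw [Function.update_of_ne (by omega), Function.update_of_ne (by omega)]
            exact k3 X (by omega)
      · rintro τ₃ - - ⟨k1, k2, k3⟩
        refine ⟨fun i' h1 h2 X hX => ?_, fun i' h1 h2 X hX => ?_⟩
        · rcases Nat.lt_or_ge i i' with h | h
          · exact k1 i' h1 h X hX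
          · obtain rfl : i = i' := by omega
            exact (k3 X hX).1
        · rcases Nat.lt_or_ge i i' with h | h
          · exact k2 i' h1 h X hX
          · obtain rfl : i = i' := by omega
            exact (k3 X hX).2

end GraphSearch

namespace GraphSearch
open GraphSearch.Expr GraphSearch.Program

/-! ### The program: the decision tree and the search for the guesses -/

/-- Compute the final keys for the decisions of the dynamic program. -/
def walk : Program :=
  assign 16 0 ;;
  forTo 11 0 (assign 17 (get 7 (var 11)) ;; assign 19 (get 15 (var 11 * var 5 + var 16)) ;;
    ite ((var 19).less (var 0))
      (store 10 (var 17) (get 10 (var 19) - (var 0 - var 11)) ;;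
        assign 20 ((var 16 / get 6 (var 19)) % var 4) ;;
        assign 16 (var 16 + (get 9 (var 20 * var 0 + var 17) - var 20) * get 6 (var 19)))
      skip)

/-- Write the table of the parents for the keys and the ancestor table. -/
def writeOutput : Program :=
  forTo 11 0 (assign 12 0 ;; assign 13 0 ;;
    forTo 14 0 (ite ((1 - (var 14).same (var 11)) *
        (ancExpr 14 11 * (var 13).less (get 10 (var 14))))
      (assign 13 (get 10 (var 14)) ;; assign 12 (var 14 + 1)) skip) ;;
    store 3 (var 11) (var 12))

/-- Store the tree for the guesses if it is better than the trees found before. -/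
def improve : Program :=
  assign 14 (var 14 + get 14 0) ;;
  ite ((var 8).same 0 + (var 14 + 1).less (var 8))
    (assign 8 (var 14 + 1) ;; walk ;; closure ;; writeOutput) skip

/-- Treat the guesses in the registers `9` and `10`. -/
def candidate : Program :=
  makeKeys ;; closure ;; makeLimits ;; makeTotals ;; sumInner ;; dynamicProgram ;; improve

/-- Try all guesses. -/
def search : Program := assign 8 0 ;; forTo 9 3 (forTo 10 5 candidate)

/-- Compute the data of the dynamic program. -/
def prepare : Program :=
  markInner ;; powers 0 3 5 ;; sumCosts ;; sortVertices ;; makeGrid ;; powers 4 5 6 ;; roundUp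

/-- The algorithm. -/
def algorithm : Program := prepare ;; search

open scoped Classical

variable {n : ℕ}

theorem Setup.one_le_key (A : Setup n) (P : ℕ) (v : Fin n) : 1 ≤ A.key P v := by
  by_cases hI : A.Inner v
  · rw [key_inner hI]; omega
  · rw [key_leaf hI]; omega

theorem Big.key_le {A : Setup n} {N : ℕ} (hN : Big A N) (P : ℕ) (v : Fin n) : A.key P v ≤ N := by
  have := hN.key
  by_cases hI : A.Inner v
  · have := A.key_inner_le (P := P) hI
    omega
  · rw [Setup.key_leaf hI]; omega

/-- The program follows the optimal path from the zero load vector and moves each leaf in front of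
its inner vertex as prescribed by the stored decision. -/
theorem Wp.walk {N P S T : ℕ} {A : Setup n} {H : ℕ → ℕ → Option (Fin n)} {σ : State}
    (hσ : Tables A P S σ) (hA : A.Valid) (hN : Big A N)
    (hH : ∀ i < n, ∀ X < A.m ^ A.k, A.Feas P S X (A.ord i) (H i X))
    (h15 : ∀ i < n, ∀ X < A.m ^ A.k,
      σ.arr 15 (i * A.m ^ A.k + X) = (H i X).elim n fun u => (u : ℕ))
    (hT : n * 51 + 8 ≤ T) :
    Wp N walk T σ fun τ => ∀ v : Fin n, τ.arr 10 v = A.finalKey P (A.plan H) v := by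
  have ha : ∀ x u, A.plan H x = some u → ¬ A.Inner x ∧ A.Above P u x := by
    intro x u hx
    have := hH _ (hA.rk_lt x) _ (Setup.path_spec hA hH (hA.rk_lt x).le).1
    rw [hA.ord_rk, show H (A.rk x) (A.path H (A.rk x)) = some u from hx] at this
    exact ⟨this.1, this.2.1⟩
  refine Wp.assign_seq (T₂ := n * 51 + 6) (Nat.zero_le _) (by simp; omega) ?_
  refine Wp.forTo 43 (fun i τ => τ.reg 16 = A.path H i ∧ ∀ v : Fin n,
    τ.arr 10 v = if A.rk v < i then A.finalKey P (A.plan H) v else A.key P v)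
    (by simpa using hσ.env.card) hN.le.le ?_ ?_ ?_ rfl le_rfl
  · exact ⟨by simp [Setup.path], by simpa using hσ.key⟩
  · rintro i hi τ hr hf ⟨h16, h10⟩
    have hE : Env A τ := by
      refine hσ.env.frame (p := GraphSearch.walk) ⟨fun x hx => ?_, fun a ha => ?_⟩ rfl
      · simp only [GraphSearch.walk, writesReg, Bool.or_eq_false_iff] at hx
        rw [hf.reg x hx.2]
        have := hx.1
        simp only [beq_eq_false_iff_ne, ne_eq] at this
        simp [Ne.symm this]
      · exact hf.arr a ha
    have h15' : τ.arr 15 = σ.arr 15 := hf.arr 15 rfl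
    obtain ⟨hX, -⟩ := Setup.path_spec hA hH hi.le
    have hF := hH i hi _ hX
    have hrk : A.rk (A.ord i) = i := hA.rk_ord i hi
    have hplan : A.plan H (A.ord i) = H i (A.path H i) := by rw [Setup.plan, hrk]
    have e17 : (get 7 (var 11)).eval τ = (A.ord i : ℕ) := by simp [hr, hE.ord i hi]
    refine Wp.assign_seq (T₂ := 40) (e17 ▸ (A.ord i).2.le.trans hN.le.le) (by decide) ?_
    rw [e17]
    have e19 : (get 15 (var 11 * var 5 + var 16)).eval (τ.setReg 17 (A.ord i)) =
        (H i (A.path H i)).elim n fun u => (u : ℕ) := by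
      simp [hr, hE.nm, h16, h15', h15 i hi _ hX]
    have hfin : ∀ v, v ≠ A.ord i → (A.rk v < i ↔ A.rk v < i + 1) := fun v hv => by
      have : A.rk v ≠ i := fun h => hv (by rw [← h, hA.ord_rk])
      omega
    refine Wp.assign_seq (T₂ := 33) ?_ (by decide) ?_
    · rw [e19]
      rcases H i (A.path H i) with _ | u
      · exact hN.le.le
      · exact u.2.le.trans hN.le.le
    rw [e19]
    rcases hHi : H i (A.path H i) with _ | u
    · refine Wp.ite 29 (by decide) (fun hv => ?_) (fun _ => Wp.skip (by omega) ⟨?_, ?_⟩)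
      · simp [hE.card] at hv
      · simp [h16, Setup.path, hHi, Setup.next]
      · intro v
        simp only [setReg_arr, h10 v]
        by_cases hv : v = A.ord i
        · subst hv
          rw [if_neg (by omega), if_pos (by omega), Setup.finalKey_none (hplan.trans hHi)]
        · simp only [hfin v hv]
    · rw [hHi] at hF hplan
      have hu := hF.2.1.1
      -- The keys are overwritten in place, but only keys of inner vertices are read, and these are
      -- the same before and after.
      have hk : τ.arr 10 u = A.key P u := by
        rw [h10, Setup.finalKey_inner ha hu, ite_self]
      have hup := hF.2.2.trans_lt (A.dig_lt hA.m_pos S u)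
      refine Wp.ite 29 (by decide) (fun _ => ?_) (fun hv => ?_)
      · refine Wp.store_seq (T₂ := 21) ?_ (by decide) ?_
        · simp only [eval_sub, eval_get, eval_var, setReg_reg, setReg_arr, if_true,
            Option.elim_some, hk]
          exact (Nat.sub_le _ _).trans (hN.key_le P u)
        have e20 : ∀ τ' : State, τ'.reg = ((τ.setReg 17 (A.ord i)).setReg 19 u).reg →
            τ'.arr 6 = τ.arr 6 →
            ((var 16 / get 6 (var 19)) % var 4).eval τ' = A.dig A.m (A.path H i) u := by
          intro τ' h1 h2
          simp [h1, h2, h16, hE.m, hE.pm u hu, Setup.dig]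
        refine Wp.assign_seq (T₂ := 14) ?_ (by decide) ?_
        · rw [e20 _ (by simp) (by funext j; simp)]
          exact (A.dig_lt hA.m_pos _ _).le.trans hN.m
        rw [e20 _ (by simp) (by funext j; simp)]
        have e16 : ∀ τ' : State, τ'.reg = (((τ.setReg 17 (A.ord i)).setReg 19 u).setReg 20
              (A.dig A.m (A.path H i) u)).reg → τ'.arr 6 = τ.arr 6 → τ'.arr 9 = τ.arr 9 →
            (var 16 + (get 9 (var 20 * var 0 + var 17) - var 20) * get 6 (var 19)).eval τ' =
              A.path H (i + 1) := by
          intro τ' h1 h2 h3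
          simp [h1, h2, h3, h16, hE.card, hE.pm u hu, hE.up _ (A.dig_lt hA.m_pos _ u), Setup.path,
            hHi, Setup.next]
        have hpath := (Setup.path_spec hA hH (Nat.succ_le_of_lt hi)).1
        refine Wp.assign ?_ (by decide) ⟨?_, ?_⟩
        · rw [e16 _ (by funext j; simp) (by funext j; simp) (by funext j; simp)]
          exact hpath.le.trans hN.nm
        · rw [e16 _ (by funext j; simp) (by funext j; simp) (by funext j; simp)]
          simp
        · intro v
          simp only [setReg_arr, setArr_arr, eval_var, eval_sub, eval_get, setReg_reg,
            Nat.reduceEqDiff, if_true, if_false, true_and, Option.elim_some, hk, hE.card, hr]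
          by_cases hv : v = A.ord i
          · subst hv
            rw [if_pos rfl, if_pos (by omega), Setup.finalKey, hplan, hrk]
            rfl
          · rw [if_neg fun h => hv (Fin.ext h), h10 v]
            simp only [hfin v hv]
      · simp [hE.card] at hv
  · rintro τ - - ⟨-, h10⟩ v
    rw [h10, if_pos (hA.rk_lt v)]

theorem exists_decisionTree_of_connected {G : SimpleGraph (Fin n)} (hG : G.Connected)
    {κ : Fin n → ℕ} (hκ : Function.Injective κ) :
    ∃ D : DecisionTree G Set.univ, ∀ x, (D.queries x).Pairwise (fun a b => κ a < κ b) ∧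
      ∀ y, y ∈ D.queries x ↔ Anc G κ y x := by
  obtain ⟨D, hD⟩ := exists_decisionTree (G := G) (S := Set.univ) hκ
    (have := hG.nonempty; Set.univ_nonempty) fun x _ y _ => ⟨trivial, by
      simpa using (SimpleGraph.reachable_iff_reflTransGen x y).1 (hG.preconnected x y)⟩
  refine ⟨D, fun x => ⟨(hD x trivial).1, fun y => ?_⟩⟩
  rw [(hD x trivial).2 y]
  simp [Anc]

/-- The parent of a vertex is its proper ancestor with the largest key. All keys are positive, so
`0` is a safe start for the maximum and survives only at the root. -/
theorem Wp.writeOutput {N T : ℕ} {A : Setup n} {κ : Fin n → ℕ} {σ : State} (hE : Env A σ)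
    (hN : Big A N) (hκ : ∀ v, 1 ≤ κ v ∧ κ v ≤ N) (h10 : ∀ v : Fin n, σ.arr 10 v = κ v)
    (h11 : ∀ u x : Fin n, κ u ≤ σ.arr 11 (u * n + x) ↔ Anc A.G κ u x)
    {D : DecisionTree A.G Set.univ} (hD : ∀ x, (D.queries x).Pairwise (fun a b => κ a < κ b) ∧
      ∀ y, y ∈ D.queries x ↔ Anc A.G κ y x)
    (hT : n * (n * 38 + 21) + 6 ≤ T) :
    Wp N writeOutput T σ fun τ => Outputs τ D := by
  refine Wp.forTo (n * 38 + 13) (fun j τ => ∀ v : Fin n, v.1 < j →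
    τ.arr 3 v = (D.parent v).elim 0 (fun u => (u : ℕ) + 1)) hE.card hN.le.le (by simp) ?_ ?_ rfl hT
  · intro x hx τ hr hf hi
    have hE' := hE.frame hf rfl
    refine Wp.assign_seq (T₂ := n * 38 + 11) (Nat.zero_le _) (by simp; omega) ?_
    refine Wp.assign_seq (T₂ := n * 38 + 9) (Nat.zero_le _) (by simp; omega) ?_
    simp only [eval_zero]
    refine Wp.seq (n * 38 + 6) 3 (Q₁ := fun τ =>
      τ.reg 12 = (D.parent ⟨x, hx⟩).elim 0 (fun u => (u : ℕ) + 1))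
      (Wp.forTo 30 (fun j τ =>
        (τ.reg 13 = 0 ∧ τ.reg 12 = 0 ∧ ∀ y : Fin n, y.1 < j → y.1 ≠ x → ¬ Anc A.G κ y ⟨x, hx⟩) ∨
        ∃ y : Fin n, y.1 < j ∧ y.1 ≠ x ∧ Anc A.G κ y ⟨x, hx⟩ ∧ τ.reg 13 = κ y ∧ τ.reg 12 = y + 1 ∧
          ∀ z : Fin n, z.1 < j → z.1 ≠ x → Anc A.G κ z ⟨x, hx⟩ → κ z ≤ κ y)
        (by simpa using hE'.card) hN.le.le ?_ ?_ ?_ rfl le_rfl) le_rfl ?_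
    · exact .inl ⟨by simp, by simp, fun y hy => absurd hy (Nat.not_lt_zero _)⟩
    · intro y hy τ₁ hr₁ hf₁ hi₁
      have f0 : τ₁.reg 0 = n := (hf₁.reg 0 rfl).trans (by simpa using hE'.card)
      have fx : τ₁.reg 11 = x := (hf₁.reg 11 rfl).trans (by simpa using hr)
      have f10 : τ₁.arr 10 = σ.arr 10 := (hf₁.arr 10 rfl).trans (hf.arr 10 rfl)
      have f11 : τ₁.arr 11 = σ.arr 11 := (hf₁.arr 11 rfl).trans (hf.arr 11 rfl)
      have i1 := h10 ⟨y, hy⟩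
      have i2 := h11 ⟨y, hy⟩ ⟨x, hx⟩
      simp only at i1 i2
      have hc : ((1 - (var 14).same (var 11)) *
          (ancExpr 14 11 * (var 13).less (get 10 (var 14)))).eval τ₁ =
          if y ≠ x ∧ Anc A.G κ ⟨y, hy⟩ ⟨x, hx⟩ ∧ τ₁.reg 13 < κ ⟨y, hy⟩ then 1 else 0 := by
        simp only [ancExpr, eval_mul, eval_get, eval_var, eval_sub, eval_one, eval_less, eval_add,
          eval_same, f0, fx, f10, f11, hr₁, i1, ← i2]
        by_cases c1 : y = x <;> by_cases c2 : κ ⟨y, hy⟩ ≤ σ.arr 11 (y * n + x) <;>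
          by_cases c3 : τ₁.reg 13 < κ ⟨y, hy⟩ <;> simp [c1, c2, c3, not_lt.2, not_le.1]
      have hcase : ∀ z : Fin n, z.1 < y + 1 → z.1 < y ∨ z = ⟨y, hy⟩ := fun z hz => by
        rcases Nat.lt_succ_iff_lt_or_eq.1 hz with h | h
        · exact .inl h
        · exact .inr (Fin.ext h)
      refine Wp.ite 7 (by decide) (fun hv => ?_) (fun hv => Wp.skip (by omega) ?_)
      · rw [hc] at hv
        have hv' : y ≠ x ∧ Anc A.G κ ⟨y, hy⟩ ⟨x, hx⟩ ∧ τ₁.reg 13 < κ ⟨y, hy⟩ := by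
          by_contra h
          exact hv (if_neg h)
        obtain ⟨c1, c2, c3⟩ := hv'
        refine Wp.assign_seq (T₂ := 4) ?_ (by decide) (Wp.assign ?_ (by decide) ?_)
        · simpa [hr₁, f10, i1] using (hκ ⟨y, hy⟩).2
        · have := hN.le
          simp [hr₁]
          omega
        · refine .inr ⟨⟨y, hy⟩, Nat.lt_succ_self _, c1, c2, by simp [hr₁, f10, i1], by simp [hr₁],
            fun z hz hzx hza => ?_⟩
          rcases hcase z hz with hz | rfl
          · rcases hi₁ with ⟨-, -, h⟩ | ⟨y', -, -, -, h13, -, h⟩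
            · exact (h z hz hzx hza).elim
            · exact (h z hz hzx hza).trans (h13 ▸ c3.le)
          · exact le_rfl
      · rw [hc] at hv
        have hv' : ¬ (y ≠ x ∧ Anc A.G κ ⟨y, hy⟩ ⟨x, hx⟩ ∧ τ₁.reg 13 < κ ⟨y, hy⟩) := by
          intro h
          rw [if_pos h] at hv
          exact one_ne_zero hv
        simp only [setReg_reg, Nat.reduceEqDiff, if_false]
        rcases hi₁ with ⟨h13, h12, h⟩ | ⟨y', hy', hyx, hya, h13, h12, h⟩
        · refine .inl ⟨h13, h12, fun z hz hzx hza => ?_⟩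
          rcases hcase z hz with hz | rfl
          · exact h z hz hzx hza
          · exact hv' ⟨hzx, hza, h13 ▸ (hκ _).1⟩
        · refine .inr ⟨y', by omega, hyx, hya, h13, h12, fun z hz hzx hza => ?_⟩
          rcases hcase z hz with hz | rfl
          · exact h z hz hzx hza
          · exact not_lt.1 fun h' => hv' ⟨hzx, hza, h13 ▸ h'⟩
    · intro τ₁ _ _ hi₁
      obtain ⟨hp, hm⟩ := hD ⟨x, hx⟩
      rw [DecisionTree.parent]
      rcases dropLast_getLast?_of_pairwise hp (D.getLast?_queries (Set.mem_univ _)) with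
        ⟨h, h'⟩ | ⟨y, h', hy, hyx, hmax⟩
      · rw [h']
        rcases hi₁ with ⟨-, h12, -⟩ | ⟨y, -, hyx, hya, -⟩
        · exact h12
        · exact (hyx (congrArg Fin.val (h y ((hm y).2 hya)))).elim
      · rw [h']
        have hyx' : y.1 ≠ x := fun h => hyx (Fin.ext h)
        rcases hi₁ with ⟨-, -, h⟩ | ⟨y', -, hyx₁, hya₁, -, h12, h⟩
        · exact (h y y.2 hyx' ((hm y).1 hy)).elim
        · have h1 := h y y.2 hyx' ((hm y).1 hy)
          have h2 := hmax y' ((hm y').2 hya₁) fun h => hyx₁ (congrArg Fin.val h)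
          -- Injectivity of the keys is not assumed here; two vertices on one path are separated by
          -- the strict increase of the keys along it.
          have : y = y' := by
            by_contra hne
            have h3 := ((hm y).1 hy)
            rcases List.pairwise_iff_getElem.1 hp with hp'
            obtain ⟨i, hi', hyi⟩ := List.getElem_of_mem hy
            obtain ⟨j, hj', hyj⟩ := List.getElem_of_mem ((hm y').2 hya₁)
            rcases lt_trichotomy i j with hij | hij | hij
            · have := hp' i j hi' hj' hij
              rw [hyi, hyj] at this
              omega
            · subst hij
              exact hne (hyi.symm.trans hyj)
            · have := hp' j i hj' hi' hij
              rw [hyi, hyj] at this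
              omega
          rw [h12, this]
          rfl
    · intro τ₁ hf₁ h12
      have g11 : τ₁.reg 11 = x := (hf₁.reg 11 rfl).trans (by simpa using hr)
      have g3 : τ₁.arr 3 = τ.arr 3 := hf₁.arr 3 rfl
      refine Wp.store ?_ le_rfl ?_
      · simp only [eval_var, h12]
        rcases D.parent ⟨x, hx⟩ with _ | u
        · exact Nat.zero_le _
        · exact u.2.trans_le hN.le.le
      · intro v hv
        simp only [setReg_arr, setArr_arr, eval_var, g11, g3, h12, true_and]
        split_ifs with hvx
        · rw [(Fin.ext hvx : v = ⟨x, hx⟩)]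
        · exact hi v (by omega)
  · intro τ _ _ hi v
    exact hi v v.2

end GraphSearch

namespace GraphSearch
open GraphSearch.Expr GraphSearch.Program
open scoped Classical

variable {n : ℕ}

/-- The recorded value is nominal and only bounds the cost of the stored tree from above. This is
all that is needed, because the nominal value is what gets compared with the optimum. -/
theorem Wp.improve {N P S T : ℕ} {A : Setup n} {σ : State} (hσ : Tables A P S σ) (hA : A.Valid)
    (hN : Big A N) (hG : A.G.Connected) (hs : Solved A P S σ)
    (h14 : σ.reg 14 = ∑ v, if A.Inner v then A.w v * A.total P S v else 0)
    (hT : n * (n * (n * 48 + 14) + 14) + n * (n * 36 + 14) + n * (n * 38 + 21) + n * 51 + 45 ≤ T) :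
    Wp N improve T σ fun τ => τ.reg 8 ≠ 0 ∧ τ.reg 8 ≤ A.value P S + 1 ∧
      (σ.reg 8 ≠ 0 → τ.reg 8 ≤ σ.reg 8) ∧
      ((∃ D : DecisionTree A.G Set.univ, Outputs τ D ∧ D.cost A.c A.w + 1 ≤ τ.reg 8) ∨
        σ.reg 8 ≠ 0 ∧ τ.reg 8 = σ.reg 8 ∧ τ.arr 3 = σ.arr 3) := by
  have hE := hσ.env
  have hval : A.value P S + 1 ≤ N := by
    have h1 := A.value_le_mul (P := P) (S := S) hA
    have h2 := hN.value
    have h3 : (n + 1) * A.maxStep ≤ (n + 2) * A.maxStep := Nat.mul_le_mul_right _ (by omega)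
    omega
  have hpos : 0 < A.m ^ A.k := Nat.pow_pos hA.m_pos
  have e14 : (var 14 + get 14 0).eval σ = A.value P S := by
    have := hs.value 0 (Nat.zero_le _) 0 hpos
    simp only [zero_mul, add_zero, Nat.sub_zero] at this
    simp [h14, this, Setup.value]
  refine Wp.assign_seq (T₂ := n * (n * (n * 48 + 14) + 14) + n * (n * 36 + 14) +
    n * (n * 38 + 21) + n * 51 + 40) (by rw [e14]; omega) (by simp; omega) ?_
  rw [e14]
  have hc : ((var 8).same 0 + (var 14 + 1).less (var 8)).eval (σ.setReg 14 (A.value P S)) ≠ 0 ↔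
      σ.reg 8 = 0 ∨ A.value P S + 1 < σ.reg 8 := by
    by_cases c1 : σ.reg 8 = 0 <;> by_cases c2 : A.value P S + 1 < σ.reg 8 <;> simp [c1, c2]
  refine Wp.ite (n * (n * (n * 48 + 14) + 14) + n * (n * 36 + 14) +
    n * (n * 38 + 21) + n * 51 + 30) (by simp; omega) (fun hv => ?_) (fun hv => ?_)
  · rw [hc] at hv
    refine Wp.assign_seq (T₂ := n * (n * (n * 48 + 14) + 14) + n * (n * 36 + 14) +
      n * (n * 38 + 21) + n * 51 + 26) (by simpa using hval) (by simp; omega) ?_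
    -- Outside the table the decision is set to `none`, which makes the choice function total.
    have hex : ∀ i X, ∃ o, i < n → X < A.m ^ A.k → A.Feas P S X (A.ord i) o ∧
        A.F P S (n - i) X = A.stepCost P S X (A.ord i) o +
          A.F P S (n - (i + 1)) (A.next X (A.ord i) o) ∧
        σ.arr 15 (i * A.m ^ A.k + X) = o.elim n fun u => (u : ℕ) := by
      intro i X
      by_cases h : i < n ∧ X < A.m ^ A.k
      · obtain ⟨o, ho⟩ := hs.choice i h.1 X h.2
        exact ⟨o, fun _ _ => ho⟩
      · exact ⟨none, fun h1 h2 => (h ⟨h1, h2⟩).elim⟩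
    choose H hH using hex
    have hfeas : ∀ i < n, ∀ X < A.m ^ A.k, A.Feas P S X (A.ord i) (H i X) :=
      fun i hi X hX => (hH i X hi hX).1
    have ha : ∀ x u, A.plan H x = some u → ¬ A.Inner x ∧ A.Above P u x := by
      intro x u hx
      have := hfeas _ (hA.rk_lt x) _ (Setup.path_spec hA hfeas (hA.rk_lt x).le).1
      rw [hA.ord_rk, show H (A.rk x) (A.path H (A.rk x)) = some u from hx] at this
      exact ⟨this.1, this.2.1⟩
    set κ := A.finalKey P (A.plan H) with hκdef
    have hκ : ∀ v, 1 ≤ κ v ∧ κ v ≤ N := fun v => by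
      refine ⟨?_, (Setup.finalKey_le ha v).trans (hN.key_le P v)⟩
      rcases hv : A.plan H v with _ | u
      · rw [hκdef, Setup.finalKey_none hv]
        exact A.one_le_key P v
      · have h1 := Setup.finalKey_some (P := P) (ha v u hv).2.1 hv
        have h2 := Setup.key_inner (P := P) (ha v u hv).2.1
        rw [hκdef]
        omega
    obtain ⟨D, hD⟩ := exists_decisionTree_of_connected hG (Setup.finalKey_injective hA ha)
    have hcost : D.cost A.c A.w ≤ A.value P S := by
      refine Setup.cost_le_value hA hfeas (fun i hi X hX => (hH i X hi hX).2.1) (fun x => ?_)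
        fun x y hy => ((hD x).2 y).1 hy
      exact (hD x).1.imp fun h => ne_of_apply_ne κ h.ne
    generalize hρ : ((σ.setReg 14 (A.value P S)).setReg 8
      ((var 14 + 1).eval (σ.setReg 14 (A.value P S)))) = ρ
    have hρσ : Tables A P S ρ := by
      refine Tables.frame (p := Program.assign 14 0 ;; Program.assign 8 0) hσ
        ⟨fun x hx => ?_, fun a ha => by rw [← hρ]; rfl⟩ rfl
      simp only [writesReg, Bool.or_eq_false_iff, beq_eq_false_iff_ne, ne_eq] at hx
      rw [← hρ]
      simp [Ne.symm hx.1, Ne.symm hx.2]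
    have hρ8 : ρ.reg 8 = A.value P S + 1 := by rw [← hρ]; simp
    refine Wp.seq (n * 51 + 8) (n * (n * (n * 48 + 14) + 14) + n * (n * 36 + 14) +
      n * (n * 38 + 21) + 18) (Wp.walk hρσ hA hN hfeas (fun i hi X hX => ?_) le_rfl) (by omega) ?_
    · rw [← hρ]
      exact (hH i X hi hX).2.2
    intro τ₁ hf₁ h10
    have hE₁ := hρσ.env.frame hf₁ rfl
    refine Wp.seq (n * (n * (n * 48 + 14) + 14) + 6 + (n * (n * 36 + 14) + 6))
      (n * (n * 38 + 21) + 6) (Wp.closure hE₁ hN hκ h10 le_rfl) (by omega) ?_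
    intro τ₂ hf₂ h11
    have hE₂ := hE₁.frame hf₂ rfl
    refine Wp.mono (Wp.writeOutput hE₂ hN hκ (fun v => ?_) h11 hD le_rfl) le_rfl ?_
    · rw [hf₂.arr 10 rfl]
      exact h10 v
    · intro τ₃ hf₃ hout
      have h8 : τ₃.reg 8 = A.value P S + 1 :=
        ((hf₃.reg 8 rfl).trans (hf₂.reg 8 rfl)).trans ((hf₁.reg 8 rfl).trans hρ8)
      rw [h8]
      exact ⟨by omega, le_rfl, fun h => by omega, .inl ⟨D, hout, by omega⟩⟩
  · have hv' : ¬ (σ.reg 8 = 0 ∨ A.value P S + 1 < σ.reg 8) := fun h => hc.2 h hv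
    refine Wp.skip (by omega) ?_
    simp only [setReg_reg, setReg_arr, Nat.reduceEqDiff, if_false]
    exact ⟨by omega, by omega, fun _ => le_rfl, .inr ⟨by omega, trivial, trivial⟩⟩

/-- In the time bound, `161 = 15 + 88 + 58` collects the terms with `m ^ k`; the constants of all
other terms add up to less than `650`. -/
theorem Wp.candidate {N P S T : ℕ} {A : Setup n} {σ : State} (hE : Env A σ) (hA : A.Valid)
    (hN : Big A N) (hG : A.G.Connected) (h9 : σ.reg 9 = P) (h10 : σ.reg 10 = S) (hn : 1 ≤ n)
    (hT : A.m ^ A.k * (n * n) * 161 + n * n * n * 650 ≤ T) :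
    Wp N candidate T σ fun τ => τ.reg 8 ≠ 0 ∧ τ.reg 8 ≤ A.value P S + 1 ∧
      (σ.reg 8 ≠ 0 → τ.reg 8 ≤ σ.reg 8) ∧
      ((∃ D : DecisionTree A.G Set.univ, Outputs τ D ∧ D.cost A.c A.w + 1 ≤ τ.reg 8) ∨
        σ.reg 8 ≠ 0 ∧ τ.reg 8 = σ.reg 8 ∧ τ.arr 3 = σ.arr 3) := by
  set C := n * (n * (n * 48 + 14) + 14) + 6 + (n * (n * 36 + 14) + 6) with hC
  set DP := A.m ^ A.k * 15 + n * (A.m ^ A.k * (n * 88 + 58) + 28) + 12 with hDP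
  set I := n * (n * (n * 48 + 14) + 14) + n * (n * 36 + 14) + n * (n * 38 + 21) + n * 51 + 45
    with hI
  have hsum : (n * 50 + 6) + C + (n * 16 + 6) + (n * (n * 32 + 19) + 6) + (n * 19 + 8) + DP + I ≤
      A.m ^ A.k * (n * n) * 161 + n * n * n * 650 := by
    have h1 : n ≤ n * n := Nat.le_mul_of_pos_left n hn
    have h2 : n * n ≤ n * n * n := Nat.le_mul_of_pos_right _ hn
    have h3 : A.m ^ A.k * n ≤ A.m ^ A.k * (n * n) := Nat.mul_le_mul_left _ h1
    have h4 : A.m ^ A.k ≤ A.m ^ A.k * n := Nat.le_mul_of_pos_right _ hn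
    rw [hC, hDP, hI]
    nlinarith
  refine Wp.seq (n * 50 + 6) (C + ((n * 16 + 6) + (n * (n * 32 + 19) + 6) + (n * 19 + 8) + DP + I))
    (Wp.makeKeys hE hN h9 le_rfl) (by omega) fun τ₁ hf₁ k10 => ?_
  have hE₁ := hE.frame hf₁ rfl
  refine Wp.seq C ((n * 16 + 6) + (n * (n * 32 + 19) + 6) + (n * 19 + 8) + DP + I)
    (Wp.closure hE₁ hN (fun v => ⟨A.one_le_key P v, hN.key_le P v⟩) k10 le_rfl) le_rfl
    fun τ₂ hf₂ k11 => ?_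
  have hE₂ := hE₁.frame hf₂ rfl
  rw [← hf₂.arr 10 rfl] at k10
  refine Wp.seq (n * 16 + 6) ((n * (n * 32 + 19) + 6) + (n * 19 + 8) + DP + I)
    (Wp.makeLimits (S := S) hE₂ hN hA ?_ le_rfl) (by omega) fun τ₃ hf₃ k12 => ?_
  · exact (hf₂.reg 10 rfl).trans ((hf₁.reg 10 rfl).trans h10)
  have hE₃ := hE₂.frame hf₃ rfl
  rw [← hf₃.arr 10 rfl] at k10
  rw [← hf₃.arr 11 rfl] at k11
  refine Wp.seq (n * (n * 32 + 19) + 6) ((n * 19 + 8) + DP + I)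
    (Wp.makeTotals hE₃ hN hA k10 k11 k12 le_rfl) (by omega) fun τ₄ hf₄ k13 => ?_
  have hT₄ : Tables A P S τ₄ := by
    refine ⟨hE₃.frame hf₄ rfl, ?_, ?_, ?_, k13⟩
    · rwa [hf₄.arr 10 rfl]
    · rwa [hf₄.arr 11 rfl]
    · rwa [hf₄.arr 12 rfl]
  refine Wp.seq (n * 19 + 8) (DP + I) (Wp.sumInner hT₄.env hN hA k13 le_rfl) (by omega)
    fun τ₅ hf₅ k14 => ?_
  have hT₅ := hT₄.frame hf₅ rfl
  refine Wp.seq DP I (Wp.dynamicProgram hT₅ hA hN le_rfl) le_rfl fun τ₆ hf₆ hs => ?_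
  have hT₆ := hT₅.frame hf₆ rfl
  have e8 : τ₆.reg 8 = σ.reg 8 := (hf₆.reg 8 rfl).trans <| (hf₅.reg 8 rfl).trans <|
    (hf₄.reg 8 rfl).trans <| (hf₃.reg 8 rfl).trans <| (hf₂.reg 8 rfl).trans (hf₁.reg 8 rfl)
  have e3 : τ₆.arr 3 = σ.arr 3 := (hf₆.arr 3 rfl).trans <| (hf₅.arr 3 rfl).trans <|
    (hf₄.arr 3 rfl).trans <| (hf₃.arr 3 rfl).trans <| (hf₂.arr 3 rfl).trans (hf₁.arr 3 rfl)
  rw [← e8, ← e3]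
  exact Wp.improve hT₆ hA hN hG hs ((hf₆.reg 14 rfl).trans k14) le_rfl

theorem Wp.search {N T : ℕ} {A : Setup n} {σ : State} (hE : Env A σ) (hA : A.Valid)
    (hN : Big A N) (hG : A.G.Connected) (hn : 1 ≤ n)
    (hT : n ^ A.k * (A.m ^ A.k * (A.m ^ A.k * (n * n) * 161 + n * n * n * 650 + 8) + 14) + 8 ≤ T) :
    Wp N search T σ fun τ => ∃ D : DecisionTree A.G Set.univ, Outputs τ D ∧
      ∀ P < n ^ A.k, ∀ S < A.m ^ A.k, D.cost A.c A.w ≤ A.value P S := by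
  -- Either no guess has been treated, or the recorded value lies between the cost of the stored
  -- tree and all nominal values seen so far (each plus one). The shift by one reserves `0` for the
  -- first case.
  set Inv : ℕ → ℕ → State → Prop := fun P S τ =>
    (τ.reg 8 = 0 ∧ ∀ P' S', S' < A.m ^ A.k → ¬ (P' < P ∨ P' = P ∧ S' < S)) ∨
    (τ.reg 8 ≠ 0 ∧
      (∃ D : DecisionTree A.G Set.univ, Outputs τ D ∧ D.cost A.c A.w + 1 ≤ τ.reg 8) ∧
      ∀ P' S', S' < A.m ^ A.k → P' < P ∨ P' = P ∧ S' < S → τ.reg 8 ≤ A.value P' S' + 1) with hInv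
  have hcongr : ∀ P S (τ τ' : State), τ'.reg 8 = τ.reg 8 → τ'.arr 3 = τ.arr 3 → Inv P S τ →
      Inv P S τ' := by
    intro P S τ τ' h8 h3 h
    simp only [hInv, h8, Outputs, h3] at h ⊢
    exact h
  have hrow : ∀ P τ, Inv P (A.m ^ A.k) τ → Inv (P + 1) 0 τ := by
    intro P τ h
    have : ∀ P' S', S' < A.m ^ A.k → (P' < P + 1 ∨ P' = P + 1 ∧ S' < 0) →
        P' < P ∨ P' = P ∧ S' < A.m ^ A.k := by omega
    rcases h with ⟨h8, h⟩ | ⟨h8, hD, h⟩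
    · exact .inl ⟨h8, fun P' S' hS h' => h P' S' hS (this P' S' hS h')⟩
    · exact .inr ⟨h8, hD, fun P' S' hS h' => h P' S' hS (this P' S' hS h')⟩
  refine Wp.assign_seq (T₂ := n ^ A.k * (A.m ^ A.k * (A.m ^ A.k * (n * n) * 161 +
    n * n * n * 650 + 8) + 14) + 6) (Nat.zero_le _) (by simp; omega) ?_
  refine Wp.forTo (A.m ^ A.k * (A.m ^ A.k * (n * n) * 161 + n * n * n * 650 + 8) + 6)
    (fun P τ => Inv P 0 τ) (by simpa using hE.np) hN.np ?_ ?_ ?_ rfl le_rfl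
  · exact .inl ⟨by simp, by omega⟩
  · intro P hP τ hr hf hi
    have hE₁ : Env A τ := by
      refine hE.frame (p := GraphSearch.search) ⟨fun x hx => ?_, fun a ha => hf.arr a ha⟩ rfl
      simp only [GraphSearch.search, writesReg, Bool.or_eq_false_iff] at hx
      rw [hf.reg x hx.2]
      have := hx.1
      simp only [beq_eq_false_iff_ne, ne_eq] at this
      simp [Ne.symm this]
    refine Wp.forTo (A.m ^ A.k * (n * n) * 161 + n * n * n * 650) (fun S τ => Inv P S τ) hE₁.nm
      hN.nm ?_ ?_ ?_ rfl le_rfl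
    · exact hcongr _ _ _ _ (by simp) rfl hi
    · intro S hS τ₁ hr₁ hf₁ hi₁
      refine Wp.mono (Wp.candidate (P := P) (S := S) (hE₁.frame hf₁ rfl) hA hN hG
        ((hf₁.reg 9 rfl).trans hr) hr₁ hn le_rfl) le_rfl ?_
      rintro τ₂ - ⟨h8, hle, hmono, hD⟩
      refine hcongr _ _ τ₂ _ (by simp) rfl (.inr ⟨h8, ?_, ?_⟩)
      · rcases hD with hD | ⟨g8, k8, k3⟩
        · exact hD
        · rcases hi₁ with ⟨h0, -⟩ | ⟨-, ⟨D, hD, hc⟩, -⟩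
          · exact (g8 h0).elim
          · refine ⟨D, ?_, k8 ▸ hc⟩
            rw [Outputs, k3]
            exact hD
      · intro P' S' hS' h
        by_cases heq : P' = P ∧ S' = S
        · rw [heq.1, heq.2]
          exact hle
        · have h' : P' < P ∨ P' = P ∧ S' < S := by omega
          rcases hi₁ with ⟨-, h0⟩ | ⟨g8, -, hall⟩
          · exact (h0 P' S' hS' h').elim
          · exact (hmono g8).trans (hall P' S' hS' h')
    · intro τ₁ _ _ hi₁
      exact hcongr _ _ τ₁ _ (by simp) rfl (hrow P τ₁ hi₁)
  · intro τ _ _ hi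
    have hpos : 0 < A.m ^ A.k := Nat.pow_pos hA.m_pos
    rcases hi with ⟨-, h⟩ | ⟨-, ⟨D, hD, hc⟩, hall⟩
    · exact (h 0 0 hpos (.inl (Nat.pow_pos hn))).elim
    · refine ⟨D, hD, fun P hP S hS => ?_⟩
      have := hall P S hS (.inl hP)
      omega

theorem Wp.prepare {N T : ℕ} {ε : ℚ} [NeZero n] {G : SimpleGraph (Fin n)} {c w : Fin n → ℕ}
    (hG : G.Connected) (hk : ∃ v, (G.neighborSet v).ncard ≠ 1)
    (hN : Big (setup ε G c w) N) (hd : 2 * n * ε.den ≤ N)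
    (hT : (setup ε G c w).m * (n * ((setup ε G c w).m * 19 + 23) + 14) +
      (setup ε G c w).m * 34 + n * (n * 79) + n * 91 + 72 ≤ T) :
    Wp N prepare T (inputState ε G c w) (Env (setup ε G c w)) := by
  set A := setup ε G c w with hAdef
  have hA : A.Valid := setup_valid ε c w hG hk
  set σ := inputState ε G c w with hσ
  have hn : 0 < n := Nat.pos_of_ne_zero (NeZero.ne n)
  have r0 : σ.reg 0 = n := rfl
  have r1 : σ.reg 1 = ε.num.toNat := rfl
  have r2 : σ.reg 2 = ε.den := rfl
  have hadj : ∀ u v : Fin n, σ.arr 0 (u * n + v) = if A.G.Adj u v then 1 else 0 := by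
    intro u v
    have : (∃ a b : Fin n, G.Adj a b ∧ (u : ℕ) * n + v = a * n + b) ↔ G.Adj u v := by
      constructor
      · rintro ⟨a, b, hab, h⟩
        obtain ⟨h1, h2⟩ := index_injective h
        rwa [Fin.ext h1, h2]
      · exact fun h => ⟨u, v, h, rfl⟩
    simp only [hσ, inputState, if_true, this]
    rfl
  have hc : ∀ v : Fin n, σ.arr 1 v = A.c v := fun v => by simp [hσ, inputState]; rfl
  have hw : ∀ v : Fin n, σ.arr 2 v = A.w v := fun v => by simp [hσ, inputState]; rfl
  have hcN : ∑ v, A.c v ≤ N := by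
    have := hN.total
    rw [Setup.maxTotal] at this
    omega
  have hgN : A.g (A.m - 1) ≤ N := by
    have := hN.total
    rw [Setup.maxTotal] at this
    have := Nat.le_mul_of_pos_left (A.g (A.m - 1)) hn
    omega
  refine Wp.seq (n * (n * 17 + 23) + 6) (A.m * (n * (A.m * 19 + 23) + 14) +
      A.m * 34 + n * (n * 62) + n * 68 + 66) (Wp.markInner hN.le r0 hadj le_rfl)
      (by rw [Nat.mul_add n (n * 17)]; have : n * (n * 79) = n * (n * 17) + n * (n * 62) := by ring
          omega) fun τ₁ f₁ inner => ?_
  have h := Wp.powers (A := A) (N := N) (σ := τ₁) (base := 0) (out := 3) (a := 5) hN.le.le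
    ((f₁.reg 0 rfl).trans r0) ((f₁.reg 0 rfl).trans r0) hn hN.np inner (by decide) (by decide) le_rfl
  refine Wp.seq (n * 18 + 8) (A.m * (n * (A.m * 19 + 23) + 14) +
      A.m * 34 + n * (n * 62) + n * 50 + 58) h (by omega) fun τ₂ f₂ ⟨np, pn⟩ => ?_
  refine Wp.seq (n * 13 + 8) (A.m * (n * (A.m * 19 + 23) + 14) +
      A.m * 34 + n * (n * 62) + n * 37 + 50) (Wp.sumCosts (c := A.c) hN.le.le
      ((f₂.reg 0 rfl).trans <| (f₁.reg 0 rfl).trans r0) ?_ hcN le_rfl) (by omega)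
      fun τ₃ f₃ r6 => ?_
  · rw [f₂.arr 1 rfl, f₁.arr 1 rfl]
    exact hc
  have s0 : τ₃.reg 0 = n :=
    (f₃.reg 0 rfl).trans <| (f₂.reg 0 rfl).trans <| (f₁.reg 0 rfl).trans r0
  refine Wp.seq (n * (n * 62 + 19) + 6) (A.m * (n * (A.m * 19 + 23) + 14) +
      A.m * 34 + n * 18 + 44) (Wp.sortVertices (c := A.c) (w := A.w) hN.le.le s0 ?_ ?_ r6 le_rfl)
      (by rw [Nat.mul_add n (n * 62)]; omega) fun τ₄ f₄ ord => ?_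
  · rw [f₃.arr 1 rfl, f₂.arr 1 rfl, f₁.arr 1 rfl]
    exact hc
  · rw [f₃.arr 2 rfl, f₂.arr 2 rfl, f₁.arr 2 rfl]
    exact hw
  refine Wp.seq (A.m * 34 + 30) (A.m * (n * (A.m * 19 + 23) + 14) + n * 18 + 14)
    (Wp.makeGrid (n := n) (a := ε.num.toNat) (d := ε.den) (x := ∑ v, A.c v)
      ((f₄.reg 0 rfl).trans s0) ?_ ?_ ((f₄.reg 6 rfl).trans r6) hd hgN hN.m le_rfl) (by omega)
    fun τ₅ f₅ ⟨r4, grd⟩ => ?_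
  · exact (f₄.reg 1 rfl).trans <| (f₃.reg 1 rfl).trans <| (f₂.reg 1 rfl).trans <|
      (f₁.reg 1 rfl).trans r1
  · exact (f₄.reg 2 rfl).trans <| (f₃.reg 2 rfl).trans <| (f₂.reg 2 rfl).trans <|
      (f₁.reg 2 rfl).trans r2
  have t0 : τ₅.reg 0 = n := (f₅.reg 0 rfl).trans <| (f₄.reg 0 rfl).trans s0
  have inner₅ : ∀ v : Fin n, τ₅.arr 4 v = if A.Inner v then 1 else 0 := by
    rw [f₅.arr 4 rfl, f₄.arr 4 rfl, f₃.arr 4 rfl, f₂.arr 4 rfl]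
    exact inner
  have h := Wp.powers (A := A) (N := N) (σ := τ₅) (base := 4) (out := 5) (a := 6) hN.le.le
    t0 r4 hA.m_pos hN.nm inner₅ (by decide) (by decide) le_rfl
  refine Wp.seq (n * 18 + 8) (A.m * (n * (A.m * 19 + 23) + 14) + 6) h (by omega)
    fun τ₆ f₆ ⟨nm, pm⟩ => ?_
  have r4' : τ₆.reg 4 = A.m := (f₆.reg 4 rfl).trans r4
  have hc₆ : ∀ v : Fin n, τ₆.arr 1 v = A.c v := by
    rw [f₆.arr 1 rfl, f₅.arr 1 rfl, f₄.arr 1 rfl, f₃.arr 1 rfl, f₂.arr 1 rfl, f₁.arr 1 rfl]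
    exact hc
  have grd₆ : ∀ i < A.m, τ₆.arr 8 i = A.g i := by
    rw [f₆.arr 8 rfl]
    exact grd
  refine Wp.mono (Wp.roundUp hN.le.le hN.m ((f₆.reg 0 rfl).trans t0) r4' hc₆ grd₆ le_rfl) le_rfl
    fun τ₇ f₇ up => ?_
  constructor
  · exact (f₇.reg 0 rfl).trans <| (f₆.reg 0 rfl).trans t0
  · exact (f₇.reg 3 rfl).trans <| (f₆.reg 3 rfl).trans <| (f₅.reg 3 rfl).trans <|
      (f₄.reg 3 rfl).trans <| (f₃.reg 3 rfl).trans np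
  · exact (f₇.reg 4 rfl).trans r4'
  · exact (f₇.reg 5 rfl).trans nm
  · rw [f₇.arr 0 rfl, f₆.arr 0 rfl, f₅.arr 0 rfl, f₄.arr 0 rfl, f₃.arr 0 rfl, f₂.arr 0 rfl,
      f₁.arr 0 rfl]
    exact hadj
  · rw [f₇.arr 1 rfl]
    exact hc₆
  · rw [f₇.arr 2 rfl, f₆.arr 2 rfl, f₅.arr 2 rfl, f₄.arr 2 rfl, f₃.arr 2 rfl, f₂.arr 2 rfl,
      f₁.arr 2 rfl]
    exact hw
  · rw [f₇.arr 4 rfl, f₆.arr 4 rfl]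
    exact inner₅
  · rw [f₇.arr 5 rfl, f₆.arr 5 rfl, f₅.arr 5 rfl, f₄.arr 5 rfl, f₃.arr 5 rfl]
    exact pn
  · rw [f₇.arr 6 rfl]
    exact pm
  · rw [f₇.arr 7 rfl, f₆.arr 7 rfl, f₅.arr 7 rfl]
    intro i hi
    have := ord (A.ord i)
    rwa [show rank A.c A.w ((∑ v, A.c v) + 1) (A.ord i) = i from hA.rk_ord i hi] at this
  · rw [f₇.arr 8 rfl]
    exact grd₆
  · exact up

end GraphSearch

namespace GraphSearch

/-! ### The bounds -/

/-- The power is at most `exp (ε / 2) ≤ 1 / (1 - ε / 2)`, and `(1 + ε) * (1 - ε / 2) ≥ 1` for `ε ≤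
1`. -/
theorem one_add_div_pow_le {ε : ℝ} (h0 : 0 ≤ ε) (h1 : ε ≤ 1) {n : ℕ} (hn : 1 ≤ n) :
    (1 + ε / (2 * n)) ^ n ≤ 1 + ε := by
  have hn' : (0 : ℝ) < n := by exact_mod_cast hn
  have h2 : (1 + ε / (2 * n)) ^ n ≤ Real.exp (ε / 2) := by
    have h : 1 + ε / (2 * n) ≤ Real.exp (ε / (2 * n)) := by
      rw [add_comm]; exact Real.add_one_le_exp _
    refine (pow_le_pow_left₀ (by positivity) h n).trans_eq ?_
    rw [← Real.exp_nat_mul]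
    congr 1
    field_simp
  refine h2.trans ((Real.exp_bound_div_one_sub_of_interval (by positivity) (by linarith)).trans ?_)
  rw [div_le_iff₀ (by linarith)]
  nlinarith

/-- For `x ≤ n` there is nothing to do. Otherwise `k ≤ n < x`, so only boundedly many exponents
occur and `x ^ ⌈x⌉` serves as the constant. -/
theorem exists_pow_le {x : ℝ} (hx : 1 ≤ x) :
    ∃ D : ℝ, 0 ≤ D ∧ ∀ n k : ℕ, k ≤ n → x ^ k ≤ D * (n : ℝ) ^ k := by
  refine ⟨x ^ ⌈x⌉₊, by positivity, fun n k hkn => ?_⟩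
  have hD : 1 ≤ x ^ ⌈x⌉₊ := one_le_pow₀ hx
  by_cases h : x ≤ n
  · exact (pow_le_pow_left₀ (by linarith) h k).trans (le_mul_of_one_le_left (by positivity) hD)
  · have h1 : k ≤ ⌈x⌉₊ := hkn.trans (by
      have := (not_le.1 h).le.trans (Nat.le_ceil x)
      exact_mod_cast this)
    have h2 : 1 ≤ (n : ℝ) ^ k := by
      rcases Nat.eq_zero_or_pos n with rfl | hn
      · obtain rfl : k = 0 := by omega
        simp
      · exact one_le_pow₀ (by exact_mod_cast hn)
    exact (pow_le_pow_right₀ hx h1).trans (le_mul_of_one_le_right (by positivity) h2)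

/-- Equivalent to `2 ^ x ≤ 1 + x` on the unit interval, which is Bernoulli's inequality for
exponents at most one. -/
theorem le_logb_one_add {x : ℝ} (h0 : 0 ≤ x) (h1 : x ≤ 1) : x ≤ Real.logb 2 (1 + x) := by
  rw [Real.le_logb_iff_rpow_le (by norm_num) (by linarith)]
  have := rpow_one_add_le_one_add_mul_self (s := 1) (by norm_num) h0 h1
  norm_num at this
  exact this

theorem logb_one_add_le {x : ℝ} (h0 : 0 ≤ x) : Real.logb 2 (1 + x) ≤ 2 * x := by
  have h2 := Real.log_two_gt_d9
  rw [Real.logb, div_le_iff₀ (by linarith)]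
  have := Real.log_le_sub_one_of_pos (show 0 < 1 + x by linarith)
  nlinarith

/-! ### Growth and size of the grid -/

section Grid
variable {a b : ℕ}

/-- Grid points are at least their index, so from index `b / a + 1` on the quotient `x * a / b` is
at least one. Rounding it down then loses at most a factor of two, which explains the halved growth
rate. -/
theorem grid_growth (ha : 0 < a) (hab : a ≤ b) (j : ℕ) :
    (1 + (a : ℝ) / b / 2) ^ j ≤ grid a b (b / a + 1 + j) := by
  have hb : (0 : ℝ) < b := by exact_mod_cast ha.trans_le hab
  induction j with
  | zero =>
    have := (grid_strictMono a b).le_apply (x := b / a + 1 + 0)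
    rw [pow_zero]
    exact_mod_cast (Nat.succ_le_succ (Nat.zero_le (b / a))).trans this
  | succ j ih =>
    set x := grid a b (b / a + 1 + j) with hx
    have h1 : b / a + 1 ≤ x := (Nat.le_add_right _ j).trans (grid_strictMono a b).le_apply
    have h2 : b ≤ x * a := by
      have h3 : b < a * (b / a + 1) := Nat.lt_mul_div_succ b ha
      calc b ≤ a * (b / a + 1) := h3.le
        _ ≤ a * x := Nat.mul_le_mul_left _ h1
        _ = x * a := mul_comm _ _
    have h3 : x * a ≤ 2 * (x * a / b) * b := by
      have h4 := Nat.lt_mul_div_succ (x * a) (ha.trans_le hab)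
      have h5 : 1 ≤ x * a / b := (Nat.one_le_div_iff (ha.trans_le hab)).2 h2
      nlinarith
    have h4 : (x : ℝ) * (a / b / 2) ≤ (x * a / b : ℕ) := by
      rw [div_div, mul_div_assoc', div_le_iff₀ (by positivity)]
      have : ((x * a : ℕ) : ℝ) ≤ (2 * (x * a / b) * b : ℕ) := by exact_mod_cast h3
      push_cast at this ⊢
      linarith
    rw [← add_assoc, grid, ← hx]
    have h5 : ((x * a / b : ℕ) : ℝ) ≤ (max 1 (x * a / b) : ℕ) := by exact_mod_cast le_max_right _ _
    have h6 : 0 ≤ (a : ℝ) / b / 2 := by positivity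
    rw [pow_succ]
    calc (1 + (a : ℝ) / b / 2) ^ j * (1 + (a : ℝ) / b / 2) ≤ x * (1 + (a : ℝ) / b / 2) := by gcongr
      _ ≤ ((x + max 1 (x * a / b) : ℕ) : ℝ) := by push_cast at h5 ⊢; linarith

/-- The first `b / a` or so points may grow by ones; after them the growth is geometric, so reaching
`2 x` takes logarithmically many further points. -/
theorem gridSize_le (ha : 0 < a) (hab : a ≤ b) {x : ℕ} (hx : 2 ≤ x) :
    (gridSize a b (2 * x) : ℝ) ≤ 3 + b / a + 4 * (b / a) * Real.logb 2 x := by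
  have ha' : (0 : ℝ) < a := by exact_mod_cast ha
  have hb : (0 : ℝ) < b := by exact_mod_cast ha.trans_le hab
  have hx' : (2 : ℝ) ≤ x := by exact_mod_cast hx
  have hL : 1 ≤ Real.logb 2 x := by
    rw [Real.le_logb_iff_rpow_le (by norm_num) (by linarith)]
    simpa using hx'
  have hq : ((b / a : ℕ) : ℝ) ≤ b / a := Nat.cast_div_le
  have hba : 0 ≤ (b : ℝ) / a := by positivity
  by_cases hm : gridSize a b (2 * x) ≤ b / a + 3
  · have : (gridSize a b (2 * x) : ℝ) ≤ (b / a : ℕ) + 3 := by exact_mod_cast hm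
    nlinarith
  · obtain ⟨j, hj⟩ : ∃ j, gridSize a b (2 * x) = b / a + 3 + j :=
      ⟨gridSize a b (2 * x) - (b / a + 3), by omega⟩
    -- This is the last but one point of the grid, hence still below the target.
    have h1 : grid a b (b / a + 1 + j) < 2 * x := grid_lt (by omega)
    have h2 := (grid_growth ha hab j).trans (by exact_mod_cast h1.le :
      (grid a b (b / a + 1 + j) : ℝ) ≤ (2 * x : ℕ))
    have hδ0 : 0 ≤ (a : ℝ) / b / 2 := by positivity
    have hδ1 : (a : ℝ) / b / 2 ≤ 1 := by
      have : (a : ℝ) / b ≤ 1 := (div_le_one hb).2 (by exact_mod_cast hab)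
      linarith
    have h3 : j * ((a : ℝ) / b / 2) ≤ 2 * Real.logb 2 x := by
      calc j * ((a : ℝ) / b / 2) ≤ j * Real.logb 2 (1 + a / b / 2) := by
            gcongr; exact le_logb_one_add hδ0 hδ1
        _ = Real.logb 2 ((1 + (a : ℝ) / b / 2) ^ j) := by rw [Real.logb_pow]
        _ ≤ Real.logb 2 ((2 * x : ℕ) : ℝ) := Real.logb_le_logb_of_le (by norm_num) (by positivity) h2
        _ = 1 + Real.logb 2 x := by
            push_cast
            rw [Real.logb_mul (by norm_num) (by linarith), Real.logb_self_eq_one (by norm_num)]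
        _ ≤ 2 * Real.logb 2 x := by linarith
    have h4 : (j : ℝ) ≤ 4 * (b / a) * Real.logb 2 x := by
      have h5 : (j : ℝ) = j * ((a : ℝ) / b / 2) * (2 * (b / a)) := by field_simp
      rw [h5]
      calc j * ((a : ℝ) / b / 2) * (2 * (b / a)) ≤ 2 * Real.logb 2 x * (2 * (b / a)) := by gcongr
        _ = 4 * (b / a) * Real.logb 2 x := by ring
    rw [hj]
    push_cast
    linarith

theorem one_lt_gridSize {x : ℕ} (hx : 0 < x) : 1 < gridSize a b x := lt_gridSize (i := 0) hx

theorem gridSize_le_self (x : ℕ) : gridSize a b x ≤ x + 1 := by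
  by_contra h
  have h1 : grid a b x < x := grid_lt (by omega)
  exact absurd ((grid_strictMono a b).le_apply (x := x)) (not_le.2 h1)

/-- The point before the last is below `x`, and for `a ≤ b` a step is at most `1` or the point
itself. -/
theorem grid_last_le (hab : a ≤ b) {x : ℕ} (hx : 0 < x) :
    grid a b (gridSize a b x - 1) ≤ 2 * x := by
  obtain ⟨i, hi⟩ : ∃ i, gridSize a b x - 1 = i + 1 := ⟨gridSize a b x - 2, by
    have := one_lt_gridSize (a := a) (b := b) hx
    omega⟩
  have h1 : grid a b i < x := grid_lt (by omega)
  have h2 : grid a b i * a / b ≤ grid a b i := by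
    rcases Nat.eq_zero_or_pos b with rfl | hb
    · simp
    · exact Nat.div_le_of_le_mul (by rw [mul_comm]; exact Nat.mul_le_mul_right _ hab)
  rw [hi, grid]
  omega

end Grid

theorem nonLeafCount_le {n : ℕ} (G : SimpleGraph (Fin n)) : nonLeafCount G ≤ n := by
  rw [nonLeafCount]
  exact (Set.ncard_le_card _).trans_eq (by simp)

theorem big_of_le {n β N : ℕ} {A : Setup n} (hn : n + 3 ≤ β) (hn1 : 1 ≤ n) (hk : 1 ≤ A.k)
    (hc : ∑ v, A.c v ≤ β) (hw : ∑ v, A.w v ≤ β) (hm : A.m ≤ β ^ 2) (hg : A.g (A.m - 1) ≤ β ^ 2)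
    (hN : N = β ^ (10 * A.k)) : Big A N := by
  have h4 : 4 ≤ β := by omega
  have hNk : ∀ i, i ≤ 10 → β ^ i ≤ N := fun i hi =>
    hN ▸ Nat.pow_le_pow_right (by omega) (by omega)
  have e2 : β ^ 2 = β * β := sq β
  have e3 : β ^ 3 = β * β ^ 2 := by ring
  have e4 : β ^ 4 = β * β ^ 3 := by ring
  have e5 : β ^ 5 = β * β ^ 4 := by ring
  have e6 : β ^ 6 = β * β ^ 5 := by ring
  have e7 : β ^ 7 = β * β ^ 6 := by ring
  have e8 : β ^ 8 = β * β ^ 7 := by ring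
  have step : ∀ x, 4 * x ≤ β * x := fun x => Nat.mul_le_mul_right _ h4
  have s2 := step β
  have s3 := step (β ^ 2)
  have s4 := step (β ^ 3)
  have s5 := step (β ^ 4)
  have s6 := step (β ^ 5)
  have s7 := step (β ^ 6)
  have s8 := step (β ^ 7)
  have hT : A.maxTotal ≤ β ^ 4 := by
    have : n * A.g (A.m - 1) ≤ β * β ^ 2 := Nat.mul_le_mul (by omega) hg
    rw [Setup.maxTotal]
    omega
  have hS : A.maxStep ≤ β * (2 * β ^ 4) := by
    rw [Setup.maxStep]
    exact Nat.mul_le_mul hw (by omega)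
  refine ⟨?_, ?_, ?_, hm.trans (hNk 2 (by norm_num)), hT.trans (hNk 4 (by norm_num)), ?_⟩
  · have h1 : n * n * (n + 1) ≤ β * β * β :=
      Nat.mul_le_mul (Nat.mul_le_mul (by omega) (by omega)) (by omega)
    have h2 : β * β * β = β ^ 3 := by ring
    have := hNk 4 (by norm_num)
    omega
  · rw [hN]
    exact (Nat.pow_le_pow_left (by omega) _).trans (Nat.pow_le_pow_right (by omega) (by omega))
  · rw [hN]
    refine (Nat.pow_le_pow_left hm _).trans ?_
    rw [← pow_mul]
    exact Nat.pow_le_pow_right (by omega) (by omega)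
  · have h1 : (n + 2) * A.maxStep ≤ β * (β * (2 * β ^ 4)) := Nat.mul_le_mul (by omega) hS
    have h2 : β * (β * (2 * β ^ 4)) = 2 * β ^ 6 := by ring
    have := hNk 8 (by norm_num)
    omega

theorem toNat_num_le_den {ε : ℚ} (h : ε ≤ 1) : ε.num.toNat ≤ ε.den := by
  have := (Rat.le_iff _ _).1 h
  simp only [Rat.den_ofNat, Rat.num_ofNat, Nat.cast_one, mul_one, one_mul] at this
  omega

theorem inputState_bounded {n β N : ℕ} {ε : ℚ} (h1 : ε ≤ 1) {G : SimpleGraph (Fin n)}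
    {c w : Fin n → ℕ} (hβ : n + ∑ v, c v + ∑ v, w v + ε.den = β) (hβN : β ≤ N) :
    (inputState ε G c w).Bounded N := by
  have hd : 1 ≤ ε.den := ε.pos
  have hnum := toNat_num_le_den h1
  have hc : ∀ v, c v ≤ ∑ v, c v := fun v =>
    Finset.single_le_sum (f := c) (fun _ _ => Nat.zero_le _) (Finset.mem_univ v)
  have hw : ∀ v, w v ≤ ∑ v, w v := fun v =>
    Finset.single_le_sum (f := w) (fun _ _ => Nat.zero_le _) (Finset.mem_univ v)
  refine ⟨fun x => ?_, fun a i => ?_⟩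
  · simp only [inputState]
    split_ifs <;> omega
  · simp only [inputState]
    split_ifs with h1 h2 h3 h4 h5 h6
    · omega
    · omega
    · have := hc ⟨i, h4⟩; omega
    · omega
    · have := hw ⟨i, h6⟩; omega
    · omega
    · omega

/-- The dominating term is the number of pairs of guesses times the size of the table times `n`;
every other term is compared with `(n * n) * (U * U)`, where `U = (23 * R) ^ k` bounds `m`, `m ^ k`
and `n`. -/
theorem time_le {n k m t : ℕ} {R : ℝ} (hn : 1 ≤ n) (hk : 1 ≤ k) (hnR : (n : ℝ) ≤ R)
    (hm : (m : ℝ) ≤ 23 * R)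
    (ht : t ≤ m * (n * (m * 19 + 23) + 14) + m * 34 + n * (n * 79) + n * 91 + 72 +
      (n ^ k * (m ^ k * (m ^ k * (n * n) * 161 + n * n * n * 650 + 8) + 14) + 8)) :
    (t : ℝ) ≤ 1200 * ((n : ℝ) ^ (k + 2) * (23 * R) ^ (2 * k)) := by
  have hn' : (1 : ℝ) ≤ n := by exact_mod_cast hn
  set U : ℝ := (23 * R) ^ k with hU
  have hRU : 23 * R ≤ U := le_self_pow₀ (by linarith) (by omega)
  have hM : (m : ℝ) ^ k ≤ U := pow_le_pow_left₀ (by positivity) hm k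
  have hp : (1 : ℝ) ≤ (n : ℝ) ^ k := one_le_pow₀ hn'
  have ht' : (t : ℝ) ≤ m * (n * (m * 19 + 23) + 14) + m * 34 + n * (n * 79) + n * 91 + 72 +
      ((n : ℝ) ^ k * ((m : ℝ) ^ k * ((m : ℝ) ^ k * (n * n) * 161 + n * n * n * 650 + 8) + 14) + 8) := by
    exact_mod_cast ht
  refine ht'.trans ?_
  have hX : (n : ℝ) ^ (k + 2) * (23 * R) ^ (2 * k) = (n : ℝ) ^ k * ((n * n) * (U * U)) := by
    rw [hU]; ring
  rw [hX]
  generalize (n : ℝ) ^ k = p at hp ⊢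
  have hm0 : (0 : ℝ) ≤ m := Nat.cast_nonneg m
  have hM0 : (0 : ℝ) ≤ (m : ℝ) ^ k := by positivity
  generalize (m : ℝ) ^ k = M at hM hM0 ⊢
  have hmU : (m : ℝ) ≤ U := hm.trans hRU
  have hnU : (n : ℝ) ≤ U := by linarith
  clear_value U
  clear hX ht' hm ht hnR hRU hU
  generalize (n : ℝ) = n at hn' hnU ⊢
  generalize (m : ℝ) = m at hm0 hmU ⊢
  have hU1 : 1 ≤ U := hn'.trans hnU
  have hnn : 1 ≤ n * n := one_le_mul_of_one_le_of_one_le hn' hn'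
  have hUU : U ≤ U * U := le_mul_of_one_le_left (by linarith) hU1
  have hnn' : n ≤ n * n := le_mul_of_one_le_left (by linarith) hn'
  set Z := (n * n) * (U * U) with hZ
  have z1 : 1 ≤ Z := one_le_mul_of_one_le_of_one_le hnn (hU1.trans hUU)
  have z2 : n * n ≤ Z := le_mul_of_one_le_right (by linarith) (hU1.trans hUU)
  have z3 : U * U ≤ Z := le_mul_of_one_le_left (by linarith) hnn
  have z4 : m * n * m ≤ Z := by
    calc m * n * m = n * (m * m) := by ring
      _ ≤ (n * n) * (U * U) := by gcongr
  have z5 : m * n ≤ Z := by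
    calc m * n = n * m := by ring
      _ ≤ (n * n) * (U * U) := by gcongr; exact hmU.trans hUU
  have z6 : M * (M * (n * n)) ≤ Z := by
    calc M * (M * (n * n)) = (n * n) * (M * M) := by ring
      _ ≤ (n * n) * (U * U) := by gcongr
  have z7 : M * (n * n * n) ≤ Z := by
    calc M * (n * n * n) = (n * n) * (M * n) := by ring
      _ ≤ (n * n) * (U * U) := by gcongr
  have z8 : M * 8 ≤ 8 * Z := by linarith
  have hpZ : Z ≤ p * Z := le_mul_of_one_le_left (by linarith) hp
  -- The constant is `161 + 650 + 8 + 14`. Together with the cost of the preparation and the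
  -- remaining `8` this stays below `1200`.
  have hin : p * (M * (M * (n * n) * 161 + n * n * n * 650 + 8) + 14) ≤ p * (833 * Z) := by
    gcongr
    nlinarith
  nlinarith

/-- The algorithm on an instance. -/
theorem exists_run {n k : ℕ} {ε : ℚ} (h0 : 0 < ε) (h1 : ε ≤ 1) {G : SimpleGraph (Fin n)}
    {c w : Fin n → ℕ} (hG : G.Connected) (hk : nonLeafCount G = k) (hk1 : 1 ≤ k)
    (hc : 2 ≤ ∑ v, c v) :
    ∃ (t : ℕ) (σ : State) (D : DecisionTree G Set.univ),
      Exec ((n + ∑ v, c v + ∑ v, w v + ε.den) ^ (640 * k)) algorithm (inputState ε G c w) t σ ∧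
      Outputs σ D ∧
      (∀ D' : DecisionTree G Set.univ, (D.cost c w : ℝ) ≤ (1 + (ε : ℝ)) * D'.cost c w) ∧
      (t : ℝ) ≤ 1200 * ((n : ℝ) ^ (k + 2) * (23 * (n * Real.logb 2 (∑ v, (c v : ℝ)) /
        Real.logb 2 (1 + (ε : ℝ)))) ^ (2 * k)) := by
  have hkn : k ≤ n := hk ▸ nonLeafCount_le G
  have hn : 1 ≤ n := hk1.trans hkn
  have : NeZero n := ⟨by omega⟩
  have hex : ∃ v, (G.neighborSet v).ncard ≠ 1 := by
    by_contra! h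
    have : nonLeafCount G = 0 := by simp [nonLeafCount, h]
    omega
  have hA := setup_valid ε c w hG hex
  have hgrid := setup_grid ε h0 hA
  have hAk : (setup ε G c w).k = k := hk
  have hAm : (setup ε G c w).m = gridSize ε.num.toNat (2 * n * ε.den) (2 * ∑ v, c v) := rfl
  have hAg : (setup ε G c w).g = grid ε.num.toNat (2 * n * ε.den) := rfl
  have hd : 1 ≤ ε.den := ε.pos
  have hnum0 : 0 < ε.num := Rat.num_pos.2 h0
  have hnum := toNat_num_le_den h1
  have hab : ε.num.toNat ≤ 2 * n * ε.den := hnum.trans (Nat.le_mul_of_pos_left _ (by omega))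
  have hε : (ε : ℝ) = (ε.num.toNat : ℝ) / ε.den := by
    conv_lhs => rw [← Rat.num_div_den ε]
    push_cast
    congr 1
    exact_mod_cast (Int.toNat_of_nonneg hnum0.le).symm
  have hε0 : (0 : ℝ) < ε := by exact_mod_cast h0
  have hε1 : (ε : ℝ) ≤ 1 := by exact_mod_cast h1
  have hβ4 : n + 3 ≤ n + ∑ v, c v + ∑ v, w v + ε.den := by omega
  have hcβ : ∑ v, c v + 2 ≤ n + ∑ v, c v + ∑ v, w v + ε.den := by omega
  have hwβ : ∑ v, w v ≤ n + ∑ v, c v + ∑ v, w v + ε.den := by omega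
  have hdβ : ε.den ≤ n + ∑ v, c v + ∑ v, w v + ε.den := by omega
  have hin := fun N => inputState_bounded (N := N) h1 (G := G) (c := c) (w := w) rfl
  generalize n + ∑ v, c v + ∑ v, w v + ε.den = β at hβ4 hcβ hwβ hdβ hin ⊢
  have hββ : 4 * β ≤ β ^ 2 := by rw [sq]; exact Nat.mul_le_mul_right _ (by omega)
  have hbig : Big (setup ε G c w) (β ^ (10 * k)) := by
    refine big_of_le hβ4 hn (hAk ▸ hk1) ?_ hwβ ?_ ?_ (by rw [hAk])
    · exact (show ∑ v, c v ≤ β by omega)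
    · rw [hAm]
      refine (gridSize_le_self _).trans ?_
      omega
    · rw [hAm, hAg]
      refine (grid_last_le hab (by omega)).trans ?_
      omega
  have hpow : ∀ i, i ≤ 10 → β ^ i ≤ β ^ (10 * k) := fun i hi =>
    Nat.pow_le_pow_right (by omega) (by omega)
  have h2nd : 2 * n * ε.den ≤ β ^ (10 * k) := by
    refine le_trans ?_ (hpow 3 (by norm_num))
    calc 2 * n * ε.den ≤ β * β * β := Nat.mul_le_mul (Nat.mul_le_mul (by omega) (by omega)) hdβ
      _ = β ^ 3 := by ring
  obtain ⟨t, σ, hrun, ht, D, hD, hmin⟩ :=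
    Wp.seq _ _ (Wp.prepare hG hex hbig h2nd le_rfl) le_rfl
      (fun τ _ hE => Wp.search hE hA hbig hG hn le_rfl)
  have h64 : 64 ≤ β ^ (10 * k) := by
    refine le_trans ?_ (hpow 3 (by norm_num))
    calc 64 = 4 ^ 3 := by norm_num
      _ ≤ β ^ 3 := Nat.pow_le_pow_left (by omega) _
  -- All expressions of the program have size and constants at most `64`, and memory contents are at
  -- most `β ^ (10 k)`; this is the source of the exponent `640 k`.
  have hexec := (hrun.exec (s := 64) (by omega) h64 (by decide)
    (hin _ (by simpa using hpow 1 (by norm_num)))).1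
  rw [← pow_mul, show 10 * k * 64 = 640 * k by ring] at hexec
  refine ⟨t, σ, D, hexec, hD, fun D' => ?_, ?_⟩
  · obtain ⟨P, hP, S, hS, hle⟩ := Setup.value_le hA D' (δ := (ε : ℝ) / (2 * n)) (ε := ε)
      (by positivity) hε1 (one_add_div_pow_le hε0.le hε1 hn) hgrid
    refine le_trans ?_ hle
    exact_mod_cast hmin P hP S hS
  · have hl1 := logb_one_add_le hε0.le
    have hl2 := (le_logb_one_add hε0.le hε1)
    have hl0 : 0 < Real.logb 2 (1 + (ε : ℝ)) := hε0.trans_le hl2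
    have hl3 : Real.logb 2 (1 + (ε : ℝ)) ≤ 1 := by
      rw [Real.logb_le_iff_le_rpow (by norm_num) (by linarith)]
      norm_num
      linarith
    have hC : ((∑ v, c v : ℕ) : ℝ) = ∑ v, (c v : ℝ) := by push_cast; rfl
    have hC2 : (2 : ℝ) ≤ ∑ v, (c v : ℝ) := by rw [← hC]; exact_mod_cast hc
    have hL : 1 ≤ Real.logb 2 (∑ v, (c v : ℝ)) := by
      rw [Real.le_logb_iff_rpow_le (by norm_num) (by linarith)]
      simpa using hC2
    have hm := gridSize_le (a := ε.num.toNat) (b := 2 * n * ε.den) (by omega) hab hc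
    rw [← hAm, hC] at hm
    have hb : ((2 * n * ε.den : ℕ) : ℝ) / (ε.num.toNat : ℝ) = 2 * n / ε := by
      rw [hε]
      push_cast
      field_simp
    rw [hb] at hm
    generalize Real.logb 2 (∑ v, (c v : ℝ)) = L at hL hm ⊢
    generalize Real.logb 2 (1 + (ε : ℝ)) = l at hl0 hl1 hl3 ⊢
    have hn' : (1 : ℝ) ≤ n := by exact_mod_cast hn
    have hnR : (n : ℝ) ≤ n * L / l := by
      rw [le_div_iff₀ hl0]
      nlinarith
    have hbR : 2 * n / (ε : ℝ) * L ≤ 4 * (n * L / l) := by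
      rw [div_mul_eq_mul_div, mul_div_assoc', div_le_div_iff₀ hε0 hl0]
      have : 0 ≤ (n : ℝ) * L := by positivity
      nlinarith
    have hb0 : 0 ≤ 2 * n / (ε : ℝ) := by positivity
    have hb1 : 2 * n / (ε : ℝ) ≤ 2 * n / (ε : ℝ) * L := le_mul_of_one_le_right hb0 hL
    -- With `R = n L / l`, the bound for the grid is at most `3 R + 4 R + 16 R`, since `2 n / ε * L
    -- ≤ 4 R` by `l ≤ 2 ε`. This gives the constant `23`.
    refine time_le (m := (setup ε G c w).m) hn hk1 hnR ?_ ?_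
    · nlinarith
    · rw [hAk] at ht
      exact ht

end GraphSearch

/-! ### The two running time bounds -/

theorem mainTheorem6 :
    ∃ (P : GraphSearch.Program) (A : ℕ) (C : ℝ),
      ∀ ε : ℚ, 0 < ε → ε ≤ 1 → ∃ Cε : ℝ,
        ∀ (n k : ℕ) (G : SimpleGraph (Fin n)) (c w : Fin n → ℕ),
          G.Connected → GraphSearch.nonLeafCount G = k → 1 ≤ k → 2 ≤ ∑ v, c v →
          ∃ (t : ℕ) (σ : GraphSearch.State) (D : GraphSearch.DecisionTree G Set.univ),
            GraphSearch.Exec ((n + ∑ v, c v + ∑ v, w v + ε.den) ^ (A * k)) P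
              (GraphSearch.inputState ε G c w) t σ ∧
            GraphSearch.Outputs σ D ∧
            (∀ D' : GraphSearch.DecisionTree G Set.univ,
              (D.cost c w : ℝ) ≤ (1 + (ε : ℝ)) * (D'.cost c w : ℝ)) ∧
            (t : ℝ) ≤ C * (k * (n : ℝ) ^ (4 * k + 2) *
              Real.logb 2 (∑ v, (c v : ℝ)) ^ (2 * k) /
              Real.logb 2 (1 + (ε : ℝ)) ^ (2 * k)) ∧
            (t : ℝ) ≤ Cε * (k * (n : ℝ) ^ (4 * k + 2) *
              Real.logb 2 (∑ v, (c v : ℝ)) ^ (2 * k) /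
              Real.logb 2 (1 + (ε : ℝ)) ^ k) := by
  -- The constant `529` is `23 ^ 2`, the base of the exponential factor in the time bound of
  -- `exists_run`.
  obtain ⟨K, hK0, hK⟩ := GraphSearch.exists_pow_le (x := 529) (by norm_num)
  refine ⟨GraphSearch.algorithm, 640, 1200 * K, fun ε h0 h1 => ?_⟩
  have hε0 : (0 : ℝ) < ε := by exact_mod_cast h0
  have hε1 : (ε : ℝ) ≤ 1 := by exact_mod_cast h1
  have hl0 : 0 < Real.logb 2 (1 + (ε : ℝ)) :=
    hε0.trans_le (GraphSearch.le_logb_one_add hε0.le hε1)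
  have hl1 := GraphSearch.logb_one_add_le hε0.le
  have hx : 1 ≤ 529 / Real.logb 2 (1 + (ε : ℝ)) := by
    rw [one_le_div hl0]
    linarith
  -- For fixed `ε`, one half of the powers of `1 / log (1 + ε)` is treated as part of the constant
  -- and is absorbed by `n ^ k` too. The resulting constant depends on `ε` only.
  obtain ⟨K', hK'0, hK'⟩ := GraphSearch.exists_pow_le hx
  refine ⟨1200 * K', fun n k G c w hG hk hk1 hc => ?_⟩
  obtain ⟨t, σ, D, hexec, hD, hopt, ht⟩ := GraphSearch.exists_run h0 h1 (w := w) hG hk hk1 hc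
  have hkn : k ≤ n := hk ▸ GraphSearch.nonLeafCount_le G
  have hk' : (1 : ℝ) ≤ k := by exact_mod_cast hk1
  have hL2 : 0 ≤ Real.logb 2 (∑ v, (c v : ℝ)) ^ (2 * k) := by
    rw [pow_mul]
    positivity
  have hKn := hK n k hkn
  have hK'n := hK' n k hkn
  generalize Real.logb 2 (∑ v, (c v : ℝ)) = L at ht hL2 ⊢
  generalize Real.logb 2 (1 + (ε : ℝ)) = l at ht hl0 hK'n ⊢
  refine ⟨t, σ, D, hexec, hD, hopt, ht.trans ?_, ht.trans ?_⟩
  · have h : (n : ℝ) ^ (k + 2) * (23 * (n * L / l)) ^ (2 * k) =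
        529 ^ k * ((n : ℝ) ^ (3 * k + 2) * L ^ (2 * k) / l ^ (2 * k)) := by
      rw [mul_pow, div_pow, mul_pow, pow_mul (23 : ℝ)]
      norm_num
      ring
    rw [h, mul_assoc]
    have h2 : 0 ≤ (n : ℝ) ^ (3 * k + 2) * L ^ (2 * k) / l ^ (2 * k) := by positivity
    refine mul_le_mul_of_nonneg_left ?_ (by norm_num)
    calc 529 ^ k * ((n : ℝ) ^ (3 * k + 2) * L ^ (2 * k) / l ^ (2 * k))
        ≤ K * (n : ℝ) ^ k * ((n : ℝ) ^ (3 * k + 2) * L ^ (2 * k) / l ^ (2 * k)) := by gcongr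
      _ ≤ k * (K * (n : ℝ) ^ k * ((n : ℝ) ^ (3 * k + 2) * L ^ (2 * k) / l ^ (2 * k))) :=
        le_mul_of_one_le_left (by positivity) hk'
      _ = _ := by ring
  · have h : (n : ℝ) ^ (k + 2) * (23 * (n * L / l)) ^ (2 * k) =
        (529 / l) ^ k * ((n : ℝ) ^ (3 * k + 2) * L ^ (2 * k) / l ^ k) := by
      rw [mul_pow, div_pow, mul_pow, pow_mul (23 : ℝ), div_pow, show 2 * k = k + k by ring,
        pow_add l]
      norm_num
      field_simp
      ring
    rw [h, mul_assoc]
    have h2 : 0 ≤ (n : ℝ) ^ (3 * k + 2) * L ^ (2 * k) / l ^ k := by positivity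
    refine mul_le_mul_of_nonneg_left ?_ (by norm_num)
    calc (529 / l) ^ k * ((n : ℝ) ^ (3 * k + 2) * L ^ (2 * k) / l ^ k)
        ≤ K' * (n : ℝ) ^ k * ((n : ℝ) ^ (3 * k + 2) * L ^ (2 * k) / l ^ k) := by gcongr
      _ ≤ k * (K' * (n : ℝ) ^ k * ((n : ℝ) ^ (3 * k + 2) * L ^ (2 * k) / l ^ k)) :=
        le_mul_of_one_le_left (by positivity) hk'
      _ = _ := by ring
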